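/- Let $k=\mathbb R$ or $k=\mathbb C$. A super algebra is a finite-dimensional $\mathbb Z/2$-graded unital associative $k$-algebra $A=A_0\oplus A_1$. For super algebras $A$, $B$, an $A$-$B$-bimodule is a finite-dimensional $\mathbb Z/2$-graded $k$-vector space with commuting $k$-bilinear grading-compatible actions of $A$ from the left and of $B$ from the right; isomorphisms of bimodules are grading-preserving. An $A$-$B$-bimodule $M$ is invertible if there is a $B$-$A$-bimodule $N$ with $M\otimes_B N\cong A$ and $N\otimes_A M\cong B$ as bimodules. $\mathrm{Aut}(A)$ is the Lie group of grading-preserving $k$-algebra automorphisms of $A$, and $A_0^\times$ is the Lie group of even invertible elements. $A$ is Picard-surjective if every invertible $A$-$A$-bimodule is isomorphic to $A_\varphi$ for some $\varphi\in\mathrm{Aut}(A)$, where $A_\varphi$ is $A$ with left multiplication and right action $x\cdot a=x\,\varphi(a)$. $\mathrm{AUT}(A)$ is the crossed module of Lie groups given by $i:A_0^\times\to\mathrm{Aut}(A)$, $i(a)(x)=axa^{-1}$, and by the action of $\mathrm{Aut}(A)$ on $A_0^\times$ by evaluation. For a crossed module $\Gamma=(t:H\to G)$ with action $(g,h)\mapsto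 {}^g h$ and a smooth manifold $X$, $\check{\mathrm H}^1(X,\Gamma)$ is the set of equivalence classes of cocycles: a cocycle consists of an open cover $(U_\alpha)$ and smooth maps $g_{\alpha\beta}:U_\alpha\cap U_\beta\to G$, $a_{\alpha\beta\gamma}:U_\alpha\cap U_\beta\cap U_\gamma\to H$ with $t(a_{\alpha\beta\gamma})\,g_{\beta\gamma}\,g_{\alpha\beta}=g_{\alpha\gamma}$ and $a_{\alpha\gamma\delta}\,{}^{g_{\gamma\delta}}a_{\alpha\beta\gamma}=a_{\alpha\beta\delta}\,a_{\beta\gamma\delta}$; cocycles $(g,a)$, $(g',a')$ are equivalent if, on a common refinement, there are smooth maps $h_\alpha:U_\alpha\to G$, $e_{\alpha\beta}:U_\alpha\cap U_\beta\to H$ with $t(e_{\alpha\beta})\,h_\beta\,g_{\alpha\beta}=g'_{\alpha\beta}\,h_\alpha$ and $a'_{\alpha\beta\gamma}\,{}^{g'_{\beta\gamma}}e_{\alpha\beta}\,e_{\beta\gamma}=e_{\alpha\gamma}\,{}^{h_\gamma}a_{\alpha\beta\gamma}$. An invertible butterfly (weak equivalence) between crossed modules $t_1:H_1\to G_1$ and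 $t_2:H_2\to G_2$ is a Lie group $K$ with Lie group homomorphisms $i_j:H_j\to K$, $p_j:K\to G_j$ ($j=1,2$) such that $p_j\circ i_j=t_j$, such that $1\to H_1\xrightarrow{i_1}K\xrightarrow{p_2}G_2\to 1$ and $1\to H_2\xrightarrow{i_2}K\xrightarrow{p_1}G_1\to1$ are short exact sequences of Lie groups, and such that $i_j({}^{p_j(x)}h)=x\,i_j(h)\,x^{-1}$ for all $x\in K$, $h\in H_j$. **Proposition.** Let $A$ and $B$ be Picard-surjective super algebras, let $M$ be an invertible $A$-$B$-bimodule, and let $X$ be a smooth manifold. (1) Let $K$ be the Lie group of triples $(\varphi,\psi,f)$ with $\varphi\in\mathrm{Aut}(A)$, $\psi\in\mathrm{Aut}(B)$ and $f$ an even linear automorphism of $M$ such that $f(amb)=\varphi(a)f(m)\psi(b)$ for all $a\in A$, $m\in M$, $b\in B$, a closed subgroup of $\mathrm{Aut}(A)\times\mathrm{Aut}(B)\times\mathrm{GL}(M)$. Then $K$, together with $i_1(a)=(i(a),\mathrm{id},m\mapsto am)$, $i_2(b)=(\mathrm{id},i(b),m\mapsto mb^{-1})$ and the projections $p_1(\varphi,\psi,f)=\varphi$,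 $p_2(\varphi,\psi,f)=\psi$, is an invertible butterfly between $\mathrm{AUT}(A)$ and $\mathrm{AUT}(B)$. (2) There is a unique bijection $\check{\mathrm H}^1(X,\mathrm{AUT}(A))\cong\check{\mathrm H}^1(X,\mathrm{AUT}(B))$ that sends the class of $(g,a)$ to the class of $(f,b)$ whenever, after passing to a refinement of the open cover, there are smooth maps $\tilde g_{\alpha\beta}:U_\alpha\cap U_\beta\to K$ with $p_1\circ\tilde g_{\alpha\beta}=g_{\alpha\beta}$, $p_2\circ\tilde g_{\alpha\beta}=f_{\alpha\beta}$ and $i_2(b_{\alpha\beta\gamma})=\tilde g_{\alpha\gamma}\,\tilde g_{\alpha\beta}^{-1}\,\tilde g_{\beta\gamma}^{-1}\,i_1(a_{\alpha\beta\gamma})^{-1}$. (3) In particular, $\check{\mathrm H}^1(X,\mathrm{AUT}(A))$ and $\check{\mathrm H}^1(X,\mathrm{AUT}(B))$ are in bijection whenever $A$ and $B$ are Morita equivalent Picard-surjective super algebras, that is, whenever an invertible $A$-$B$-bimodule exists. -/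

import Mathlib

open scoped Manifold ContDiff Topology

universe u v w

set_option linter.unusedSectionVars false

noncomputable section

/-! ### The closed subgroup theorem

Closed subgroups of the group of units of a finite-dimensional real algebra are Lie groups. -/

open NormedSpace

section Cartan
variable {𝔸 : Type*} [NormedRing 𝔸] [NormedAlgebra ℝ 𝔸] [FiniteDimensional ℝ 𝔸]

/-- The exponential of `x` as a unit. -/
def expUnit (x : 𝔸) : 𝔸ˣ :=
  haveI := FiniteDimensional.complete ℝ 𝔸
  letI := NormedAlgebra.restrictScalars ℚ ℝ 𝔸
  (isUnit_exp x).unit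

theorem coe_expUnit (x : 𝔸) : (expUnit x : 𝔸) = exp x := rfl

theorem contDiff_exp_real : ContDiff ℝ ω (exp : 𝔸 → 𝔸) := by
  have := FiniteDimensional.complete ℝ 𝔸
  exact contDiff_iff_contDiffAt.2 fun x => (exp_analytic (𝕂 := ℝ) x).contDiffAt

theorem expUnit_zsmul (z : ℤ) (x : 𝔸) : expUnit (z • x) = expUnit x ^ z := by
  have := FiniteDimensional.complete ℝ 𝔸
  let _ := NormedAlgebra.restrictScalars ℚ ℝ 𝔸
  have hn : ∀ (n : ℕ) (x : 𝔸), expUnit (n • x) = expUnit x ^ n := fun n x =>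
    Units.ext (by rw [Units.val_pow_eq_pow_val, coe_expUnit, coe_expUnit, exp_nsmul])
  have hneg : ∀ x : 𝔸, expUnit (-x) = (expUnit x)⁻¹ := fun x => by
    refine eq_inv_of_mul_eq_one_left (Units.ext ?_)
    rw [Units.val_mul, coe_expUnit, coe_expUnit, Units.val_one,
      ← exp_add_of_commute (Commute.neg_left (Commute.refl x)), neg_add_cancel, exp_zero]
  obtain ⟨n, rfl | rfl⟩ := z.eq_nat_or_neg
  · rw [zpow_natCast, natCast_zsmul, hn]
  · rw [zpow_neg, zpow_natCast, neg_smul, hneg, natCast_zsmul, hn]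

theorem expUnit_zero : expUnit (0 : 𝔸) = 1 := Units.ext (by rw [coe_expUnit, exp_zero]; rfl)

theorem continuous_expUnit : Continuous (expUnit : 𝔸 → 𝔸ˣ) := by
  have := FiniteDimensional.complete ℝ 𝔸
  rw [Units.isOpenEmbedding_val.isInducing.continuous_iff]
  exact contDiff_exp_real.continuous

/-- If `exp zₙ ∈ S` with `zₙ / tₙ → x` and `tₙ → 0⁺`, then `exp (s x) ∈ S` for all `s`. -/
theorem expUnit_mem_of_tendsto {S : Subgroup 𝔸ˣ} (hS : IsClosed (S : Set 𝔸ˣ))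
    {α : Type*} {l : Filter α} [l.NeBot] {t : α → ℝ} {z : α → 𝔸} {x : 𝔸} (ht : Filter.Tendsto t l (𝓝[>] 0))
    (hz : Filter.Tendsto (fun n => (t n)⁻¹ • z n) l (𝓝 x)) (hmem : ∀ᶠ n in l, expUnit (z n) ∈ S)
    (s : ℝ) : expUnit (s • x) ∈ S := by
  have ht0 : Filter.Tendsto t l (𝓝 0) := ht.mono_right nhdsWithin_le_nhds
  have htp : ∀ᶠ n in l, 0 < t n := ht (self_mem_nhdsWithin)
  have hfl : Filter.Tendsto (fun n => (⌊s / t n⌋ : ℝ) * t n) l (𝓝 s) := by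
    have h1 : Filter.Tendsto (fun n => s - t n) l (𝓝 s) := by
      simpa using tendsto_const_nhds.sub ht0
    refine tendsto_of_tendsto_of_tendsto_of_le_of_le' h1 (tendsto_const_nhds (x := s)) ?_ ?_
    · filter_upwards [htp] with n hn
      have := (Int.sub_one_lt_floor (s / t n)).le
      have := mul_le_mul_of_nonneg_right this hn.le
      rwa [sub_mul, one_mul, div_mul_cancel₀ _ hn.ne'] at this
    · filter_upwards [htp] with n hn
      have := mul_le_mul_of_nonneg_right (Int.floor_le (s / t n)) hn.le
      rwa [div_mul_cancel₀ _ hn.ne'] at this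
  have hlim := (continuous_expUnit.tendsto (s • x)).comp (hfl.smul hz)
  refine hS.mem_of_tendsto hlim ?_
  filter_upwards [htp, hmem] with n hn hm
  have : ((⌊s / t n⌋ : ℝ) * t n) • (t n)⁻¹ • z n = ⌊s / t n⌋ • z n := by
    rw [smul_smul, mul_assoc, mul_inv_cancel₀ hn.ne', mul_one, Int.cast_smul_eq_zsmul]
  simp only [Function.comp_apply, this, expUnit_zsmul]
  exact S.zpow_mem hm _

theorem hasStrictFDerivAt_exp_mul_exp {E₁ E₂ : Type*} [NormedAddCommGroup E₁] [NormedSpace ℝ E₁]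
    [NormedAddCommGroup E₂] [NormedSpace ℝ E₂] (f : E₁ →L[ℝ] 𝔸) (g : E₂ →L[ℝ] 𝔸) :
    HasStrictFDerivAt (fun p : E₁ × E₂ => exp (f p.1) * exp (g p.2)) (f.coprod g) 0 := by
  have := FiniteDimensional.complete ℝ 𝔸
  have h1 : HasStrictFDerivAt (fun p : E₁ × E₂ => exp (f p.1))
      ((1 : 𝔸 →L[ℝ] 𝔸).comp (f.comp (ContinuousLinearMap.fst ℝ E₁ E₂))) 0 := by
    have h := hasStrictFDerivAt_exp_zero (𝕂 := ℝ) (𝔸 := 𝔸)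
    rw [← map_zero (f.comp (ContinuousLinearMap.fst ℝ E₁ E₂))] at h
    exact h.comp (0 : E₁ × E₂) (f.comp (ContinuousLinearMap.fst ℝ E₁ E₂)).hasStrictFDerivAt
  have h2 : HasStrictFDerivAt (fun p : E₁ × E₂ => exp (g p.2))
      ((1 : 𝔸 →L[ℝ] 𝔸).comp (g.comp (ContinuousLinearMap.snd ℝ E₁ E₂))) 0 := by
    have h := hasStrictFDerivAt_exp_zero (𝕂 := ℝ) (𝔸 := 𝔸)
    rw [← map_zero (g.comp (ContinuousLinearMap.snd ℝ E₁ E₂))] at h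
    exact h.comp (0 : E₁ × E₂) (g.comp (ContinuousLinearMap.snd ℝ E₁ E₂)).hasStrictFDerivAt
  refine (h1.mul' h2).congr_fderiv ?_
  ext p <;> simp [exp_zero]

/-- The Lie algebra of a closed subgroup of the units of a finite-dimensional algebra. -/
def lieAlgOf (S : Subgroup 𝔸ˣ) (hS : IsClosed (S : Set 𝔸ˣ)) : Submodule ℝ 𝔸 where
  carrier := {x | ∀ s : ℝ, expUnit (s • x) ∈ S}
  zero_mem' s := by rw [smul_zero, expUnit_zero]; exact S.one_mem
  smul_mem' c x hx s := by rw [smul_smul]; exact hx _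
  add_mem' {x y} hx hy := by
    have := FiniteDimensional.complete ℝ 𝔸
    -- the local logarithm
    have hd : HasFDerivAt (exp : 𝔸 → 𝔸) ((ContinuousLinearEquiv.refl ℝ 𝔸 : 𝔸 ≃L[ℝ] 𝔸) : 𝔸 →L[ℝ] 𝔸) 0 :=
      (hasStrictFDerivAt_exp_zero (𝕂 := ℝ) (𝔸 := 𝔸)).hasFDerivAt
    have hs : HasStrictFDerivAt (exp : 𝔸 → 𝔸) ((ContinuousLinearEquiv.refl ℝ 𝔸 : 𝔸 ≃L[ℝ] 𝔸) : 𝔸 →L[ℝ] 𝔸) 0 :=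
      (hasStrictFDerivAt_exp_zero (𝕂 := ℝ) (𝔸 := 𝔸))
    set lg := hs.localInverse exp _ 0 with hlg
    have hl : HasStrictFDerivAt lg (ContinuousLinearMap.id ℝ 𝔸) (exp (0 : 𝔸)) := hs.to_localInverse
    have hr : ∀ᶠ u in 𝓝 (exp (0 : 𝔸)), exp (lg u) = u := hs.eventually_right_inverse
    have hl0 : lg (exp (0 : 𝔸)) = 0 := hs.localInverse_apply_image
    let X := ContinuousLinearMap.toSpanSingleton ℝ x
    let Y := ContinuousLinearMap.toSpanSingleton ℝ y
    have hc : HasFDerivAt (fun t : ℝ => exp (t • x) * exp (t • y)) (X + Y) 0 := by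
      have h := (hasStrictFDerivAt_exp_mul_exp X Y).hasFDerivAt
      have hdiag : HasFDerivAt (fun t : ℝ => (t, t))
        ((ContinuousLinearMap.id ℝ ℝ).prod (ContinuousLinearMap.id ℝ ℝ)) 0 :=
        (hasFDerivAt_id (0 : ℝ)).prodMk (hasFDerivAt_id 0)
      have h' := HasFDerivAt.comp (0 : ℝ) (g := fun p : ℝ × ℝ => exp (X p.1) * exp (Y p.2))
        (f := fun t : ℝ => (t, t)) h hdiag
      refine h'.congr_fderiv ?_
      ext; simp [X, Y]
    have h0 : exp ((0 : ℝ) • x) * exp ((0 : ℝ) • y) = exp (0 : 𝔸) := by simp [exp_zero]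
    have hz : HasDerivAt (fun t : ℝ => lg (exp (t • x) * exp (t • y))) (x + y) 0 := by
      have h := HasFDerivAt.comp (0 : ℝ) (g := lg) (f := fun t : ℝ => exp (t • x) * exp (t • y))
        (h0.symm ▸ hl.hasFDerivAt) hc
      have := h.hasDerivAt
      simpa [X, Y, Function.comp_def] using this
    refine expUnit_mem_of_tendsto hS (l := 𝓝[>] (0 : ℝ)) (t := id)
      (z := fun t => lg (exp (t • x) * exp (t • y))) Filter.tendsto_id ?_ ?_
    · have h := hz.tendsto_slope.mono_left (nhdsWithin_mono _ fun t (ht : 0 < t) => ht.ne')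
      refine h.congr fun t => ?_
      simp only [slope, vsub_eq_sub, sub_zero, h0, hl0, id]
    · have hev := (hc.continuousAt.tendsto.eventually (h0.symm ▸ hr)).filter_mono
        (nhdsWithin_le_nhds (s := Set.Ioi (0 : ℝ)))
      filter_upwards [hev] with t ht
      have : expUnit (lg (exp (t • x) * exp (t • y))) = expUnit (t • x) * expUnit (t • y) :=
        Units.ext (by simpa [coe_expUnit] using ht)
      rw [this]
      exact S.mul_mem (hx t) (hy t)

/-- A smooth chart, near the unit, of a closed subgroup `S` of `𝔸ˣ`: `v ↦ exp (emb v)` maps the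
open set `V` bijectively to `S ∩ O`, with inverse the restriction of the smooth map `lg`. -/
structure ExpChart (S : Subgroup 𝔸ˣ) where
  dim : ℕ
  emb : EuclideanSpace ℝ (Fin dim) →L[ℝ] 𝔸
  lg : 𝔸 → EuclideanSpace ℝ (Fin dim)
  O : Set 𝔸
  V : Set (EuclideanSpace ℝ (Fin dim))
  isOpen_O : IsOpen O
  isOpen_V : IsOpen V
  one_mem : (1 : 𝔸) ∈ O
  smooth_lg : ContDiffOn ℝ ∞ lg O
  exp_mem : ∀ v, expUnit (emb v) ∈ S
  exp_mem_O : ∀ v ∈ V, exp (emb v) ∈ O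
  lg_exp : ∀ v ∈ V, lg (exp (emb v)) = v
  lg_mem : ∀ s ∈ S, (s : 𝔸) ∈ O → lg s ∈ V
  exp_lg : ∀ s ∈ S, (s : 𝔸) ∈ O → exp (emb (lg s)) = s

/-- The closed subgroup theorem. -/
theorem nonempty_expChart (S : Subgroup 𝔸ˣ) (hS : IsClosed (S : Set 𝔸ˣ)) :
    Nonempty (ExpChart S) := by
  have := FiniteDimensional.complete ℝ 𝔸
  set 𝔤 := lieAlgOf S hS with h𝔤
  obtain ⟨𝔥, hc⟩ := Submodule.exists_isCompl 𝔤
  set L : EuclideanSpace ℝ (Fin (Module.finrank ℝ 𝔤)) ≃L[ℝ] 𝔤 :=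
    ContinuousLinearEquiv.ofFinrankEq (by simp) with hL
  let Φ : 𝔤 × 𝔥 → 𝔸 := fun p => exp (𝔤.subtypeL p.1) * exp (𝔥.subtypeL p.2)
  let e : (𝔤 × 𝔥) ≃L[ℝ] 𝔸 := (Submodule.prodEquivOfIsCompl 𝔤 𝔥 hc).toContinuousLinearEquiv
  have hd : HasStrictFDerivAt Φ (e : (𝔤 × 𝔥) →L[ℝ] 𝔸) 0 :=
    (hasStrictFDerivAt_exp_mul_exp 𝔤.subtypeL 𝔥.subtypeL).congr_fderiv (by ext p <;> simp [e])
  have hΦ : ContDiff ℝ ω Φ :=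
    (contDiff_exp_real.comp (𝔤.subtypeL.contDiff.comp contDiff_fst)).mul
      (contDiff_exp_real.comp (𝔥.subtypeL.contDiff.comp contDiff_snd))
  have hΦ0 : Φ 0 = 1 := by simp [Φ, exp_zero]
  -- near the origin, `exp x * exp y ∈ S` forces `y = 0`
  have key : ∀ᶠ y : 𝔥 in 𝓝 0, expUnit (y : 𝔸) ∈ S → y = 0 := by
    by_contra hcon
    rw [Filter.not_eventually] at hcon
    obtain ⟨y, hy0, hy⟩ := Filter.exists_seq_forall_of_frequently hcon
    simp only [Classical.not_imp] at hy
    have hpos : ∀ n, 0 < ‖y n‖ := fun n => norm_pos_iff.2 (hy n).2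
    have hsph : ∀ n, ‖y n‖⁻¹ • y n ∈ Metric.sphere (0 : 𝔥) 1 := fun n => by
      rw [mem_sphere_zero_iff_norm, norm_smul, norm_inv, norm_norm, inv_mul_cancel₀ (hpos n).ne']
    obtain ⟨x, hx, φ, hφ, hlim⟩ := (isCompact_sphere (0 : 𝔥) 1).tendsto_subseq hsph
    have ht : Filter.Tendsto (fun n => ‖y (φ n)‖) Filter.atTop (𝓝[>] 0) := by
      refine tendsto_nhdsWithin_iff.2 ⟨?_, Filter.Eventually.of_forall fun n => hpos _⟩
      simpa using (hy0.comp hφ.tendsto_atTop).norm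
    have hxg : (x : 𝔸) ∈ 𝔤 := fun s =>
      expUnit_mem_of_tendsto hS ht (z := fun n => (y (φ n) : 𝔸))
        ((continuous_subtype_val.tendsto x).comp hlim)
        (Filter.Eventually.of_forall fun n => (hy _).1) s
    have : (x : 𝔸) ∈ 𝔤 ⊓ 𝔥 := ⟨hxg, x.2⟩
    rw [hc.inf_eq_bot, Submodule.mem_bot] at this
    have hx1 : ‖x‖ = 1 := by simpa using hx
    rw [show x = 0 from Subtype.ext this, norm_zero] at hx1
    exact zero_ne_one hx1
  obtain ⟨W, hW, hWo, hW0⟩ := eventually_nhds_iff.1 key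
  let P : OpenPartialHomeomorph (𝔤 × 𝔥) 𝔸 := hd.toOpenPartialHomeomorph Φ
  have hP0 : (0 : 𝔤 × 𝔥) ∈ P.source := hd.mem_toOpenPartialHomeomorph_source
  have hPt : (1 : 𝔸) ∈ P.target := hΦ0 ▸ P.map_source hP0
  have hPs : P.symm 1 = 0 := by
    have := P.left_inv hP0
    rwa [show P 0 = 1 from hΦ0] at this
  have hsm : ContDiffAt ℝ ω P.symm 1 :=
    P.contDiffAt_symm (f₀' := e) hPt (by rw [hPs]; exact hd.hasFDerivAt) hΦ.contDiffAt
  obtain ⟨N, hN, hNo, hN1⟩ := eventually_nhds_iff.1 (hsm.eventually (by simp))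
  let O : Set 𝔸 := (P.target ∩ P.symm ⁻¹' (Set.univ ×ˢ W)) ∩ N
  have hO : IsOpen O :=
    (P.symm.isOpen_inter_preimage (isOpen_univ.prod hWo)).inter hNo
  have hemb : ∀ x : 𝔤, Φ (x, 0) = exp (x : 𝔸) := fun x => by simp [Φ, exp_zero]
  refine ⟨{ dim := _
            emb := 𝔤.subtypeL.comp L.toContinuousLinearMap
            lg := fun u => L.symm (P.symm u).1
            O := O
            V := {v | (L v, (0 : 𝔥)) ∈ P.source ∧ exp (L v : 𝔸) ∈ O}
            isOpen_O := hO
            isOpen_V := ?_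
            one_mem := ⟨⟨hPt, ?_⟩, hN1⟩
            smooth_lg := ?_
            exp_mem := ?_
            exp_mem_O := fun v hv => hv.2
            lg_exp := ?_
            lg_mem := ?_
            exp_lg := ?_ }⟩
  · refine (P.open_source.preimage (by fun_prop)).inter (hO.preimage ?_)
    exact contDiff_exp_real.continuous.comp (by fun_prop)
  · simp [hPs, hW0]
  · refine L.symm.contDiff.comp_contDiffOn (contDiff_fst.comp_contDiffOn ?_)
    exact fun u hu => ((hN u hu.2).of_le le_top).contDiffWithinAt
  · intro v
    have := (L v).2 1
    rwa [one_smul] at this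
  · intro v hv
    have h : P.symm (Φ (L v, 0)) = (L v, 0) := P.left_inv hv.1
    rw [hemb] at h
    change L.symm (P.symm (exp (L v : 𝔸))).1 = v
    rw [h, L.symm_apply_apply]
  all_goals
    intro s hs hsO
    have h1 : Φ (P.symm s) = s := P.right_inv hsO.1.1
    have h2 : (P.symm s).2 = 0 := by
      refine hW _ hsO.1.2.2 ?_
      have hs' : s = expUnit ((P.symm s).1 : 𝔸) * expUnit ((P.symm s).2 : 𝔸) := Units.ext h1.symm
      have hg : expUnit ((P.symm s).1 : 𝔸) ∈ S := by
        have := (P.symm s).1.2 1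
        rwa [one_smul] at this
      rw [hs', S.mul_mem_cancel_left hg] at hs
      exact hs
    have h3 : P.symm s = ((P.symm s).1, 0) := Prod.ext rfl h2
    have h4 : exp ((P.symm s).1 : 𝔸) = s := by rw [← hemb, ← h3, h1]
  · refine ⟨?_, ?_⟩
    · rw [L.apply_symm_apply, ← h3]
      exact P.map_target hsO.1.1
    · rw [L.apply_symm_apply, h4]
      exact hsO
  · change exp ((L (L.symm (P.symm s).1) : 𝔤) : 𝔸) = s
    rw [L.apply_symm_apply, h4]

end Cartan

section ClosedSubgroup
variable {𝔸 : Type*} [NormedRing 𝔸] [NormedAlgebra ℝ 𝔸] [FiniteDimensional ℝ 𝔸]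
  {G : Type*} [Group G] [TopologicalSpace G] {r : G →* 𝔸ˣ}

/-- The chosen chart at the unit of (the image of) a closed subgroup. -/
def expChart (hr : Topology.IsClosedEmbedding r) : ExpChart r.range :=
  (nonempty_expChart r.range (by rw [MonoidHom.coe_range]; exact hr.isClosed_range)).some

theorem val_isEmbedding (hr : Topology.IsClosedEmbedding r) :
    Topology.IsEmbedding (fun g => (r g : 𝔸)) :=
  have := FiniteDimensional.complete ℝ 𝔸
  Units.isOpenEmbedding_val.isEmbedding.comp hr.isEmbedding

/-- The logarithmic chart at the unit. -/
def chartOne (hr : Topology.IsClosedEmbedding r) :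
    OpenPartialHomeomorph G (EuclideanSpace ℝ (Fin (expChart hr).dim)) where
  toFun g := (expChart hr).lg (r g : 𝔸)
  invFun v := Function.invFun r (expUnit ((expChart hr).emb v))
  source := {g | (r g : 𝔸) ∈ (expChart hr).O}
  target := (expChart hr).V
  map_source' g hg := (expChart hr).lg_mem _ ⟨g, rfl⟩ hg
  map_target' v hv := by
    change (r (Function.invFun r _) : 𝔸) ∈ (expChart hr).O
    rw [Function.invFun_eq ((expChart hr).exp_mem v)]
    exact (expChart hr).exp_mem_O v hv
  left_inv' g hg := by
    apply hr.injective
    rw [Function.invFun_eq ((expChart hr).exp_mem _)]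
    exact Units.ext ((expChart hr).exp_lg _ ⟨g, rfl⟩ hg)
  right_inv' v hv := by
    rw [Function.invFun_eq ((expChart hr).exp_mem v)]
    exact (expChart hr).lg_exp v hv
  open_source := (expChart hr).isOpen_O.preimage (val_isEmbedding hr).continuous
  open_target := (expChart hr).isOpen_V
  continuousOn_toFun := (expChart hr).smooth_lg.continuousOn.comp
    (val_isEmbedding hr).continuous.continuousOn fun _ hg => hg
  continuousOn_invFun := by
    refine Continuous.continuousOn ?_
    rw [hr.isInducing.continuous_iff]
    have : (r ∘ fun v => Function.invFun r (expUnit ((expChart hr).emb v))) =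
        fun v => expUnit ((expChart hr).emb v) := by
      ext v : 1
      exact Function.invFun_eq ((expChart hr).exp_mem v)
    rw [this]
    exact continuous_expUnit.comp (expChart hr).emb.continuous

theorem isTopologicalGroup_of_embedding (hr : Topology.IsClosedEmbedding r) :
    IsTopologicalGroup G :=
  have := FiniteDimensional.complete ℝ 𝔸
  hr.isInducing.topologicalGroup r

/-- The charts are the left translates of the logarithmic chart at the unit. -/
def chartOf (hr : Topology.IsClosedEmbedding r) (g : G) :
    OpenPartialHomeomorph G (EuclideanSpace ℝ (Fin (expChart hr).dim)) :=
  have := isTopologicalGroup_of_embedding hr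
  (Homeomorph.mulLeft g⁻¹).toOpenPartialHomeomorph.trans (chartOne hr)

theorem mem_chartOf_source (hr : Topology.IsClosedEmbedding r) (g h : G) :
    h ∈ (chartOf hr g).source ↔ ((r g⁻¹ : 𝔸ˣ) * r h : 𝔸) ∈ (expChart hr).O := by
  simp [chartOf, chartOne]

theorem chartOf_apply (hr : Topology.IsClosedEmbedding r) (g h : G) :
    chartOf hr g h = (expChart hr).lg ((r g⁻¹ : 𝔸ˣ) * r h : 𝔸) := by
  simp [chartOf, chartOne]

theorem val_chartOf_symm (hr : Topology.IsClosedEmbedding r) (g : G)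
    (v : EuclideanSpace ℝ (Fin (expChart hr).dim)) :
    (r ((chartOf hr g).symm v) : 𝔸) = r g * exp ((expChart hr).emb v) := by
  have h : (chartOf hr g).symm v = g * Function.invFun r (expUnit ((expChart hr).emb v)) := by
    change g⁻¹⁻¹ * _ = _
    rw [inv_inv]
    rfl
  rw [h, map_mul, Function.invFun_eq ((expChart hr).exp_mem v)]
  rfl

/-- The charts of a closed linear group. -/
abbrev closedChartedSpace (hr : Topology.IsClosedEmbedding r) :
    ChartedSpace (EuclideanSpace ℝ (Fin (expChart hr).dim)) G where
  atlas := Set.range (chartOf hr)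
  chartAt := chartOf hr
  mem_chart_source g := by
    rw [mem_chartOf_source, ← Units.val_mul, ← map_mul]
    simpa using (expChart hr).one_mem
  chart_mem_atlas g := ⟨g, rfl⟩

theorem closed_isManifold (hr : Topology.IsClosedEmbedding r) :
    letI := closedChartedSpace hr
    IsManifold (𝓡 (expChart hr).dim) ∞ G := by
  let _ := closedChartedSpace hr
  refine isManifold_of_contDiffOn _ _ _ ?_
  rintro _ _ ⟨g, rfl⟩ ⟨g', rfl⟩
  simp only [modelWithCornersSelf_coe, modelWithCornersSelf_coe_symm, Function.id_comp,
    Function.comp_id, Set.preimage_id, Set.range_id, Set.inter_univ]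
  have hval : ∀ v, ((r g'⁻¹ : 𝔸ˣ) * r ((chartOf hr g).symm v) : 𝔸) =
      (r g'⁻¹ : 𝔸ˣ) * (r g * exp ((expChart hr).emb v)) := fun v => by rw [val_chartOf_symm]
  have hsm : ContDiff ℝ ∞ fun v => ((r g'⁻¹ : 𝔸ˣ) * (r g * exp ((expChart hr).emb v)) : 𝔸) :=
    contDiff_const.mul (contDiff_const.mul ((contDiff_exp_real.of_le le_top).comp
      (expChart hr).emb.contDiff))
  refine ((expChart hr).smooth_lg.comp hsm.contDiffOn ?_).congr ?_
  · intro v hv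
    have : (chartOf hr g).symm v ∈ (chartOf hr g').source := by
      simpa using hv.2
    rw [mem_chartOf_source, hval] at this
    exact this
  · intro v _
    change chartOf hr g' ((chartOf hr g).symm v) = _
    rw [chartOf_apply, hval]
    rfl

theorem contMDiff_val_closed (hr : Topology.IsClosedEmbedding r) :
    letI := closedChartedSpace hr
    ContMDiff (𝓡 (expChart hr).dim) 𝓘(ℝ, 𝔸) ∞ fun g => (r g : 𝔸) := by
  let _ := closedChartedSpace hr
  have := closed_isManifold hr
  intro g
  have h1 : ContMDiffOn (𝓡 (expChart hr).dim) (𝓡 (expChart hr).dim) ∞ (chartAt _ g)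
      (chartAt (EuclideanSpace ℝ (Fin (expChart hr).dim)) g).source := contMDiffOn_chart
  have h1' := (h1.contMDiffAt ((chartAt _ g).open_source.mem_nhds (mem_chart_source _ g)))
  have hsm : ContDiff ℝ ∞ fun v => (r g * exp ((expChart hr).emb v) : 𝔸) :=
    contDiff_const.mul ((contDiff_exp_real.of_le le_top).comp (expChart hr).emb.contDiff)
  refine (hsm.contMDiff.contMDiffAt.comp g h1').congr_of_eventuallyEq ?_
  filter_upwards [(chartOf hr g).open_source.mem_nhds (mem_chart_source _ g)] with h hh
  change (r h : 𝔸) = r g * exp ((expChart hr).emb (chartOf hr g h))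
  rw [← val_chartOf_symm, (chartOf hr g).left_inv hh]

/-- A map into a closed linear group is smooth iff it is smooth as a map into the algebra. -/
theorem contMDiffWithinAt_closed_iff (hr : Topology.IsClosedEmbedding r)
    {E H X : Type*} [NormedAddCommGroup E] [NormedSpace ℝ E] [TopologicalSpace H]
    {I : ModelWithCorners ℝ E H} [TopologicalSpace X] [ChartedSpace H X] {f : X → G} {s : Set X}
    {x : X} :
    letI := closedChartedSpace hr
    ContMDiffWithinAt I (𝓡 (expChart hr).dim) ∞ f s x ↔
      ContMDiffWithinAt I 𝓘(ℝ, 𝔸) ∞ (fun y => (r (f y) : 𝔸)) s x := by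
  let _ := closedChartedSpace hr
  have := closed_isManifold hr
  refine ⟨fun h => (contMDiff_val_closed hr).contMDiffAt.comp_contMDiffWithinAt x h, fun h => ?_⟩
  rw [contMDiffWithinAt_iff_target]
  refine ⟨(val_isEmbedding hr).isInducing.continuousWithinAt_iff.2 h.continuousWithinAt, ?_⟩
  have hm : ContMDiffWithinAt I 𝓘(ℝ, 𝔸) ∞
      (fun y => ((r (f x)⁻¹ : 𝔸ˣ) * r (f y) : 𝔸)) s x :=
    ((contDiff_const.mul contDiff_id : ContDiff ℝ ∞
      fun u : 𝔸 => ((r (f x)⁻¹ : 𝔸ˣ) : 𝔸) * u).contMDiff.contMDiffAt.comp_contMDiffWithinAt x h)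
  have hx : ((r (f x)⁻¹ : 𝔸ˣ) * r (f x) : 𝔸) ∈ (expChart hr).O :=
    (mem_chartOf_source hr (f x) (f x)).1 (mem_chart_source _ (f x))
  have hlg : ContMDiffAt 𝓘(ℝ, 𝔸) (𝓡 (expChart hr).dim) ∞ (expChart hr).lg
      ((r (f x)⁻¹ : 𝔸ˣ) * r (f x) : 𝔸) :=
    ((expChart hr).smooth_lg.contDiffAt ((expChart hr).isOpen_O.mem_nhds hx)).contMDiffAt
  have := hlg.comp_contMDiffWithinAt x hm
  refine this.congr (fun y _ => ?_) ?_
  all_goals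
    simp only [extChartAt, OpenPartialHomeomorph.extend, Function.comp_apply]
    exact chartOf_apply hr _ _

theorem closed_lieGroup (hr : Topology.IsClosedEmbedding r) :
    letI := closedChartedSpace hr
    LieGroup (𝓡 (expChart hr).dim) ∞ G := by
  let _ := closedChartedSpace hr
  have := FiniteDimensional.complete ℝ 𝔸
  have hM := closed_isManifold hr
  have hv := contMDiff_val_closed hr
  refine { hM with contMDiff_mul := ?_, contMDiff_inv := ?_ }
  · intro p
    rw [ContMDiffAt, contMDiffWithinAt_closed_iff hr]
    have h2 : ContMDiff ((𝓡 (expChart hr).dim).prod (𝓡 (expChart hr).dim)) 𝓘(ℝ, 𝔸 × 𝔸) ∞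
        fun p : G × G => ((r p.1 : 𝔸), (r p.2 : 𝔸)) :=
      (hv.comp contMDiff_fst).prodMk_space (hv.comp contMDiff_snd)
    have h3 := (contDiff_mul (𝕜 := ℝ) (𝔸 := 𝔸) (n := ∞)).contMDiff.comp h2
    simpa [Function.comp_def, map_mul, ContMDiffAt] using h3.contMDiffAt (x := p)
  · intro g
    rw [ContMDiffAt, contMDiffWithinAt_closed_iff hr]
    have h3 := (contDiffAt_ringInverse ℝ (r g) (n := ∞)).contMDiffAt.comp g (hv.contMDiffAt (x := g))
    simpa [Function.comp_def, ContMDiffAt] using h3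

end ClosedSubgroup

/-! ### Lie groups and crossed modules -/

/-- A (finite-dimensional real) Lie group. -/
structure LieGrp : Type (u + 1) where
  carrier : Type u
  [group : Group carrier]
  [topology : TopologicalSpace carrier]
  dim : ℕ
  [charts : ChartedSpace (EuclideanSpace ℝ (Fin dim)) carrier]
  [lieGroup : LieGroup (𝓡 dim) ∞ carrier]
  [t2 : T2Space carrier]
  [secondCountable : SecondCountableTopology carrier]

instance : CoeSort LieGrp.{u} (Type u) := ⟨LieGrp.carrier⟩

attribute [instance] LieGrp.group LieGrp.topology LieGrp.charts LieGrp.lieGroup LieGrp.t2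
  LieGrp.secondCountable

section OfClosed
variable {𝔸 : Type*} [NormedRing 𝔸] [NormedAlgebra ℝ 𝔸] [FiniteDimensional ℝ 𝔸]
  (G : Type u) [Group G] (r : G →* 𝔸ˣ)

theorem isClosedEmbedding_induced (hinj : Function.Injective r) (hcl : IsClosed (Set.range r)) :
    @Topology.IsClosedEmbedding G 𝔸ˣ (TopologicalSpace.induced r inferInstance) _ r :=
  @Topology.IsClosedEmbedding.mk G 𝔸ˣ (TopologicalSpace.induced r inferInstance) _ r
    (@Topology.IsEmbedding.mk G 𝔸ˣ (TopologicalSpace.induced r inferInstance) _ r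
      (@Topology.IsInducing.mk G 𝔸ˣ (TopologicalSpace.induced r inferInstance) _ r rfl) hinj) hcl

/-- A group `G` that is embedded by `r` as a closed subgroup of the units of a finite-dimensional
algebra, with its induced topology and Lie group structure. -/
def LieGrp.ofClosed (hinj : Function.Injective r) (hcl : IsClosed (Set.range r)) : LieGrp.{u} :=
  letI : TopologicalSpace G := TopologicalSpace.induced r inferInstance
  have hr := isClosedEmbedding_induced G r hinj hcl
  letI := closedChartedSpace hr
  { carrier := G
    dim := (expChart hr).dim
    lieGroup := closed_lieGroup hr
    t2 := T2Space.of_injective_continuous (val_isEmbedding hr).injective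
      (val_isEmbedding hr).continuous
    secondCountable :=
      have := FiniteDimensional.proper ℝ 𝔸
      (val_isEmbedding hr).secondCountableTopology }

variable {G r}

theorem LieGrp.contMDiffWithinAt_ofClosed_iff {hinj : Function.Injective r}
    {hcl : IsClosed (Set.range r)}
    {E H X : Type*} [NormedAddCommGroup E] [NormedSpace ℝ E] [TopologicalSpace H]
    {I : ModelWithCorners ℝ E H} [TopologicalSpace X] [ChartedSpace H X]
    {f : X → LieGrp.ofClosed G r hinj hcl} {s : Set X} {x : X} :
    ContMDiffWithinAt I (𝓡 (LieGrp.ofClosed G r hinj hcl).dim) ∞ f s x ↔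
      ContMDiffWithinAt I 𝓘(ℝ, 𝔸) ∞ (fun y => (r (f y) : 𝔸)) s x :=
  letI : TopologicalSpace G := TopologicalSpace.induced r inferInstance
  contMDiffWithinAt_closed_iff (isClosedEmbedding_induced G r hinj hcl)

theorem LieGrp.contMDiff_ofClosed_iff {hinj : Function.Injective r}
    {hcl : IsClosed (Set.range r)}
    {E H X : Type*} [NormedAddCommGroup E] [NormedSpace ℝ E] [TopologicalSpace H]
    {I : ModelWithCorners ℝ E H} [TopologicalSpace X] [ChartedSpace H X]
    {f : X → LieGrp.ofClosed G r hinj hcl} :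
    ContMDiff I (𝓡 (LieGrp.ofClosed G r hinj hcl).dim) ∞ f ↔
      ContMDiff I 𝓘(ℝ, 𝔸) ∞ (fun y => (r (f y) : 𝔸)) :=
  forall_congr' fun _ => LieGrp.contMDiffWithinAt_ofClosed_iff

theorem LieGrp.contMDiff_val_ofClosed (hinj : Function.Injective r) (hcl : IsClosed (Set.range r)) :
    ContMDiff (𝓡 (LieGrp.ofClosed G r hinj hcl).dim) 𝓘(ℝ, 𝔸) ∞
      (fun g : LieGrp.ofClosed G r hinj hcl => (r g : 𝔸)) :=
  LieGrp.contMDiff_ofClosed_iff.1 contMDiff_id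

end OfClosed

/-! ### Coordinates on `GL(V)` -/

section Coordinates
variable (𝕜 : Type v) [RCLike 𝕜] (V : Type*) [AddCommGroup V] [Module 𝕜 V] [FiniteDimensional 𝕜 V]

/-- Real-linear endomorphisms of `𝕜ⁿ`, `n = dim V`. -/
abbrev CoordEnd : Type v :=
  (Fin (Module.finrank 𝕜 V) → 𝕜) →L[ℝ] (Fin (Module.finrank 𝕜 V) → 𝕜)

/-- Coordinates with respect to a basis of `V`. -/
def coordEquiv : V ≃ₗ[𝕜] (Fin (Module.finrank 𝕜 V) → 𝕜) := (Module.finBasis 𝕜 V).equivFun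

/-- Endomorphisms of `V`, in coordinates. -/
def endCoord : Module.End 𝕜 V →* CoordEnd 𝕜 V where
  toFun T := LinearMap.toContinuousLinearMap (((coordEquiv 𝕜 V).conj T).restrictScalars ℝ)
  map_one' := by ext x : 1; simp [LinearEquiv.conj_apply]
  map_mul' S T := by ext x : 1; simp [LinearEquiv.conj_apply]

/-- `GL(V)`, in coordinates. -/
def glCoord : (V ≃ₗ[𝕜] V) →* (CoordEnd 𝕜 V)ˣ :=
  (Units.map (endCoord 𝕜 V)).comp (LinearMap.GeneralLinearGroup.generalLinearEquiv 𝕜 V).symm.toMonoidHom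

variable {𝕜 V}

/-- The endomorphism of `V` with given coordinates. -/
def ofCoord (u : CoordEnd 𝕜 V) (x : V) : V := (coordEquiv 𝕜 V).symm (u (coordEquiv 𝕜 V x))

theorem endCoord_apply (T : Module.End 𝕜 V) (x : Fin (Module.finrank 𝕜 V) → 𝕜) :
    endCoord 𝕜 V T x = coordEquiv 𝕜 V (T ((coordEquiv 𝕜 V).symm x)) := rfl

theorem glCoord_apply (T : V ≃ₗ[𝕜] V) (x : Fin (Module.finrank 𝕜 V) → 𝕜) :
    (glCoord 𝕜 V T : CoordEnd 𝕜 V) x = coordEquiv 𝕜 V (T ((coordEquiv 𝕜 V).symm x)) := rfl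

theorem ofCoord_endCoord (T : Module.End 𝕜 V) (x : V) : ofCoord (endCoord 𝕜 V T) x = T x := by
  simp [ofCoord, endCoord_apply]

theorem ofCoord_glCoord (T : V ≃ₗ[𝕜] V) (x : V) :
    ofCoord (glCoord 𝕜 V T : CoordEnd 𝕜 V) x = T x := by
  simp [ofCoord, glCoord_apply]

theorem ofCoord_injective {u w : CoordEnd 𝕜 V} (h : ∀ x, ofCoord u x = ofCoord w x) : u = w := by
  ext x : 1
  have := h ((coordEquiv 𝕜 V).symm x)
  simpa [ofCoord] using this

theorem ofCoord_mul (u w : CoordEnd 𝕜 V) (x : V) : ofCoord (u * w) x = ofCoord u (ofCoord w x) := by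
  simp [ofCoord]

theorem ofCoord_one (x : V) : ofCoord (1 : CoordEnd 𝕜 V) x = x := by
  simp [ofCoord]

theorem ofCoord_inv_apply (u : (CoordEnd 𝕜 V)ˣ) (x : V) :
    ofCoord ((u⁻¹ : (CoordEnd 𝕜 V)ˣ) : CoordEnd 𝕜 V) (ofCoord (u : CoordEnd 𝕜 V) x) = x := by
  rw [← ofCoord_mul, ← Units.val_mul, inv_mul_cancel, Units.val_one, ofCoord_one]

theorem ofCoord_apply_inv (u : (CoordEnd 𝕜 V)ˣ) (x : V) :
    ofCoord (u : CoordEnd 𝕜 V) (ofCoord ((u⁻¹ : (CoordEnd 𝕜 V)ˣ) : CoordEnd 𝕜 V) x) = x := by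
  rw [← ofCoord_mul, ← Units.val_mul, mul_inv_cancel, Units.val_one, ofCoord_one]

theorem ofCoord_add (u : CoordEnd 𝕜 V) (x y : V) : ofCoord u (x + y) = ofCoord u x + ofCoord u y := by
  simp [ofCoord]

theorem glCoord_injective : Function.Injective (glCoord 𝕜 V) := fun S T h =>
  LinearEquiv.ext fun x => by rw [← ofCoord_glCoord S, h, ofCoord_glCoord]

/-- The unit `u` as an element of `GL(V)`, if it is `𝕜`-linear. -/
def ofCoordEquiv (u : (CoordEnd 𝕜 V)ˣ)
    (hu : ∀ (c : 𝕜) (x : V), ofCoord (u : CoordEnd 𝕜 V) (c • x) = c • ofCoord (u : CoordEnd 𝕜 V) x) :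
    V ≃ₗ[𝕜] V where
  toFun := ofCoord (u : CoordEnd 𝕜 V)
  invFun := ofCoord ((u⁻¹ : (CoordEnd 𝕜 V)ˣ) : CoordEnd 𝕜 V)
  map_add' := ofCoord_add _
  map_smul' := hu
  left_inv := ofCoord_inv_apply u
  right_inv := ofCoord_apply_inv u

theorem glCoord_ofCoordEquiv (u : (CoordEnd 𝕜 V)ˣ)
    (hu : ∀ (c : 𝕜) (x : V), ofCoord (u : CoordEnd 𝕜 V) (c • x) = c • ofCoord (u : CoordEnd 𝕜 V) x) :
    glCoord 𝕜 V (ofCoordEquiv u hu) = u :=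
  Units.ext (ofCoord_injective fun x => by rw [ofCoord_glCoord]; rfl)

theorem continuous_ofCoord [TopologicalSpace V] [IsModuleTopology 𝕜 V] (x : V) :
    Continuous fun u : (CoordEnd 𝕜 V)ˣ => ofCoord (u : CoordEnd 𝕜 V) x := by
  have := IsModuleTopology.toContinuousAdd 𝕜 V
  have := IsModuleTopology.toContinuousSMul 𝕜 V
  have h1 : Continuous (coordEquiv 𝕜 V).symm :=
    IsModuleTopology.continuous_of_linearMap (coordEquiv 𝕜 V).symm.toLinearMap
  exact h1.comp ((ContinuousLinearMap.apply ℝ _ (coordEquiv 𝕜 V x)).continuous.comp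
    Units.continuous_val)

theorem t2Space_moduleTopology [TopologicalSpace V] [IsModuleTopology 𝕜 V] : T2Space V :=
  T2Space.of_injective_continuous (coordEquiv 𝕜 V).injective
    (IsModuleTopology.continuous_of_linearMap (coordEquiv 𝕜 V).toLinearMap)

theorem isClosed_submodule_moduleTopology [TopologicalSpace V] [IsModuleTopology 𝕜 V]
    (S : Submodule 𝕜 V) : IsClosed (S : Set V) := by
  have := t2Space_moduleTopology (𝕜 := 𝕜) (V := V)
  have := IsModuleTopology.toContinuousSMul 𝕜 V
  have := IsModuleTopology.topologicalAddGroup 𝕜 V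
  exact S.closed_of_finiteDimensional

theorem isClosed_setOf_smul :
    IsClosed {u : (CoordEnd 𝕜 V)ˣ | ∀ (c : 𝕜) (x : V),
      ofCoord (u : CoordEnd 𝕜 V) (c • x) = c • ofCoord (u : CoordEnd 𝕜 V) x} := by
  let _ : TopologicalSpace V := moduleTopology 𝕜 V
  have : IsModuleTopology 𝕜 V := ⟨rfl⟩
  have := t2Space_moduleTopology (𝕜 := 𝕜) (V := V)
  have := IsModuleTopology.toContinuousSMul 𝕜 V
  simp only [Set.ofPred_forall]
  exact isClosed_iInter fun c => isClosed_iInter fun x =>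
    isClosed_eq (continuous_ofCoord _) ((continuous_ofCoord x).const_smul c)

theorem isClosed_setOf_mem_submodule (S : Submodule 𝕜 V) (x : V) :
    IsClosed {u : (CoordEnd 𝕜 V)ˣ | ofCoord (u : CoordEnd 𝕜 V) x ∈ S} := by
  let _ : TopologicalSpace V := moduleTopology 𝕜 V
  have : IsModuleTopology 𝕜 V := ⟨rfl⟩
  exact (isClosed_submodule_moduleTopology S).preimage (continuous_ofCoord x)

theorem isClosed_setOf_graded {ι : Type*} (S : ι → Submodule 𝕜 V) :
    IsClosed {u : (CoordEnd 𝕜 V)ˣ | ∀ i x, ofCoord (u : CoordEnd 𝕜 V) x ∈ S i ↔ x ∈ S i} := by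
  have h : {u : (CoordEnd 𝕜 V)ˣ | ∀ i x, ofCoord (u : CoordEnd 𝕜 V) x ∈ S i ↔ x ∈ S i} =
      (⋂ i, ⋂ x ∈ S i, {u : (CoordEnd 𝕜 V)ˣ | ofCoord (u : CoordEnd 𝕜 V) x ∈ S i}) ∩
      (⋂ i, ⋂ x ∈ S i, (fun u : (CoordEnd 𝕜 V)ˣ => u⁻¹) ⁻¹'
        {u : (CoordEnd 𝕜 V)ˣ | ofCoord (u : CoordEnd 𝕜 V) x ∈ S i}) := by
    ext u
    simp only [Set.mem_ofPred_eq, Set.mem_inter_iff, Set.mem_iInter, Set.mem_preimage]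
    refine ⟨fun h => ⟨fun i x hx => (h i x).2 hx, fun i x hx => (h i _).1 ?_⟩,
      fun h i x => ⟨fun hx => ?_, h.1 i x⟩⟩
    · rwa [ofCoord_apply_inv]
    · have := h.2 i _ hx
      rwa [ofCoord_inv_apply] at this
  rw [h]
  exact (isClosed_iInter fun i => isClosed_biInter fun x _ => isClosed_setOf_mem_submodule _ _).inter
    (isClosed_iInter fun i => isClosed_biInter fun x _ =>
      (isClosed_setOf_mem_submodule _ _).preimage continuous_inv)

end Coordinates

/-! ### Super algebras and the crossed module `AUT(A)` -/

/-- A crossed module of Lie groups. -/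
structure LieCrossedModule : Type (u + 1) where
  H : LieGrp.{u}
  G : LieGrp.{u}
  t : H →* G
  /-- The action of `G` on `H` by group automorphisms, `act g h = ᵍh`. -/
  act : G →* MulAut H
  smooth_t : ContMDiff (𝓡 H.dim) (𝓡 G.dim) ∞ t
  smooth_act : ContMDiff ((𝓡 G.dim).prod (𝓡 H.dim)) (𝓡 H.dim) ∞ fun p : G × H => act p.1 p.2
  t_act : ∀ g h, t (act g h) = g * t h * g⁻¹
  act_t : ∀ x h, act (t x) h = x * h * x⁻¹

section SuperAlgebra
variable {𝕜 : Type v} [RCLike 𝕜] {A : Type u} [Ring A] [Algebra 𝕜 A]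
  (𝒜 : ZMod 2 → Submodule 𝕜 A)

/-- The group of even (grading-preserving) automorphisms of a super algebra. -/
def evenAut : Subgroup (A ≃ₐ[𝕜] A) where
  carrier := {φ | ∀ i a, φ a ∈ 𝒜 i ↔ a ∈ 𝒜 i}
  one_mem' _ _ := Iff.rfl
  mul_mem' {φ ψ} hφ hψ i a := (hφ i (ψ a)).trans (hψ i a)
  inv_mem' {φ} hφ i a := by
    rw [← hφ i (φ⁻¹ a)]
    change φ (φ.symm a) ∈ _ ↔ _
    rw [AlgEquiv.apply_symm_apply]

/-- The group `A₀ˣ` of even invertible elements of a super algebra. -/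
def evenUnits [GradedAlgebra 𝒜] : Subgroup Aˣ where
  carrier := {a | (a : A) ∈ 𝒜 0}
  one_mem' := SetLike.GradedOne.one_mem (A := 𝒜)
  mul_mem' {a b} ha hb := by
    have := SetLike.GradedMul.mul_mem (A := 𝒜) ha hb
    rwa [add_zero] at this
  inv_mem' {a} ha := by
    -- the even part of `a⁻¹` is a right inverse of `a`
    have h : (a : A) * (DirectSum.decompose 𝒜 ((a⁻¹ : Aˣ) : A) 0 : A) = 1 := by
      have h1 := DirectSum.coe_decompose_mul_of_left_mem_zero 𝒜 (j := 0)
        (b := ((a⁻¹ : Aˣ) : A)) ha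
      rw [Units.mul_inv, DirectSum.decompose_of_mem_same 𝒜 SetLike.GradedOne.one_mem] at h1
      exact h1.symm
    have h2 : ((a⁻¹ : Aˣ) : A) = (DirectSum.decompose 𝒜 ((a⁻¹ : Aˣ) : A) 0 : A) := by
      rw [← Units.inv_mul_cancel_left a (DirectSum.decompose 𝒜 ((a⁻¹ : Aˣ) : A) 0 : A), h, mul_one]
    change ((a⁻¹ : Aˣ) : A) ∈ 𝒜 0
    rw [h2]
    exact SetLike.coe_mem _

variable [FiniteDimensional 𝕜 A]

/-- Even automorphisms as linear automorphisms. -/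
def evenAutToGL : evenAut 𝒜 →* (A ≃ₗ[𝕜] A) where
  toFun φ := (φ : A ≃ₐ[𝕜] A).toLinearEquiv
  map_one' := rfl
  map_mul' _ _ := rfl

/-- `Aut(A) ⊆ GL(A)`, in coordinates. -/
def evenAutRep : evenAut 𝒜 →* (CoordEnd 𝕜 A)ˣ := (glCoord 𝕜 A).comp (evenAutToGL 𝒜)

theorem ofCoord_evenAutRep (φ : evenAut 𝒜) (x : A) :
    ofCoord (evenAutRep 𝒜 φ : CoordEnd 𝕜 A) x = (φ : A ≃ₐ[𝕜] A) x :=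
  ofCoord_glCoord _ x

theorem evenAutRep_injective : Function.Injective (evenAutRep 𝒜) := fun φ ψ h =>
  Subtype.ext (AlgEquiv.ext fun x => by
    rw [← ofCoord_evenAutRep, h, ofCoord_evenAutRep])

theorem mem_range_evenAutRep (u : (CoordEnd 𝕜 A)ˣ) :
    u ∈ Set.range (evenAutRep 𝒜) ↔
      ((∀ (c : 𝕜) (x : A), ofCoord (u : CoordEnd 𝕜 A) (c • x) = c • ofCoord (u : CoordEnd 𝕜 A) x) ∧
      (∀ x y : A, ofCoord (u : CoordEnd 𝕜 A) (x * y) =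
        ofCoord (u : CoordEnd 𝕜 A) x * ofCoord (u : CoordEnd 𝕜 A) y)) ∧
      ∀ i x, ofCoord (u : CoordEnd 𝕜 A) x ∈ 𝒜 i ↔ x ∈ 𝒜 i := by
  constructor
  · rintro ⟨φ, rfl⟩
    simp only [ofCoord_evenAutRep]
    exact ⟨⟨fun c x => map_smul _ c x, fun x y => map_mul _ x y⟩, φ.2⟩
  · rintro ⟨⟨h1, h2⟩, h3⟩
    have h4 : ofCoord (u : CoordEnd 𝕜 A) 1 = 1 := by
      have h := h2 (ofCoord ((u⁻¹ : (CoordEnd 𝕜 A)ˣ) : CoordEnd 𝕜 A) 1) 1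
      rw [mul_one, ofCoord_apply_inv, one_mul] at h
      exact h.symm
    refine ⟨⟨AlgEquiv.ofLinearEquiv (ofCoordEquiv u h1) h4 h2, h3⟩, ?_⟩
    exact glCoord_ofCoordEquiv u h1

theorem isClosed_range_evenAutRep : IsClosed (Set.range (evenAutRep 𝒜)) := by
  let _ : TopologicalSpace A := moduleTopology 𝕜 A
  have : IsModuleTopology 𝕜 A := ⟨rfl⟩
  have := t2Space_moduleTopology (𝕜 := 𝕜) (V := A)
  have hmul := IsModuleTopology.continuous_mul_of_finite 𝕜 A
  have h : Set.range (evenAutRep 𝒜) = ({u : (CoordEnd 𝕜 A)ˣ | ∀ (c : 𝕜) (x : A),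
      ofCoord (u : CoordEnd 𝕜 A) (c • x) = c • ofCoord (u : CoordEnd 𝕜 A) x} ∩
      ⋂ x : A, ⋂ y : A, {u : (CoordEnd 𝕜 A)ˣ | ofCoord (u : CoordEnd 𝕜 A) (x * y) =
        ofCoord (u : CoordEnd 𝕜 A) x * ofCoord (u : CoordEnd 𝕜 A) y}) ∩
      {u : (CoordEnd 𝕜 A)ˣ | ∀ i x, ofCoord (u : CoordEnd 𝕜 A) x ∈ 𝒜 i ↔ x ∈ 𝒜 i} := by
    ext u
    simp only [mem_range_evenAutRep, Set.mem_inter_iff, Set.mem_ofPred_eq, Set.mem_iInter]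
  rw [h]
  refine (isClosed_setOf_smul.inter ?_).inter (isClosed_setOf_graded 𝒜)
  exact isClosed_iInter fun x => isClosed_iInter fun y => isClosed_eq (continuous_ofCoord _)
    (hmul.comp ((continuous_ofCoord x).prodMk (continuous_ofCoord y)))

/-- The Lie group `Aut(A)` of even automorphisms, a closed subgroup of `GL(A)`. -/
def autLie : LieGrp.{u} :=
  LieGrp.ofClosed (𝔸 := CoordEnd 𝕜 A) (evenAut 𝒜) (evenAutRep 𝒜) (evenAutRep_injective 𝒜)
    (isClosed_range_evenAutRep 𝒜)

variable [GradedAlgebra 𝒜]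

/-- `A₀ˣ` acting on `A` by left multiplication, in coordinates. -/
def evenUnitsRep : evenUnits 𝒜 →* (CoordEnd 𝕜 A)ˣ :=
  (Units.map ((endCoord 𝕜 A).comp (Algebra.lmul 𝕜 A : A →* Module.End 𝕜 A))).comp
    (evenUnits 𝒜).subtype

theorem ofCoord_evenUnitsRep (a : evenUnits 𝒜) (x : A) :
    ofCoord (evenUnitsRep 𝒜 a : CoordEnd 𝕜 A) x = ((a : Aˣ) : A) * x :=
  ofCoord_endCoord _ x

theorem evenUnitsRep_injective : Function.Injective (evenUnitsRep 𝒜) := fun a b h =>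
  Subtype.ext (Units.ext (by
    rw [← mul_one ((a : Aˣ) : A), ← ofCoord_evenUnitsRep, h, ofCoord_evenUnitsRep, mul_one]))

theorem mem_range_evenUnitsRep (u : (CoordEnd 𝕜 A)ˣ) :
    u ∈ Set.range (evenUnitsRep 𝒜) ↔
      (∀ x : A, ofCoord (u : CoordEnd 𝕜 A) x = ofCoord (u : CoordEnd 𝕜 A) 1 * x) ∧
      ofCoord (u : CoordEnd 𝕜 A) 1 ∈ 𝒜 0 := by
  constructor
  · rintro ⟨a, rfl⟩
    simp only [ofCoord_evenUnitsRep, mul_one]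
    exact ⟨fun x => trivial, a.2⟩
  · rintro ⟨h1, h2⟩
    set a := ofCoord (u : CoordEnd 𝕜 A) 1 with ha
    set b := ofCoord ((u⁻¹ : (CoordEnd 𝕜 A)ˣ) : CoordEnd 𝕜 A) 1 with hb
    have hab : a * b = 1 := by rw [← h1 b, hb, ofCoord_apply_inv]
    have hba : b * a = 1 := by
      have h : ofCoord (u : CoordEnd 𝕜 A) (b * a) = ofCoord (u : CoordEnd 𝕜 A) 1 := by
        rw [h1, ← mul_assoc, hab, one_mul]
      rw [← ofCoord_inv_apply u (b * a), h, ofCoord_inv_apply]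
    refine ⟨⟨⟨a, b, hab, hba⟩, h2⟩, Units.ext (ofCoord_injective fun x => ?_)⟩
    rw [ofCoord_evenUnitsRep, h1 x]

theorem isClosed_range_evenUnitsRep : IsClosed (Set.range (evenUnitsRep 𝒜)) := by
  let _ : TopologicalSpace A := moduleTopology 𝕜 A
  have : IsModuleTopology 𝕜 A := ⟨rfl⟩
  have := t2Space_moduleTopology (𝕜 := 𝕜) (V := A)
  have hmul := IsModuleTopology.continuous_mul_of_finite 𝕜 A
  have h : Set.range (evenUnitsRep 𝒜) = (⋂ x : A, {u : (CoordEnd 𝕜 A)ˣ |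
        ofCoord (u : CoordEnd 𝕜 A) x = ofCoord (u : CoordEnd 𝕜 A) 1 * x}) ∩
      {u : (CoordEnd 𝕜 A)ˣ | ofCoord (u : CoordEnd 𝕜 A) 1 ∈ 𝒜 0} := by
    ext u
    simp only [mem_range_evenUnitsRep, Set.mem_inter_iff, Set.mem_ofPred_eq, Set.mem_iInter]
  rw [h]
  refine IsClosed.inter ?_ (isClosed_setOf_mem_submodule _ _)
  exact isClosed_iInter fun x => isClosed_eq (continuous_ofCoord _)
    (hmul.comp ((continuous_ofCoord 1).prodMk continuous_const))

/-- The Lie group `A₀ˣ` of even invertible elements, embedded in `GL(A)` by left multiplication. -/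
def unitsLie : LieGrp.{u} :=
  LieGrp.ofClosed (𝔸 := CoordEnd 𝕜 A) (evenUnits 𝒜) (evenUnitsRep 𝒜) (evenUnitsRep_injective 𝒜)
    (isClosed_range_evenUnitsRep 𝒜)

/-- Conjugation by an even unit, as an even automorphism. -/
def innerAut : evenUnits 𝒜 →* evenAut 𝒜 where
  toFun a := ⟨AlgEquiv.ofLinearEquiv
      { toFun := fun x => ((a : Aˣ) : A) * x * (((a : Aˣ)⁻¹ : Aˣ) : A)
        invFun := fun x => (((a : Aˣ)⁻¹ : Aˣ) : A) * x * ((a : Aˣ) : A)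
        map_add' := fun x y => by rw [mul_add, add_mul]
        map_smul' := fun c x => by simp
        left_inv := fun x => by simp [mul_assoc]
        right_inv := fun x => by simp [mul_assoc] }
      (by simp) (fun x y => by simp [mul_assoc]), fun i x => by
    have key : ∀ (b : evenUnits 𝒜) (y : A), y ∈ 𝒜 i →
        ((b : Aˣ) : A) * y * (((b : Aˣ)⁻¹ : Aˣ) : A) ∈ 𝒜 i := fun b y hy => by
      have := SetLike.GradedMul.mul_mem (A := 𝒜) (SetLike.GradedMul.mul_mem (A := 𝒜) b.2 hy) (b⁻¹).2
      rwa [zero_add, add_zero] at this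
    refine ⟨fun h => ?_, key a x⟩
    have := key a⁻¹ _ h
    simpa [mul_assoc] using this⟩
  map_one' := Subtype.ext (AlgEquiv.ext fun x => by simp)
  map_mul' a b := Subtype.ext (AlgEquiv.ext fun x => by simp [mul_assoc])

/-- The action of even automorphisms on even units by evaluation. -/
def evalAct : evenAut 𝒜 →* MulAut (evenUnits 𝒜) where
  toFun φ :=
    { toFun := fun a => ⟨Units.map ((φ : A ≃ₐ[𝕜] A) : A →* A) a, (φ.2 0 _).2 a.2⟩
      invFun := fun a => ⟨Units.map (((φ⁻¹ : evenAut 𝒜) : A ≃ₐ[𝕜] A) : A →* A) a,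
        ((φ⁻¹).2 0 _).2 a.2⟩
      left_inv := fun _ => Subtype.ext (Units.ext ((φ : A ≃ₐ[𝕜] A).symm_apply_apply _))
      right_inv := fun _ => Subtype.ext (Units.ext ((φ : A ≃ₐ[𝕜] A).apply_symm_apply _))
      map_mul' := fun _ _ => Subtype.ext (Units.ext (map_mul (φ : A ≃ₐ[𝕜] A) _ _)) }
  map_one' := rfl
  map_mul' _ _ := rfl

/-- Conjugation, as a homomorphism of Lie groups. -/
def innerAutLie : unitsLie 𝒜 →* autLie 𝒜 := innerAut 𝒜

/-- Evaluation, as an action of a Lie group. -/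
def evalActLie : autLie 𝒜 →* MulAut (unitsLie 𝒜) := evalAct 𝒜

theorem contMDiff_innerAutLie :
    ContMDiff (𝓡 (unitsLie 𝒜).dim) (𝓡 (autLie 𝒜).dim) ∞ (innerAutLie 𝒜) := by
  refine LieGrp.contMDiff_ofClosed_iff.2 ?_
  -- right multiplication by `u 1`, as a real linear function of `u`
  let R : CoordEnd 𝕜 A →ₗ[ℝ] CoordEnd 𝕜 A :=
    { toFun := fun u => endCoord 𝕜 A (LinearMap.mulRight 𝕜 (ofCoord u 1))
      map_add' := fun u w => by
        ext x : 1
        simp [endCoord_apply, ofCoord, mul_add]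
      map_smul' := fun c u => by
        ext x : 1
        simp only [endCoord_apply, ofCoord, LinearMap.mulRight_apply, RingHom.id_apply,
          smul_apply]
        rw [RCLike.real_smul_eq_coe_smul (K := 𝕜), map_smul, mul_smul_comm, map_smul,
          RCLike.real_smul_eq_coe_smul (K := 𝕜)] }
  have h1 : ContMDiff (𝓡 (unitsLie 𝒜).dim) 𝓘(ℝ, CoordEnd 𝕜 A) ∞
      (fun a : unitsLie 𝒜 => (evenUnitsRep 𝒜 a : CoordEnd 𝕜 A)) :=
    LieGrp.contMDiff_val_ofClosed (evenUnitsRep_injective 𝒜) (isClosed_range_evenUnitsRep 𝒜)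
  have h2 := h1.comp (contMDiff_inv (𝓡 (unitsLie 𝒜).dim) ∞ (G := unitsLie 𝒜))
  have hRs : ContDiff ℝ ∞ R :=
    ContinuousLinearMap.contDiff (E := CoordEnd 𝕜 A) (F := CoordEnd 𝕜 A) R.toContinuousLinearMap
  have h3 := hRs.contMDiff.comp h2
  have h4 := (contDiff_mul (𝕜 := ℝ) (𝔸 := CoordEnd 𝕜 A) (n := ∞)).contMDiff.comp
    (h1.prodMk_space h3)
  refine h4.congr fun a => ofCoord_injective fun x => ?_
  have hR : ofCoord (R ((evenUnitsRep 𝒜 (a⁻¹ : evenUnits 𝒜) : (CoordEnd 𝕜 A)ˣ) : CoordEnd 𝕜 A)) x =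
      x * (((a : evenUnits 𝒜)⁻¹ : evenUnits 𝒜) : Aˣ) := by
    change ofCoord (endCoord 𝕜 A (LinearMap.mulRight 𝕜 (ofCoord _ 1))) x = _
    rw [ofCoord_endCoord, ofCoord_evenUnitsRep, mul_one]
    rfl
  refine (ofCoord_evenAutRep 𝒜 _ x).trans (Eq.trans ?_ (ofCoord_mul _ _ x).symm)
  refine Eq.trans ?_ (congrArg _ hR.symm)
  refine Eq.trans ?_ (ofCoord_evenUnitsRep 𝒜 a _).symm
  exact mul_assoc _ _ _

theorem contMDiff_evalActLie :
    ContMDiff ((𝓡 (autLie 𝒜).dim).prod (𝓡 (unitsLie 𝒜).dim)) (𝓡 (unitsLie 𝒜).dim) ∞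
      fun p : autLie 𝒜 × unitsLie 𝒜 => evalActLie 𝒜 p.1 p.2 := by
  refine LieGrp.contMDiff_ofClosed_iff.2 ?_
  have h1 : ContMDiff (𝓡 (unitsLie 𝒜).dim) 𝓘(ℝ, CoordEnd 𝕜 A) ∞
      (fun a : unitsLie 𝒜 => (evenUnitsRep 𝒜 a : CoordEnd 𝕜 A)) :=
    LieGrp.contMDiff_val_ofClosed (evenUnitsRep_injective 𝒜) (isClosed_range_evenUnitsRep 𝒜)
  have h2 : ContMDiff (𝓡 (autLie 𝒜).dim) 𝓘(ℝ, CoordEnd 𝕜 A) ∞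
      (fun a : autLie 𝒜 => (evenAutRep 𝒜 a : CoordEnd 𝕜 A)) :=
    LieGrp.contMDiff_val_ofClosed (evenAutRep_injective 𝒜) (isClosed_range_evenAutRep 𝒜)
  have h3 := h2.comp (contMDiff_inv (𝓡 (autLie 𝒜).dim) ∞ (G := autLie 𝒜))
  have hm := (contDiff_mul (𝕜 := ℝ) (𝔸 := CoordEnd 𝕜 A) (n := ∞)).contMDiff
  have h4 := hm.comp ((hm.comp ((h2.comp (contMDiff_fst (I := 𝓡 (autLie 𝒜).dim)
    (J := 𝓡 (unitsLie 𝒜).dim))).prodMk_space (h1.comp contMDiff_snd))).prodMk_space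
      (h3.comp contMDiff_fst))
  refine h4.congr fun p => ofCoord_injective fun x => ?_
  obtain ⟨φ, a⟩ := p
  refine (ofCoord_evenUnitsRep 𝒜 _ x).trans (Eq.trans ?_ (ofCoord_mul _ _ x).symm)
  refine Eq.trans ?_ (ofCoord_mul _ _ _).symm
  refine Eq.trans ?_ (ofCoord_evenAutRep 𝒜 φ _).symm
  refine Eq.trans ?_ (congrArg _ (ofCoord_evenUnitsRep 𝒜 a _).symm)
  refine Eq.trans ?_ (congrArg _ (congrArg _ (ofCoord_evenAutRep 𝒜 (φ : evenAut 𝒜)⁻¹ x).symm))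
  rw [map_mul]
  exact congrArg _ ((φ : evenAut 𝒜).1.apply_symm_apply x).symm

/-- The crossed module `AUT(A)` of a super algebra: conjugation `A₀ˣ → Aut(A)`, with `Aut(A)` acting
on `A₀ˣ` by evaluation. -/
def AUT : LieCrossedModule.{u} where
  H := unitsLie 𝒜
  G := autLie 𝒜
  t := innerAutLie 𝒜
  act := evalActLie 𝒜
  smooth_t := contMDiff_innerAutLie 𝒜
  smooth_act := contMDiff_evalActLie 𝒜
  t_act φ a := Subtype.ext (AlgEquiv.ext fun x => by
    change (φ : evenAut 𝒜).1 _ * x * (φ : evenAut 𝒜).1 _ =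
      (φ : evenAut 𝒜).1 (_ * (φ : evenAut 𝒜).1.symm x * _)
    rw [map_mul, map_mul, AlgEquiv.apply_symm_apply]
    rfl)
  act_t _ _ := Subtype.ext (Units.ext rfl)

end SuperAlgebra

/-! ### Bimodules, butterflies and Čech cohomology -/

section Bimodules
variable {𝕜 : Type v} [RCLike 𝕜] {A B C : Type u} [Ring A] [Algebra 𝕜 A] [Ring B] [Algebra 𝕜 B]
  [Ring C] [Algebra 𝕜 C]

/-- A finite-dimensional `ℤ/2`-graded `A`-`B`-bimodule. The right action of `b : B` on `m` is
`MulOpposite.op b • m`. -/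
structure SuperBimodule (𝒜 : ZMod 2 → Submodule 𝕜 A) (ℬ : ZMod 2 → Submodule 𝕜 B) :
    Type (max (u + 1) v) where
  carrier : Type u
  [addCommGroup : AddCommGroup carrier]
  [module : Module 𝕜 carrier]
  [finiteDimensional : FiniteDimensional 𝕜 carrier]
  [leftModule : Module A carrier]
  [rightModule : Module Bᵐᵒᵖ carrier]
  [leftTower : IsScalarTower 𝕜 A carrier]
  [rightTower : IsScalarTower 𝕜 Bᵐᵒᵖ carrier]
  [smulComm : SMulCommClass A Bᵐᵒᵖ carrier]
  grading : ZMod 2 → Submodule 𝕜 carrier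
  isInternal : DirectSum.IsInternal grading
  left_mem : ∀ {i j a m}, a ∈ 𝒜 i → m ∈ grading j → a • m ∈ grading (i + j)
  right_mem : ∀ {i j m b}, m ∈ grading i → b ∈ ℬ j → MulOpposite.op b • m ∈ grading (i + j)

namespace SuperBimodule

variable {𝒜 : ZMod 2 → Submodule 𝕜 A} {ℬ : ZMod 2 → Submodule 𝕜 B} {𝒞 : ZMod 2 → Submodule 𝕜 C}

instance : CoeSort (SuperBimodule 𝒜 ℬ) (Type u) := ⟨SuperBimodule.carrier⟩

attribute [instance] addCommGroup module finiteDimensional leftModule rightModule leftTower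
  rightTower smulComm

/-- An invertible even intertwiner between bimodules. -/
structure Iso (M N : SuperBimodule 𝒜 ℬ) where
  toEquiv : M ≃ₗ[𝕜] N
  map_left : ∀ (a : A) (m : M), toEquiv (a • m) = a • toEquiv m
  map_right : ∀ (b : B) (m : M),
    toEquiv (MulOpposite.op b • m) = MulOpposite.op b • toEquiv m
  map_grading : ∀ i, ∀ m ∈ M.grading i, toEquiv m ∈ N.grading i

/-- The bimodule `A_φ`: the algebra `A` with left multiplication, and right action
`x ◁ a = x * φ a`. -/
def twisted [GradedAlgebra 𝒜] [FiniteDimensional 𝕜 A] (φ : evenAut 𝒜) : SuperBimodule 𝒜 𝒜 :=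
  letI : Module Aᵐᵒᵖ A := Module.compHom A ((φ : A ≃ₐ[𝕜] A) : A →+* A).op
  { carrier := A
    rightTower := ⟨fun c a x => by
      change x * (φ : A ≃ₐ[𝕜] A) (MulOpposite.unop (c • a)) =
        c • (x * (φ : A ≃ₐ[𝕜] A) (MulOpposite.unop a))
      rw [MulOpposite.unop_smul, map_smul, mul_smul_comm]⟩
    smulComm := ⟨fun a b x => by
      change a * (x * (φ : A ≃ₐ[𝕜] A) (MulOpposite.unop b)) =
        (a * x) * (φ : A ≃ₐ[𝕜] A) (MulOpposite.unop b)
      rw [mul_assoc]⟩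
    grading := 𝒜
    isInternal := DirectSum.Decomposition.isInternal 𝒜
    left_mem := fun ha hm => SetLike.GradedMul.mul_mem ha hm
    right_mem := fun hm hb => SetLike.GradedMul.mul_mem hm ((φ.2 _ _).2 hb) }

/-- The identity bimodule `A`. -/
def regular (𝒜 : ZMod 2 → Submodule 𝕜 A) [GradedAlgebra 𝒜] [FiniteDimensional 𝕜 A] :
    SuperBimodule 𝒜 𝒜 where
  carrier := A
  grading := 𝒜
  isInternal := DirectSum.Decomposition.isInternal 𝒜
  left_mem ha hm := SetLike.GradedMul.mul_mem ha hm
  right_mem hm hb := SetLike.GradedMul.mul_mem hm hb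

open scoped TensorProduct

/-- The subspace of `M ⊗ N` spanned by the elements `(m ◁ b) ⊗ n - m ⊗ (b ▷ n)`. -/
def balancing (M : SuperBimodule 𝒜 ℬ) (N : SuperBimodule ℬ 𝒞) : Submodule 𝕜 (M ⊗[𝕜] N) :=
  Submodule.span 𝕜 {z | ∃ (m : M) (b : B) (n : N),
    z = (MulOpposite.op b • m) ⊗ₜ[𝕜] n - m ⊗ₜ[𝕜] (b • n)}

/-- The underlying vector space of the relative tensor product `M ⊗_B N`. -/
abbrev RelTensor (M : SuperBimodule 𝒜 ℬ) (N : SuperBimodule ℬ 𝒞) : Type u :=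
  (M ⊗[𝕜] N) ⧸ balancing M N

/-- The class of `m ⊗ n` in `M ⊗_B N`. -/
def relTmul (M : SuperBimodule 𝒜 ℬ) (N : SuperBimodule ℬ 𝒞) (m : M) (n : N) : RelTensor M N :=
  Submodule.Quotient.mk (m ⊗ₜ[𝕜] n)

/-- An invertible even intertwiner `M ⊗_B N ≅ P` of `A`-`C`-bimodules. The bimodule structure on
`M ⊗_B N` is `a ▷ (m ⊗ n) ◁ c = (a ▷ m) ⊗ (n ◁ c)`, and its part of degree `d` is spanned by the
`m ⊗ n` with `|m| + |n| = d`, so that it suffices to speak about the elements `m ⊗ n`. -/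
structure TensorIso (M : SuperBimodule 𝒜 ℬ) (N : SuperBimodule ℬ 𝒞) (P : SuperBimodule 𝒜 𝒞) where
  toEquiv : RelTensor M N ≃ₗ[𝕜] P
  map_left : ∀ (a : A) (m : M) (n : N),
    toEquiv (relTmul M N (a • m) n) = a • toEquiv (relTmul M N m n)
  map_right : ∀ (c : C) (m : M) (n : N),
    toEquiv (relTmul M N m (MulOpposite.op c • n)) =
      MulOpposite.op c • toEquiv (relTmul M N m n)
  map_grading : ∀ i j, ∀ m ∈ M.grading i, ∀ n ∈ N.grading j,
    toEquiv (relTmul M N m n) ∈ P.grading (i + j)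

/-- An `A`-`B`-bimodule `M` is invertible if there is a `B`-`A`-bimodule `N` with `M ⊗_B N ≅ A` and
`N ⊗_A M ≅ B`. -/
def IsInvertible [GradedAlgebra 𝒜] [FiniteDimensional 𝕜 A] [GradedAlgebra ℬ]
    [FiniteDimensional 𝕜 B] (M : SuperBimodule 𝒜 ℬ) : Prop :=
  ∃ N : SuperBimodule ℬ 𝒜,
    Nonempty (TensorIso M N (regular 𝒜)) ∧ Nonempty (TensorIso N M (regular ℬ))

end SuperBimodule

/-- A super algebra is Picard-surjective if every invertible `A`-`A`-bimodule is isomorphic to `A_φ`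
for an even automorphism `φ`. -/
def PicardSurjective (𝒜 : ZMod 2 → Submodule 𝕜 A) [GradedAlgebra 𝒜] [FiniteDimensional 𝕜 A] : Prop :=
  ∀ M : SuperBimodule 𝒜 𝒜, M.IsInvertible →
    ∃ φ : evenAut 𝒜, Nonempty (M.Iso (SuperBimodule.twisted φ))

/-- Morita equivalence of super algebras. -/
def SuperMoritaEquivalent (𝒜 : ZMod 2 → Submodule 𝕜 A) [GradedAlgebra 𝒜] [FiniteDimensional 𝕜 A]
    (ℬ : ZMod 2 → Submodule 𝕜 B) [GradedAlgebra ℬ] [FiniteDimensional 𝕜 B] : Prop :=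
  ∃ M : SuperBimodule 𝒜 ℬ, M.IsInvertible

end Bimodules

section Butterflies

/-- `1 → H → K → G → 1` is a short exact sequence of Lie groups: it is an exact sequence of groups,
`i` is a smooth embedding and `p` is a smooth submersion. -/
structure IsLieShortExact {H K G : LieGrp.{u}} (i : H →* K) (p : K →* G) : Prop where
  smooth_left : ContMDiff (𝓡 H.dim) (𝓡 K.dim) ∞ i
  smooth_right : ContMDiff (𝓡 K.dim) (𝓡 G.dim) ∞ p
  injective : Function.Injective i
  exact : i.range = p.ker
  surjective : Function.Surjective p
  embedding : Topology.IsEmbedding i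
  immersion : ∀ h : H, Function.Injective (mfderiv (𝓡 H.dim) (𝓡 K.dim) i h)
  submersion : ∀ k : K, Function.Surjective (mfderiv (𝓡 K.dim) (𝓡 G.dim) p k)

/-- A diagram of groups and homomorphisms of the shape of a butterfly. -/
structure ButterflyDiagram (Γ₁ Γ₂ : LieCrossedModule.{u}) where
  K : LieGrp.{u}
  i₁ : Γ₁.H →* K
  i₂ : Γ₂.H →* K
  p₁ : K →* Γ₁.G
  p₂ : K →* Γ₂.G

/-- The diagram is an invertible butterfly (a weak equivalence of crossed modules of Lie groups). -/
structure ButterflyDiagram.IsInvertibleButterfly {Γ₁ Γ₂ : LieCrossedModule.{u}}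
    (D : ButterflyDiagram Γ₁ Γ₂) : Prop where
  comm₁ : ∀ h, D.p₁ (D.i₁ h) = Γ₁.t h
  comm₂ : ∀ h, D.p₂ (D.i₂ h) = Γ₂.t h
  shortExact₁ : IsLieShortExact D.i₁ D.p₂
  shortExact₂ : IsLieShortExact D.i₂ D.p₁
  act₁ : ∀ x h, D.i₁ (Γ₁.act (D.p₁ x) h) = x * D.i₁ h * x⁻¹
  act₂ : ∀ x h, D.i₂ (Γ₂.act (D.p₂ x) h) = x * D.i₂ h * x⁻¹

end Butterflies

section BimoduleButterfly
variable {𝕜 : Type v} [RCLike 𝕜] {A B : Type u} [Ring A] [Algebra 𝕜 A] [FiniteDimensional 𝕜 A]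
  [Ring B] [Algebra 𝕜 B] [FiniteDimensional 𝕜 B]
  {𝒜 : ZMod 2 → Submodule 𝕜 A} {ℬ : ZMod 2 → Submodule 𝕜 B}

namespace SuperBimodule

variable (M : SuperBimodule 𝒜 ℬ)

/-- The group of triples `(φ, ψ, f)` of even automorphisms of `A` and `B`, and an even linear
automorphism `f` of `M` with `f (a ▷ m ◁ b) = φ a ▷ f m ◁ ψ b`. -/
def tripleGroup : Subgroup (evenAut 𝒜 × evenAut ℬ × (M ≃ₗ[𝕜] M)) where
  carrier := {k | (∀ i m, k.2.2 m ∈ M.grading i ↔ m ∈ M.grading i) ∧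
    ∀ (a : A) (b : B) (m : M), k.2.2 (a • MulOpposite.op b • m) =
      (k.1 : A ≃ₐ[𝕜] A) a • MulOpposite.op ((k.2.1 : B ≃ₐ[𝕜] B) b) • k.2.2 m}
  one_mem' := ⟨fun _ _ => Iff.rfl, fun _ _ _ => rfl⟩
  mul_mem' {k l} hk hl := ⟨fun i m => (hk.1 i _).trans (hl.1 i m), fun a b m => by
    change k.2.2 (l.2.2 _) = (k.1 : A ≃ₐ[𝕜] A) ((l.1 : A ≃ₐ[𝕜] A) a) •
      MulOpposite.op ((k.2.1 : B ≃ₐ[𝕜] B) ((l.2.1 : B ≃ₐ[𝕜] B) b)) • k.2.2 (l.2.2 m)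
    rw [hl.2, hk.2]⟩
  inv_mem' {k} hk := ⟨fun i m => by
    rw [← hk.1 i (k⁻¹.2.2 m)]
    change k.2.2 (k.2.2.symm m) ∈ _ ↔ _
    rw [LinearEquiv.apply_symm_apply], fun a b m => by
    change k.2.2.symm _ = (k.1 : A ≃ₐ[𝕜] A).symm a •
      MulOpposite.op ((k.2.1 : B ≃ₐ[𝕜] B).symm b) • k.2.2.symm m
    rw [LinearEquiv.symm_apply_eq, hk.2, AlgEquiv.apply_symm_apply, AlgEquiv.apply_symm_apply,
      LinearEquiv.apply_symm_apply]⟩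

/-- The ambient algebra for the group of triples. -/
abbrev TripleAlg : Type v := CoordEnd 𝕜 A × CoordEnd 𝕜 B × CoordEnd 𝕜 M

/-- The component in `GL(A)`. -/
def projA : (M.TripleAlg)ˣ →* (CoordEnd 𝕜 A)ˣ := Units.map (MonoidHom.fst _ _)

/-- The component in `GL(B)`. -/
def projB : (M.TripleAlg)ˣ →* (CoordEnd 𝕜 B)ˣ :=
  Units.map ((MonoidHom.fst _ _).comp (MonoidHom.snd _ _))

/-- The component in `GL(M)`. -/
def projM : (M.TripleAlg)ˣ →* (CoordEnd 𝕜 M)ˣ :=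
  Units.map ((MonoidHom.snd _ _).comp (MonoidHom.snd _ _))

theorem tripleUnits_ext {u w : (M.TripleAlg)ˣ} (hA : M.projA u = M.projA w)
    (hB : M.projB u = M.projB w) (hM : M.projM u = M.projM w) : u = w :=
  Units.ext (Prod.ext (congrArg Units.val hA)
    (Prod.ext (congrArg Units.val hB) (congrArg Units.val hM)))

/-- The group of triples as a subgroup of `GL(A) × GL(B) × GL(M)`, in coordinates. -/
def tripleRep : M.tripleGroup →* (M.TripleAlg)ˣ where
  toFun k := MulEquiv.prodUnits.symm (evenAutRep 𝒜 k.1.1,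
    MulEquiv.prodUnits.symm (evenAutRep ℬ k.1.2.1, glCoord 𝕜 M k.1.2.2))
  map_one' := by simp
  map_mul' k l := M.tripleUnits_ext (map_mul (evenAutRep 𝒜) k.1.1 l.1.1)
    (map_mul (evenAutRep ℬ) k.1.2.1 l.1.2.1) (map_mul (glCoord 𝕜 M) k.1.2.2 l.1.2.2)

theorem projA_tripleRep (k : M.tripleGroup) : M.projA (M.tripleRep k) = evenAutRep 𝒜 k.1.1 :=
  Units.ext rfl

theorem projB_tripleRep (k : M.tripleGroup) : M.projB (M.tripleRep k) = evenAutRep ℬ k.1.2.1 :=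
  Units.ext rfl

theorem projM_tripleRep (k : M.tripleGroup) : M.projM (M.tripleRep k) = glCoord 𝕜 M k.1.2.2 :=
  Units.ext rfl

theorem tripleRep_injective : Function.Injective M.tripleRep := by
  intro k l h
  have h1 := congrArg M.projA h
  have h2 := congrArg M.projB h
  have h3 := congrArg M.projM h
  rw [projA_tripleRep, projA_tripleRep] at h1
  rw [projB_tripleRep, projB_tripleRep] at h2
  rw [projM_tripleRep, projM_tripleRep] at h3
  exact Subtype.ext (Prod.ext (evenAutRep_injective 𝒜 h1)
    (Prod.ext (evenAutRep_injective ℬ h2) (glCoord_injective h3)))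

theorem mem_range_tripleRep (u : (M.TripleAlg)ˣ) :
    u ∈ Set.range M.tripleRep ↔
      (M.projA u ∈ Set.range (evenAutRep 𝒜) ∧ M.projB u ∈ Set.range (evenAutRep ℬ)) ∧
      ((∀ (c : 𝕜) (m : M), ofCoord (M.projM u : CoordEnd 𝕜 M) (c • m) =
        c • ofCoord (M.projM u : CoordEnd 𝕜 M) m) ∧
      (∀ i m, ofCoord (M.projM u : CoordEnd 𝕜 M) m ∈ M.grading i ↔ m ∈ M.grading i)) ∧
      ∀ (a : A) (b : B) (m : M),
        ofCoord (M.projM u : CoordEnd 𝕜 M) (a • MulOpposite.op b • m) =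
        ofCoord (M.projA u : CoordEnd 𝕜 A) a • MulOpposite.op (ofCoord (M.projB u : CoordEnd 𝕜 B) b) •
          ofCoord (M.projM u : CoordEnd 𝕜 M) m := by
  constructor
  · rintro ⟨k, rfl⟩
    simp only [projA_tripleRep, projB_tripleRep, projM_tripleRep, ofCoord_glCoord,
      ofCoord_evenAutRep]
    exact ⟨⟨⟨_, rfl⟩, ⟨_, rfl⟩⟩, ⟨fun c m => map_smul _ c m, k.2.1⟩, k.2.2⟩
  · rintro ⟨⟨⟨φ, hφ⟩, ⟨ψ, hψ⟩⟩, ⟨h1, h2⟩, h3⟩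
    refine ⟨⟨(φ, ψ, ofCoordEquiv (M.projM u) h1), h2, fun a b m => ?_⟩, ?_⟩
    · have := h3 a b m
      rw [← hφ, ← hψ, ofCoord_evenAutRep, ofCoord_evenAutRep] at this
      exact this
    · refine M.tripleUnits_ext ?_ ?_ ?_
      · rw [projA_tripleRep, hφ]
      · rw [projB_tripleRep, hψ]
      · rw [projM_tripleRep, glCoord_ofCoordEquiv]

theorem isClosed_range_tripleRep : IsClosed (Set.range M.tripleRep) := by
  let _ : TopologicalSpace A := moduleTopology 𝕜 A
  have : IsModuleTopology 𝕜 A := ⟨rfl⟩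
  let _ : TopologicalSpace B := moduleTopology 𝕜 B
  have : IsModuleTopology 𝕜 B := ⟨rfl⟩
  let _ : TopologicalSpace M := moduleTopology 𝕜 M
  have : IsModuleTopology 𝕜 M := ⟨rfl⟩
  have := t2Space_moduleTopology (𝕜 := 𝕜) (V := M)
  have cA : Continuous M.projA := Continuous.units_map _ continuous_fst
  have cB : Continuous M.projB := Continuous.units_map _ (continuous_fst.comp continuous_snd)
  have cM : Continuous M.projM := Continuous.units_map _ (continuous_snd.comp continuous_snd)
  have hl : Continuous fun p : A × M => p.1 • p.2 :=
    IsModuleTopology.continuous_bilinear_of_finite_left (R := 𝕜)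
      (LinearMap.mk₂ 𝕜 (fun (a : A) (m : M) => a • m) (fun _ _ _ => add_smul _ _ _)
        (fun _ _ _ => smul_assoc _ _ _) (fun _ _ _ => smul_add _ _ _)
        (fun c a m => smul_algebra_smul_comm c a m))
  have hr : Continuous fun p : B × M => MulOpposite.op p.1 • p.2 :=
    IsModuleTopology.continuous_bilinear_of_finite_left (R := 𝕜)
      (LinearMap.mk₂ 𝕜 (fun (b : B) (m : M) => MulOpposite.op b • m)
        (fun _ _ _ => by rw [MulOpposite.op_add, add_smul])
        (fun _ _ _ => by rw [MulOpposite.op_smul, smul_assoc]) (fun _ _ _ => smul_add _ _ _)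
        (fun c b m => smul_algebra_smul_comm c (MulOpposite.op b) m))
  have h : Set.range M.tripleRep =
      (M.projA ⁻¹' Set.range (evenAutRep 𝒜) ∩ M.projB ⁻¹' Set.range (evenAutRep ℬ)) ∩
      ((M.projM ⁻¹' {w : (CoordEnd 𝕜 M)ˣ | ∀ (c : 𝕜) (m : M),
          ofCoord (w : CoordEnd 𝕜 M) (c • m) = c • ofCoord (w : CoordEnd 𝕜 M) m} ∩
        M.projM ⁻¹' {w : (CoordEnd 𝕜 M)ˣ | ∀ i m,
          ofCoord (w : CoordEnd 𝕜 M) m ∈ M.grading i ↔ m ∈ M.grading i}) ∩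
      ⋂ a : A, ⋂ b : B, ⋂ m : M,
        {u : (M.TripleAlg)ˣ | ofCoord (M.projM u : CoordEnd 𝕜 M) (a • MulOpposite.op b • m) =
          ofCoord (M.projA u : CoordEnd 𝕜 A) a •
            MulOpposite.op (ofCoord (M.projB u : CoordEnd 𝕜 B) b) •
              ofCoord (M.projM u : CoordEnd 𝕜 M) m}) := by
    ext u
    rw [mem_range_tripleRep]
    simp only [Set.mem_inter_iff, Set.mem_ofPred_eq, Set.mem_iInter, Set.mem_preimage]
  rw [h]
  refine (((isClosed_range_evenAutRep 𝒜).preimage cA).inter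
    ((isClosed_range_evenAutRep ℬ).preimage cB)).inter
    (((isClosed_setOf_smul.preimage cM).inter ((isClosed_setOf_graded _).preimage cM)).inter
      (isClosed_iInter fun a => isClosed_iInter fun b => isClosed_iInter fun m => isClosed_eq ?_ ?_))
  · exact (continuous_ofCoord (a • MulOpposite.op b • m)).comp cM
  · exact hl.comp (((continuous_ofCoord a).comp cA).prodMk
      (hr.comp (((continuous_ofCoord b).comp cB).prodMk ((continuous_ofCoord m).comp cM))))

/-- The Lie group of triples, a closed subgroup of `Aut(A) × Aut(B) × GL(M)`. -/
def tripleLie : LieGrp.{u} :=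
  LieGrp.ofClosed (𝔸 := M.TripleAlg) M.tripleGroup M.tripleRep M.tripleRep_injective
    M.isClosed_range_tripleRep

variable [GradedAlgebra 𝒜] [GradedAlgebra ℬ]

/-- The action of an even unit of `A` on `M` from the left. -/
def leftAct (a : evenUnits 𝒜) : M ≃ₗ[𝕜] M where
  toFun m := ((a : Aˣ) : A) • m
  invFun m := (((a : Aˣ)⁻¹ : Aˣ) : A) • m
  map_add' := smul_add _
  map_smul' c m := smul_algebra_smul_comm c ((a : Aˣ) : A) m
  left_inv m := by simp [smul_smul]
  right_inv m := by simp [smul_smul]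

/-- The action of the inverse of an even unit of `B` on `M` from the right. -/
def rightInvAct (b : evenUnits ℬ) : M ≃ₗ[𝕜] M where
  toFun m := MulOpposite.op (((b : Bˣ)⁻¹ : Bˣ) : B) • m
  invFun m := MulOpposite.op ((b : Bˣ) : B) • m
  map_add' := smul_add _
  map_smul' c m := smul_algebra_smul_comm c (MulOpposite.op (((b : Bˣ)⁻¹ : Bˣ) : B)) m
  left_inv m := by simp [smul_smul, ← MulOpposite.op_mul]
  right_inv m := by simp [smul_smul, ← MulOpposite.op_mul]

theorem leftAct_mem (a : evenUnits 𝒜) (i : ZMod 2) (m : M) :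
    M.leftAct a m ∈ M.grading i ↔ m ∈ M.grading i := by
  have key : ∀ (b : evenUnits 𝒜) (y : M), y ∈ M.grading i → M.leftAct b y ∈ M.grading i :=
    fun b y hy => by
      have := M.left_mem b.2 hy
      rwa [zero_add] at this
  refine ⟨fun h => ?_, key a m⟩
  have := key a⁻¹ _ h
  rwa [show M.leftAct a⁻¹ (M.leftAct a m) = m from (M.leftAct a).left_inv m] at this

theorem rightInvAct_mem (b : evenUnits ℬ) (i : ZMod 2) (m : M) :
    M.rightInvAct b m ∈ M.grading i ↔ m ∈ M.grading i := by
  have key : ∀ (b : evenUnits ℬ) (y : M), y ∈ M.grading i → M.rightInvAct b y ∈ M.grading i :=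
    fun b y hy => by
      have := M.right_mem hy (b⁻¹).2
      rwa [add_zero] at this
  refine ⟨fun h => ?_, key b m⟩
  have := key b⁻¹ _ h
  rwa [show M.rightInvAct b⁻¹ (M.rightInvAct b m) = m by
    have := (M.rightInvAct b).left_inv m
    simpa [rightInvAct] using this] at this

/-- `a ↦ (i(a), id, l_a)`, where `i(a)` is conjugation and `l_a` the left action. -/
def inclLeft : evenUnits 𝒜 →* M.tripleGroup where
  toFun a := ⟨(innerAut 𝒜 a, 1, M.leftAct a), M.leftAct_mem a, fun x b m => by
    change ((a : Aˣ) : A) • x • MulOpposite.op b • m =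
      (((a : Aˣ) : A) * x * (((a : Aˣ)⁻¹ : Aˣ) : A)) • MulOpposite.op b • ((a : Aˣ) : A) • m
    rw [← smul_comm ((a : Aˣ) : A) (MulOpposite.op b) m, smul_smul, smul_smul, mul_assoc,
      Units.inv_mul, mul_one]⟩
  map_one' := Subtype.ext (Prod.ext (map_one _) (Prod.ext rfl
    (LinearEquiv.ext fun m => one_smul A m)))
  map_mul' a b := Subtype.ext (Prod.ext (map_mul _ a b) (Prod.ext rfl
    (LinearEquiv.ext fun m => mul_smul ((a : Aˣ) : A) ((b : Aˣ) : A) m)))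

/-- `b ↦ (id, i(b), r_{b⁻¹})`, where `i(b)` is conjugation and `r_b` the right action. -/
def inclRight : evenUnits ℬ →* M.tripleGroup where
  toFun b := ⟨(1, innerAut ℬ b, M.rightInvAct b), M.rightInvAct_mem b, fun a x m => by
    change MulOpposite.op (((b : Bˣ)⁻¹ : Bˣ) : B) • a • MulOpposite.op x • m =
      a • MulOpposite.op (((b : Bˣ) : B) * x * (((b : Bˣ)⁻¹ : Bˣ) : B)) •
        MulOpposite.op (((b : Bˣ)⁻¹ : Bˣ) : B) • m
    rw [← smul_comm a (MulOpposite.op (((b : Bˣ)⁻¹ : Bˣ) : B)), smul_smul, smul_smul,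
      ← MulOpposite.op_mul, ← MulOpposite.op_mul, ← mul_assoc, ← mul_assoc, Units.inv_mul, one_mul]⟩
  map_one' := Subtype.ext (Prod.ext rfl (Prod.ext (map_one _)
    (LinearEquiv.ext fun m => by
      change MulOpposite.op ((((1 : evenUnits ℬ) : Bˣ)⁻¹ : Bˣ) : B) • m = m
      simp)))
  map_mul' a b := Subtype.ext (Prod.ext rfl (Prod.ext (map_mul _ a b)
    (LinearEquiv.ext fun m => by
      change MulOpposite.op ((((a * b : evenUnits ℬ) : Bˣ)⁻¹ : Bˣ) : B) • m =
        MulOpposite.op (((a : Bˣ)⁻¹ : Bˣ) : B) • MulOpposite.op (((b : Bˣ)⁻¹ : Bˣ) : B) • m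
      rw [smul_smul, ← MulOpposite.op_mul, ← Units.val_mul, ← mul_inv_rev]
      rfl)))

/-- The butterfly diagram of a bimodule. -/
def butterfly : ButterflyDiagram (AUT 𝒜) (AUT ℬ) where
  K := M.tripleLie
  i₁ := M.inclLeft
  i₂ := M.inclRight
  p₁ := (MonoidHom.fst _ _).comp M.tripleGroup.subtype
  p₂ := (MonoidHom.fst _ _).comp ((MonoidHom.snd _ _).comp M.tripleGroup.subtype)

end SuperBimodule
end BimoduleButterfly

section Cech
variable (E : Type*) [NormedAddCommGroup E] [NormedSpace ℝ E]
  (X : Type w) [TopologicalSpace X] [ChartedSpace E X]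

/-- An open cover `(Uᵢ)` of `X`. -/
structure OpenCover (X : Type w) [TopologicalSpace X] : Type (w + 1) where
  ι : Type w
  U : ι → Set X
  isOpen : ∀ i, IsOpen (U i)
  covers : ∀ x, ∃ i, x ∈ U i

/-- A Čech cocycle on `X` with values in a crossed module, with respect to some open cover. The maps
`g i j` and `a i j k` are smooth maps on `Uᵢ ∩ Uⱼ` and `Uᵢ ∩ Uⱼ ∩ Uₖ`; their values elsewhere are
irrelevant. -/
structure CechCocycle (Γ : LieCrossedModule.{u}) where
  cover : OpenCover X
  g : cover.ι → cover.ι → X → Γ.G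
  a : cover.ι → cover.ι → cover.ι → X → Γ.H
  smooth_g : ∀ i j, ContMDiffOn 𝓘(ℝ, E) (𝓡 Γ.G.dim) ∞ (g i j) (cover.U i ∩ cover.U j)
  smooth_a : ∀ i j k, ContMDiffOn 𝓘(ℝ, E) (𝓡 Γ.H.dim) ∞ (a i j k)
    (cover.U i ∩ cover.U j ∩ cover.U k)
  cocycle_g : ∀ i j k, ∀ x ∈ cover.U i ∩ cover.U j ∩ cover.U k,
    Γ.t (a i j k x) * g j k x * g i j x = g i k x
  cocycle_a : ∀ i j k l, ∀ x ∈ cover.U i ∩ cover.U j ∩ cover.U k ∩ cover.U l,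
    a i k l x * Γ.act (g k l x) (a i j k x) = a i j l x * a j k l x

variable {E X} {Γ Γ₁ Γ₂ : LieCrossedModule.{u}}

/-- Two cocycles are equivalent if they are related by a coboundary `(h, e)` on a common refinement
`W` of their covers. -/
def CechCocycle.Equivalent (c c' : CechCocycle E X Γ) : Prop :=
  ∃ (W : OpenCover X) (r : W.ι → c.cover.ι) (r' : W.ι → c'.cover.ι)
    (h : W.ι → X → Γ.G) (e : W.ι → W.ι → X → Γ.H),
    (∀ i, W.U i ⊆ c.cover.U (r i)) ∧ (∀ i, W.U i ⊆ c'.cover.U (r' i)) ∧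
    (∀ i, ContMDiffOn 𝓘(ℝ, E) (𝓡 Γ.G.dim) ∞ (h i) (W.U i)) ∧
    (∀ i j, ContMDiffOn 𝓘(ℝ, E) (𝓡 Γ.H.dim) ∞ (e i j) (W.U i ∩ W.U j)) ∧
    (∀ i j, ∀ x ∈ W.U i ∩ W.U j,
      Γ.t (e i j x) * h j x * c.g (r i) (r j) x = c'.g (r' i) (r' j) x * h i x) ∧
    ∀ i j k, ∀ x ∈ W.U i ∩ W.U j ∩ W.U k,
      c'.a (r' i) (r' j) (r' k) x * Γ.act (c'.g (r' j) (r' k) x) (e i j x) * e j k x =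
        e i k x * Γ.act (h k x) (c.a (r i) (r j) (r k) x)

variable (E X Γ) in
/-- The Čech cohomology `Ȟ¹(X, Γ)`: the set of equivalence classes of cocycles. -/
def CechH1 := Quot (CechCocycle.Equivalent (E := E) (X := X) (Γ := Γ))

/-- The cocycle `d = (f, b)` with values in `Γ₂` is obtained from the cocycle `c = (g, a)` with
values in `Γ₁` by means of the butterfly: after restriction of `c` to a refinement, there are smooth
lifts `k` of `g` along `p₁` such that `f = p₂ ∘ k` and
`i₂ (b i j l) = (k i l) (k i j)⁻¹ (k j l)⁻¹ (i₁ (a i j l))⁻¹`. -/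
def ButterflyDiagram.Transports (D : ButterflyDiagram Γ₁ Γ₂) (c : CechCocycle E X Γ₁)
    (d : CechCocycle E X Γ₂) : Prop :=
  ∃ (r : d.cover.ι → c.cover.ι) (k : d.cover.ι → d.cover.ι → X → D.K),
    (∀ i, d.cover.U i ⊆ c.cover.U (r i)) ∧
    (∀ i j, ContMDiffOn 𝓘(ℝ, E) (𝓡 D.K.dim) ∞ (k i j) (d.cover.U i ∩ d.cover.U j)) ∧
    (∀ i j, ∀ x ∈ d.cover.U i ∩ d.cover.U j,
      D.p₁ (k i j x) = c.g (r i) (r j) x ∧ D.p₂ (k i j x) = d.g i j x) ∧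
    ∀ i j l, ∀ x ∈ d.cover.U i ∩ d.cover.U j ∩ d.cover.U l,
      D.i₂ (d.a i j l x) =
        k i l x * (k i j x)⁻¹ * (k j l x)⁻¹ * (D.i₁ (c.a (r i) (r j) (r l) x))⁻¹

end Cech

end

/-! Algebra. An invertible bimodule M is a progenerator on either side, and each of the two algebras
is the full endomorphism ring of M over the other (`IsMoritaPair`, obtained from the isomorphisms M
⊗_B N ≅ A and N ⊗_A M ≅ B). This gives exactness of the two sequences: if ψ = id, then f is an even
right B-linear automorphism of M, that is, the left action of an even unit of A; on the other side
likewise.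

Picard-surjectivity is used only for the surjectivity of the projections. Given ψ in Aut(B), the
space of maps f with f(mb) = f(m)ψ(b) is an A-A-bimodule, and it is invertible: composition with
ψ⁻¹-twisted maps gives B-linear maps, i.e. elements of A. So it is isomorphic to some A_φ. The map f
that corresponds to 1 in A_φ is even, satisfies f(am) = φ(a)f(m), and generates all ψ-twisted maps
over A. Since the identity of M is a sum of products of ψ-twisted and ψ⁻¹-twisted maps, f is
surjective, hence bijective, and (φ, ψ, f) lies over ψ (`exists_triple_of_right`, and
`exists_triple_of_left` for the other projection).

Smoothness. If ∑ xᵢ lᵢ(m) = m is a dual basis of M over B, then m ↦ ∑ xᵢ ψ(lᵢ(m)) is ψ-twisted,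
depends linearly on ψ and is the identity for ψ = id. After averaging over the parity it is even,
and near ψ = id it is invertible; φ is then read off by conjugation. This is a local section near
the unit (`hasLocalSections_projRight`), which translations move to every point, so the projections
are submersions. The inclusions are embeddings because a in A can be recovered from its action on M
by a linear formula, which is defined on all of End(M) (`exists_retraction_left`).

Cohomology. The argument works for every invertible butterfly with these two smoothness properties.
The images of i₁ and i₂ commute, so (h₁, h₂) ↦ i₁(h₁) i₂(h₂) is a homomorphism to K, and conjugation
in K acts on its source componentwise. Let g̃ be a lift of g along p₁; paracompactness provides it
on the double intersections of a refinement. The defect g̃_αγ g̃_αβ⁻¹ g̃_βγ⁻¹ lies over t₁(a_αβγ),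
so it is i₁(a_αβγ) i₂(b_αβγ) for a unique b_αβγ. Each identity that is required of b holds after
joining with a, by cancellation in K, and holds for a; hence it holds for b, because i₂ is injective
(`eq_of_joint_eq`). Coboundaries are transported by the same argument. The construction is symmetric
in the two crossed modules, and the same lifts g̃ transport b back to a restriction of a, which
gives the inverse map. Uniqueness holds since every cocycle can be transported. -/

noncomputable section

/-! ### Refinements of open covers -/

section Refinement
variable {X : Type w} [TopologicalSpace X]

/-- The common refinement of two open covers. -/
def OpenCover.inter (U V : OpenCover X) : OpenCover X where
  ι := U.ι × V.ι
  U p := U.U p.1 ∩ V.U p.2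
  isOpen p := (U.isOpen p.1).inter (V.isOpen p.2)
  covers x :=
    let ⟨i, hi⟩ := U.covers x
    let ⟨j, hj⟩ := V.covers x
    ⟨(i, j), hi, hj⟩

/-- The open cover by neighbourhoods of the points of `X`. -/
def OpenCover.ofPoints (N : X → Set X) (hN : ∀ x, IsOpen (N x)) (hx : ∀ x, x ∈ N x) :
    OpenCover X where
  ι := X
  U := N
  isOpen := hN
  covers x := ⟨x, hx x⟩

/-- A refinement whose members satisfy a property that holds locally. -/
theorem OpenCover.exists_refinement (U : OpenCover X) (P : U.ι → Set X → Prop)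
    (hloc : ∀ i, ∀ x ∈ U.U i, ∃ O, IsOpen O ∧ x ∈ O ∧ O ⊆ U.U i ∧ P i O) :
    ∃ (W : OpenCover X) (r : W.ι → U.ι), (∀ a, W.U a ⊆ U.U (r a)) ∧ ∀ a, P (r a) (W.U a) := by
  choose i hi using U.covers
  choose O hO hxO hOU hP using fun x => hloc (i x) x (hi x)
  exact ⟨.ofPoints O hO hxO, i, hOU, hP⟩

/-- On a paracompact Hausdorff space, every open cover has a refinement whose pairwise intersections
satisfy a property that holds locally on the pairwise intersections of the given cover. -/
theorem OpenCover.exists_refinement_inter [T2Space X] [ParacompactSpace X] (U : OpenCover X)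
    (P : U.ι → U.ι → Set X → Prop)
    (hmono : ∀ i j (O O' : Set X), O' ⊆ O → P i j O → P i j O')
    (hempty : ∀ i j, P i j ∅)
    (hloc : ∀ i j, ∀ x ∈ U.U i ∩ U.U j, ∃ O, IsOpen O ∧ x ∈ O ∧ P i j O) :
    ∃ (W : OpenCover X) (r : W.ι → U.ι), (∀ a, W.U a ⊆ U.U (r a)) ∧
      ∀ a b, P (r a) (r b) (W.U a ∩ W.U b) := by
  -- Pass to a locally finite refinement with the same index set, then shrink it to `s` so that the
  -- closures still lie in it. The new cover consists of small neighbourhoods of the points `x`,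
  -- each attached to an index `r x` with `x ∈ s (r x)`.
  obtain ⟨v, hvo, hvc, hvf, hvU⟩ := precise_refinement U.U U.isOpen
    (Set.eq_univ_of_forall fun x => Set.mem_iUnion.2 (U.covers x))
  obtain ⟨s, hsc, hso, hsv⟩ := exists_iUnion_eq_closure_subset hvo hvf.point_finite hvc
  have hsf : LocallyFinite fun i => closure (s i) := hvf.subset hsv
  have hi : ∀ x, ∃ i, x ∈ s i := fun x => by
    have : x ∈ ⋃ i, s i := hsc ▸ Set.mem_univ x
    exact Set.mem_iUnion.1 this
  choose r hr using hi
  choose! Q hQo hxQ hQP using hloc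
  -- a neighbourhood of `x` that meets `s j` only if `x ∈ closure (s j)`, and that is contained in
  -- the nice neighbourhoods of `x`
  have hN : ∀ x, ∃ N, IsOpen N ∧ x ∈ N ∧ N ⊆ s (r x) ∧ ∀ j, (N ∩ s j).Nonempty →
      x ∈ U.U j ∧ N ⊆ Q (r x) j x := by
    intro x
    -- Only finitely many closures meet `T`, so only finitely many conditions have to hold near `x`.
    obtain ⟨T, hT, hTf⟩ := hsf x
    set J := {j | (closure (s j) ∩ T).Nonempty} with hJ
    have hev : ∀ j ∈ J, ∀ᶠ y in 𝓝 x, (y ∈ s j → x ∈ closure (s j)) ∧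
        (x ∈ U.U j → y ∈ Q (r x) j x) := by
      intro j _
      refine Filter.Eventually.and ?_ ?_
      · by_cases hx : x ∈ closure (s j)
        · exact Filter.Eventually.of_forall fun _ _ => hx
        · filter_upwards [isClosed_closure.isOpen_compl.mem_nhds hx] with y hy hys
          exact absurd (subset_closure hys) hy
      · by_cases hx : x ∈ U.U j
        · have hx' : x ∈ U.U (r x) ∩ U.U j := ⟨hvU _ (hsv _ (subset_closure (hr x))), hx⟩
          filter_upwards [(hQo _ _ x hx').mem_nhds (hxQ _ _ x hx')] with y hy _ using hy
        · exact Filter.Eventually.of_forall fun _ h => absurd h hx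
    have hall : ∀ᶠ y in 𝓝 x, ∀ j ∈ J, (y ∈ s j → x ∈ closure (s j)) ∧
        (x ∈ U.U j → y ∈ Q (r x) j x) := (Filter.eventually_all_finite hTf).2 hev
    obtain ⟨N, hNs, hNo, hxN⟩ := eventually_nhds_iff.1
      (hall.and (Filter.inter_mem ((hso (r x)).mem_nhds (hr x)) hT : ∀ᶠ y in 𝓝 x, y ∈ s (r x) ∩ T))
    refine ⟨N, hNo, hxN, fun y hy => (hNs y hy).2.1, fun j => ?_⟩
    rintro ⟨y, hyN, hys⟩
    have hjJ : j ∈ J := ⟨y, subset_closure hys, (hNs y hyN).2.2⟩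
    have hxU : x ∈ U.U j := hvU _ (hsv _ (((hNs y hyN).1 j hjJ).1 hys))
    exact ⟨hxU, fun z hz => ((hNs z hz).1 j hjJ).2 hxU⟩
  choose N hNo hxN hNs hNQ using hN
  refine ⟨.ofPoints N hNo hxN, r,
    fun x => (hNs x).trans (subset_closure.trans ((hsv _).trans (hvU _))), fun x y => ?_⟩
  change P (r x) (r y) (N x ∩ N y)
  -- If `N x` and `N y` meet, then `N x` meets `s (r y)`, because `N y ⊆ s (r y)`. This is the
  -- situation in which `N x` was made small enough.
  rcases (N x ∩ N y).eq_empty_or_nonempty with h | ⟨z, hzx, hzy⟩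
  · rw [h]
    exact hempty _ _
  · obtain ⟨hxU, hsub⟩ := hNQ x (r y) ⟨z, hzx, hNs y hzy⟩
    have hx' : x ∈ U.U (r x) ∩ U.U (r y) := ⟨hvU _ (hsv _ (subset_closure (hr x))), hxU⟩
    exact hmono _ _ _ _ (Set.inter_subset_left.trans hsub) (hQP _ _ x hx')

end Refinement

/-! ### Equivalence of Čech cocycles -/

section CrossedModule
variable (Γ : LieCrossedModule.{u})

/-- The Peiffer identity, for `y = t e * x`. -/
theorem LieCrossedModule.act_of_eq {e : Γ.H} {x y : Γ.G} (h : Γ.t e * x = y) (z : Γ.H) :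
    Γ.act y z * e = e * Γ.act x z := by
  rw [← h, map_mul, MulAut.mul_apply, Γ.act_t]
  group

end CrossedModule

section Equivalence
variable {E : Type*} [NormedAddCommGroup E] [NormedSpace ℝ E]
  {X : Type w} [TopologicalSpace X] [ChartedSpace E X] {Γ Γ₁ Γ₂ : LieCrossedModule.{u}}

theorem LieCrossedModule.contMDiffOn_act {g : X → Γ.G} {h : X → Γ.H} {s : Set X}
    (hg : ContMDiffOn 𝓘(ℝ, E) (𝓡 Γ.G.dim) ∞ g s) (hh : ContMDiffOn 𝓘(ℝ, E) (𝓡 Γ.H.dim) ∞ h s) :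
    ContMDiffOn 𝓘(ℝ, E) (𝓡 Γ.H.dim) ∞ (fun x => Γ.act (g x) (h x)) s :=
  Γ.smooth_act.comp_contMDiffOn (hg.prodMk hh)

namespace CechCocycle

/-- The restriction of a cocycle to a refinement of its cover. -/
def restrict (c : CechCocycle E X Γ) (W : OpenCover X) (r : W.ι → c.cover.ι)
    (hr : ∀ i, W.U i ⊆ c.cover.U (r i)) : CechCocycle E X Γ where
  cover := W
  g i j := c.g (r i) (r j)
  a i j k := c.a (r i) (r j) (r k)
  smooth_g i j := (c.smooth_g _ _).mono (Set.inter_subset_inter (hr i) (hr j))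
  smooth_a i j k := (c.smooth_a _ _ _).mono
    (Set.inter_subset_inter (Set.inter_subset_inter (hr i) (hr j)) (hr k))
  cocycle_g i j k x hx := c.cocycle_g _ _ _ x ⟨⟨hr i hx.1.1, hr j hx.1.2⟩, hr k hx.2⟩
  cocycle_a i j k l x hx :=
    c.cocycle_a _ _ _ _ x ⟨⟨⟨hr i hx.1.1.1, hr j hx.1.1.2⟩, hr k hx.1.2⟩, hr l hx.2⟩

/-- The cocycles `c` and `c'` are related by a coboundary on the refinement `W` of their covers. -/
def EquivOn (c c' : CechCocycle E X Γ) (W : OpenCover X) (r : W.ι → c.cover.ι)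
    (r' : W.ι → c'.cover.ι) : Prop :=
  ∃ (h : W.ι → X → Γ.G) (e : W.ι → W.ι → X → Γ.H),
    (∀ i, ContMDiffOn 𝓘(ℝ, E) (𝓡 Γ.G.dim) ∞ (h i) (W.U i)) ∧
    (∀ i j, ContMDiffOn 𝓘(ℝ, E) (𝓡 Γ.H.dim) ∞ (e i j) (W.U i ∩ W.U j)) ∧
    (∀ i j, ∀ x ∈ W.U i ∩ W.U j,
      Γ.t (e i j x) * h j x * c.g (r i) (r j) x = c'.g (r' i) (r' j) x * h i x) ∧
    ∀ i j k, ∀ x ∈ W.U i ∩ W.U j ∩ W.U k,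
      c'.a (r' i) (r' j) (r' k) x * Γ.act (c'.g (r' j) (r' k) x) (e i j x) * e j k x =
        e i k x * Γ.act (h k x) (c.a (r i) (r j) (r k) x)

variable {c c' c'' : CechCocycle E X Γ} {W : OpenCover X} {r : W.ι → c.cover.ι}
  {r' : W.ι → c'.cover.ι} {r'' : W.ι → c''.cover.ι}

theorem EquivOn.equivalent (h : EquivOn c c' W r r') (hr : ∀ i, W.U i ⊆ c.cover.U (r i))
    (hr' : ∀ i, W.U i ⊆ c'.cover.U (r' i)) : c.Equivalent c' := by
  obtain ⟨h, e, h1, h2, h3, h4⟩ := h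
  exact ⟨W, r, r', h, e, hr, hr', h1, h2, h3, h4⟩

theorem EquivOn.comp (h : EquivOn c c' W r r') (V : OpenCover X) (q : V.ι → W.ι)
    (hq : ∀ i, V.U i ⊆ W.U (q i)) : EquivOn c c' V (r ∘ q) (r' ∘ q) := by
  obtain ⟨h, e, h1, h2, h3, h4⟩ := h
  exact ⟨fun i => h (q i), fun i j => e (q i) (q j), fun i => (h1 _).mono (hq i),
    fun i j => (h2 _ _).mono (Set.inter_subset_inter (hq i) (hq j)),
    fun i j x hx => h3 _ _ x ⟨hq i hx.1, hq j hx.2⟩,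
    fun i j k x hx => h4 _ _ _ x ⟨⟨hq i hx.1.1, hq j hx.1.2⟩, hq k hx.2⟩⟩

/-- Coboundaries compose to (h'h, e' · ʰ'e). The triple identity reduces to the two given ones once
the Peiffer identity has moved the transported e past e'. -/
theorem EquivOn.trans (h₁ : EquivOn c c' W r r') (h₂ : EquivOn c' c'' W r' r'') :
    EquivOn c c'' W r r'' := by
  obtain ⟨h, e, h1, h2, h3, h4⟩ := h₁
  obtain ⟨h', e', h1', h2', h3', h4'⟩ := h₂
  refine ⟨fun i x => h' i x * h i x, fun i j x => e' i j x * Γ.act (h' j x) (e i j x),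
    fun i => (h1' i).mul (h1 i), fun i j => (h2' i j).mul (LieCrossedModule.contMDiffOn_act
      ((h1' j).mono Set.inter_subset_right) (h2 i j)), fun i j x hx => ?_, fun i j k x hx => ?_⟩
  · have e1 := h3 i j x hx
    have e2 := h3' i j x hx
    beta_reduce
    rw [← mul_assoc (c''.g _ _ x), ← e2, map_mul, Γ.t_act, mul_assoc _ (c'.g _ _ x) (h i x), ← e1]
    group
  · have e3 := h4 i j k x hx
    have e4 := h4' i j k x hx
    have e5 := Γ.act_of_eq (x := h' k x * c'.g (r' j) (r' k) x) (y := c''.g (r'' j) (r'' k) x * h' j x)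
      (by rw [← mul_assoc]; exact h3' j k x ⟨hx.1.2, hx.2⟩) (e i j x)
    simp only [map_mul, MulAut.mul_apply] at e5 ⊢
    calc _ = c''.a (r'' i) (r'' j) (r'' k) x * Γ.act (c''.g (r'' j) (r'' k) x) (e' i j x) *
          (Γ.act (c''.g (r'' j) (r'' k) x) (Γ.act (h' j x) (e i j x)) * e' j k x) *
          Γ.act (h' k x) (e j k x) := by group
      _ = c''.a (r'' i) (r'' j) (r'' k) x * Γ.act (c''.g (r'' j) (r'' k) x) (e' i j x) * e' j k x *
          (Γ.act (h' k x) (Γ.act (c'.g (r' j) (r' k) x) (e i j x)) * Γ.act (h' k x) (e j k x)) := by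
            rw [e5]; group
      _ = e' i k x * Γ.act (h' k x) (c'.a (r' i) (r' j) (r' k) x *
          Γ.act (c'.g (r' j) (r' k) x) (e i j x) * e j k x) := by
            rw [e4, map_mul, map_mul]; group
      _ = _ := by rw [e3, map_mul]; group

/-- Two restrictions of a cocycle to the same refinement are related by a coboundary. -/
theorem equivOn_index (c : CechCocycle E X Γ) (W : OpenCover X) (r s : W.ι → c.cover.ι)
    (hr : ∀ i, W.U i ⊆ c.cover.U (r i)) (hs : ∀ i, W.U i ⊆ c.cover.U (s i)) :
    EquivOn c c W r s := by
  -- The 1-cell is `g` from the index `r i` to the index `s i`; `e` compares the two ways from `r i`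
  -- to `s j`, through `s i` and through `r j`.
  refine ⟨fun i => c.g (r i) (s i),
    fun i j x => (c.a (r i) (s i) (s j) x)⁻¹ * c.a (r i) (r j) (s j) x,
    fun i => (c.smooth_g _ _).mono fun x hx => ⟨hr i hx, hs i hx⟩,
    fun i j => ContMDiffOn.mul (ContMDiffOn.inv ((c.smooth_a _ _ _).mono
      fun x hx => ⟨⟨hr i hx.1, hs i hx.1⟩, hs j hx.2⟩)) ((c.smooth_a _ _ _).mono
      fun x hx => ⟨⟨hr i hx.1, hr j hx.2⟩, hs j hx.2⟩), fun i j x hx => ?_, fun i j k x hx => ?_⟩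
  · have e1 := c.cocycle_g (r i) (s i) (s j) x ⟨⟨hr i hx.1, hs i hx.1⟩, hs j hx.2⟩
    have e2 := c.cocycle_g (r i) (r j) (s j) x ⟨⟨hr i hx.1, hr j hx.2⟩, hs j hx.2⟩
    rw [map_mul, map_inv, mul_assoc, mul_assoc, inv_mul_eq_iff_eq_mul, ← mul_assoc, e2, ← e1,
      mul_assoc]
  -- These are the cocycle identities on the three tetrahedra of the prism between the triangles `r
  -- i, r j, r k` and `s i, s j, s k`.
  · have e1 := c.cocycle_a (r i) (s i) (s j) (s k) x
      ⟨⟨⟨hr i hx.1.1, hs i hx.1.1⟩, hs j hx.1.2⟩, hs k hx.2⟩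
    have e2 := c.cocycle_a (r i) (r j) (s j) (s k) x
      ⟨⟨⟨hr i hx.1.1, hr j hx.1.2⟩, hs j hx.1.2⟩, hs k hx.2⟩
    have e3 := c.cocycle_a (r i) (r j) (r k) (s k) x
      ⟨⟨⟨hr i hx.1.1, hr j hx.1.2⟩, hr k hx.2⟩, hs k hx.2⟩
    rw [← eq_inv_mul_iff_mul_eq] at e1 e2 e3
    simp only [map_mul, map_inv, e1, e2, e3]
    group

theorem restrict_equivalent (c : CechCocycle E X Γ) (W : OpenCover X) (r : W.ι → c.cover.ι)
    (hr : ∀ i, W.U i ⊆ c.cover.U (r i)) : (c.restrict W r hr).Equivalent c :=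
  have h : EquivOn (c.restrict W r hr) c W id r := c.equivOn_index W r r hr hr
  h.equivalent (fun _ => subset_rfl) hr

end CechCocycle
end Equivalence

/-! ### Transport of cocycles along an invertible butterfly -/

/-- A map of Lie groups that has smooth local sections through every point. -/
def HasLocalSections {K G : LieGrp.{u}} (p : K →* G) : Prop :=
  ∀ k : K, ∃ (O : Set G) (σ : G → K), IsOpen O ∧ p k ∈ O ∧
    ContMDiffOn (𝓡 G.dim) (𝓡 K.dim) ∞ σ O ∧ (∀ g ∈ O, p (σ g) = g) ∧ σ (p k) = k

/-- A map of Lie groups such that a map into its source is smooth if its composition with it is. -/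
def ReflectsSmooth {H K : LieGrp.{u}} (i : H →* K) (E : Type*) [NormedAddCommGroup E]
    [NormedSpace ℝ E] (X : Type w) [TopologicalSpace X] [ChartedSpace E X] : Prop :=
  ∀ (f : X → H) (s : Set X), ContMDiffOn 𝓘(ℝ, E) (𝓡 K.dim) ∞ (fun x => i (f x)) s →
    ContMDiffOn 𝓘(ℝ, E) (𝓡 H.dim) ∞ f s

section Butterfly
variable {E : Type*} [NormedAddCommGroup E] [NormedSpace ℝ E]
  {X : Type w} [TopologicalSpace X] [ChartedSpace E X] {Γ₁ Γ₂ : LieCrossedModule.{u}}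

/-- Compose `g` with a local section through one preimage of `g x`. -/
theorem HasLocalSections.exists_lift {K G : LieGrp.{u}} {p : K →* G} (hp : HasLocalSections p)
    (hs : Function.Surjective p) {g : X → G} {U : Set X} (hU : IsOpen U)
    (hg : ContMDiffOn 𝓘(ℝ, E) (𝓡 G.dim) ∞ g U) {x : X} (hx : x ∈ U) :
    ∃ O, IsOpen O ∧ x ∈ O ∧ O ⊆ U ∧ ∃ k : X → K,
      ContMDiffOn 𝓘(ℝ, E) (𝓡 K.dim) ∞ k O ∧ ∀ y ∈ O, p (k y) = g y := by
  obtain ⟨k, hk⟩ := hs (g x)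
  obtain ⟨O, σ, hO, hkO, hσ, hpσ, -⟩ := hp k
  refine ⟨U ∩ g ⁻¹' O, hg.continuousOn.isOpen_inter_preimage hU hO, ⟨hx, ?_⟩, Set.inter_subset_left,
    fun y => σ (g y), hσ.comp (hg.mono Set.inter_subset_left) fun y hy => hy.2,
    fun y hy => hpσ _ hy.2⟩
  rwa [Set.mem_preimage, ← hk]

namespace ButterflyDiagram

/-- The diagram with the roles of the two crossed modules exchanged. -/
def swap (D : ButterflyDiagram Γ₁ Γ₂) : ButterflyDiagram Γ₂ Γ₁ :=
  ⟨D.K, D.i₂, D.i₁, D.p₂, D.p₁⟩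

variable {D : ButterflyDiagram Γ₁ Γ₂}

namespace IsInvertibleButterfly

/-- The axioms are symmetric in the two crossed modules, so every result on transport from Γ₁ to Γ₂
also applies in the opposite direction. -/
theorem swap (hD : D.IsInvertibleButterfly) : D.swap.IsInvertibleButterfly :=
  ⟨hD.comm₂, hD.comm₁, hD.shortExact₂, hD.shortExact₁, hD.act₂, hD.act₁⟩

theorem p₂_i₁ (hD : D.IsInvertibleButterfly) (h : Γ₁.H) : D.p₂ (D.i₁ h) = 1 :=
  MonoidHom.mem_ker.1 (hD.shortExact₁.exact ▸ ⟨h, rfl⟩)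

theorem exists_i₂_eq (hD : D.IsInvertibleButterfly) {x : D.K} (hx : D.p₁ x = 1) :
    ∃ h, D.i₂ h = x := by
  have : x ∈ D.i₂.range := hD.shortExact₂.exact ▸ MonoidHom.mem_ker.2 hx
  exact this

/-- Conjugation by `i₁ h₁` acts on the image of `i₂` through `p₂ (i₁ h₁)`, which is trivial by
exactness. -/
theorem commute (hD : D.IsInvertibleButterfly) (h₁ : Γ₁.H) (h₂ : Γ₂.H) :
    Commute (D.i₂ h₂) (D.i₁ h₁) := by
  have := hD.act₂ (D.i₁ h₁) h₂
  rw [hD.p₂_i₁, map_one, MulAut.one_apply, eq_mul_inv_iff_mul_eq] at this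
  exact this

/-- The homomorphism `(h₁, h₂) ↦ i₁ h₁ * i₂ h₂`. -/
def joint (hD : D.IsInvertibleButterfly) : Γ₁.H × Γ₂.H →* D.K :=
  MonoidHom.noncommCoprod D.i₁ D.i₂ fun h₁ h₂ => (hD.commute h₁ h₂).symm

variable (hD : D.IsInvertibleButterfly)
include hD

theorem joint_apply (h₁ : Γ₁.H) (h₂ : Γ₂.H) : hD.joint (h₁, h₂) = D.i₁ h₁ * D.i₂ h₂ := rfl

theorem joint_conj (x : D.K) (h₁ : Γ₁.H) (h₂ : Γ₂.H) :
    hD.joint (Γ₁.act (D.p₁ x) h₁, Γ₂.act (D.p₂ x) h₂) = x * hD.joint (h₁, h₂) * x⁻¹ := by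
  rw [joint_apply, joint_apply, hD.act₁, hD.act₂]
  group

/-- `joint` need not be injective, but its restriction to a fixed first component is, as `i₂` is
injective. By this lemma an identity in Γ₂ follows from the corresponding identity in Γ₁ together
with a computation in K. -/
theorem eq_of_joint_eq {h₁ h₁' : Γ₁.H} {h₂ h₂' : Γ₂.H}
    (h : hD.joint (h₁, h₂) = hD.joint (h₁', h₂')) (h' : h₁ = h₁') : h₂ = h₂' := by
  rw [joint_apply, joint_apply, h', mul_right_inj] at h
  exact hD.shortExact₂.injective h

theorem p₂_joint (h₁ : Γ₁.H) (h₂ : Γ₂.H) : D.p₂ (hD.joint (h₁, h₂)) = Γ₂.t h₂ := by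
  rw [joint_apply, map_mul, hD.p₂_i₁, one_mul, hD.comm₂]

/-- Every element over `t₁ h₁` is of the form `i₁ h₁ * i₂ h₂`. -/
theorem exists_joint_eq {x : D.K} {h₁ : Γ₁.H} (hx : D.p₁ x = Γ₁.t h₁) :
    ∃ h₂, hD.joint (h₁, h₂) = x := by
  obtain ⟨h₂, h⟩ := hD.exists_i₂_eq (x := (D.i₁ h₁)⁻¹ * x)
    (by rw [map_mul, map_inv, hD.comm₁, hx, inv_mul_cancel])
  exact ⟨h₂, by rw [joint_apply, h, mul_inv_cancel_left]⟩

theorem joint_eq_iff {h₁ : Γ₁.H} {h₂ : Γ₂.H} {x : D.K} :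
    hD.joint (h₁, h₂) = x ↔ D.i₂ h₂ = x * (D.i₁ h₁)⁻¹ := by
  rw [joint_apply, ← (hD.commute h₁ h₂).eq, eq_mul_inv_iff_mul_eq]

/-- Since `i₁` and `i₂` commute, the factor with `i₁` can be moved to the left side. The condition
then concerns only the homomorphism `joint`, and this is the form used for all computations. -/
theorem transports_iff {c : CechCocycle E X Γ₁} {d : CechCocycle E X Γ₂} :
    D.Transports c d ↔ ∃ (r : d.cover.ι → c.cover.ι) (k : d.cover.ι → d.cover.ι → X → D.K),
      (∀ i, d.cover.U i ⊆ c.cover.U (r i)) ∧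
      (∀ i j, ContMDiffOn 𝓘(ℝ, E) (𝓡 D.K.dim) ∞ (k i j) (d.cover.U i ∩ d.cover.U j)) ∧
      (∀ i j, ∀ x ∈ d.cover.U i ∩ d.cover.U j,
        D.p₁ (k i j x) = c.g (r i) (r j) x ∧ D.p₂ (k i j x) = d.g i j x) ∧
      ∀ i j l, ∀ x ∈ d.cover.U i ∩ d.cover.U j ∩ d.cover.U l,
        hD.joint (c.a (r i) (r j) (r l) x, d.a i j l x) =
          k i l x * (k i j x)⁻¹ * (k j l x)⁻¹ := by
  simp only [hD.joint_eq_iff]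
  rfl

/-- A cocycle can be transported by means of lifts on a refinement of its cover. -/
theorem exists_transports_of_lift (hi : ReflectsSmooth D.i₂ E X) (c : CechCocycle E X Γ₁)
    (W : OpenCover X) (r : W.ι → c.cover.ι) (hr : ∀ i, W.U i ⊆ c.cover.U (r i))
    (k : W.ι → W.ι → X → D.K)
    (hk : ∀ i j, ContMDiffOn 𝓘(ℝ, E) (𝓡 D.K.dim) ∞ (k i j) (W.U i ∩ W.U j))
    (hkg : ∀ i j, ∀ x ∈ W.U i ∩ W.U j, D.p₁ (k i j x) = c.g (r i) (r j) x) :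
    ∃ d : CechCocycle E X Γ₂, D.Transports c d := by
  -- The cocycle condition of `c` says that the defect of the lifts lies over `t a`. The implication
  -- makes `b` a total function; its value 1 off the triple intersection plays no role.
  have hex : ∀ i j l x, ∃ b : Γ₂.H, x ∈ W.U i ∩ W.U j ∩ W.U l →
      hD.joint (c.a (r i) (r j) (r l) x, b) = k i l x * (k i j x)⁻¹ * (k j l x)⁻¹ := by
    intro i j l x
    by_cases hx : x ∈ W.U i ∩ W.U j ∩ W.U l
    · obtain ⟨b, hb⟩ := hD.exists_joint_eq (x := k i l x * (k i j x)⁻¹ * (k j l x)⁻¹)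
        (h₁ := c.a (r i) (r j) (r l) x) (by
          rw [map_mul, map_mul, map_inv, map_inv, hkg i l x ⟨hx.1.1, hx.2⟩, hkg i j x hx.1,
            hkg j l x ⟨hx.1.2, hx.2⟩,
            ← c.cocycle_g (r i) (r j) (r l) x ⟨⟨hr i hx.1.1, hr j hx.1.2⟩, hr l hx.2⟩]
          group)
      exact ⟨b, fun _ => hb⟩
    · exact ⟨1, fun h => absurd h hx⟩
  choose b hb using hex
  have hb' : ∀ i j l x, x ∈ W.U i ∩ W.U j ∩ W.U l →
      hD.joint (c.a (r i) (r j) (r l) x, b i j l x) * k j l x * k i j x = k i l x :=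
    fun i j l x hx => by rw [hb i j l x hx]; group
  refine ⟨{ cover := W
            g := fun i j x => D.p₂ (k i j x)
            a := b
            smooth_g := fun i j => hD.shortExact₁.smooth_right.comp_contMDiffOn (hk i j)
            smooth_a := fun i j l => hi _ _ ?_
            cocycle_g := fun i j l x hx => ?_
            cocycle_a := fun i j l m x hx => ?_ },
    hD.transports_iff.2 ⟨r, k, hr, hk, fun i j x hx => ⟨hkg i j x hx, rfl⟩, hb⟩⟩
  -- The values of `b` were chosen point by point; smoothness holds because `i₂ ∘ b` is a product of
  -- smooth maps and `i₂` reflects smoothness.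
  · have h1 := ((hk i l).mono fun x (hx : x ∈ W.U i ∩ W.U j ∩ W.U l) => ⟨hx.1.1, hx.2⟩)
    have h2 := ((hk i j).mono fun x (hx : x ∈ W.U i ∩ W.U j ∩ W.U l) => hx.1)
    have h3 := ((hk j l).mono fun x (hx : x ∈ W.U i ∩ W.U j ∩ W.U l) => ⟨hx.1.2, hx.2⟩)
    have h4 := hD.shortExact₁.smooth_left.comp_contMDiffOn
      ((c.smooth_a (r i) (r j) (r l)).mono fun x (hx : x ∈ W.U i ∩ W.U j ∩ W.U l) =>
        ⟨⟨hr i hx.1.1, hr j hx.1.2⟩, hr l hx.2⟩)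
    exact (((h1.mul h2.inv).mul h3.inv).mul h4.inv).congr fun x hx =>
      hD.joint_eq_iff.1 (hb i j l x hx)
  · rw [← hb' i j l x hx, map_mul, map_mul, hD.p₂_joint]
  · have h1 := hb i l m x ⟨⟨hx.1.1.1, hx.1.2⟩, hx.2⟩
    have h2 := hb i j l x hx.1
    have h3 := hb i j m x ⟨hx.1.1, hx.2⟩
    have h4 := hb j l m x ⟨⟨hx.1.1.2, hx.1.2⟩, hx.2⟩
    refine hD.eq_of_joint_eq ?_ (c.cocycle_a (r i) (r j) (r l) (r m) x
      ⟨⟨⟨hr i hx.1.1.1, hr j hx.1.1.2⟩, hr l hx.1.2⟩, hr m hx.2⟩)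
    -- Writing the acting element as the projection of the lift `k l m` turns the action into
    -- conjugation in K. The defects then cancel.
    rw [← hkg l m x ⟨hx.1.2, hx.2⟩, ← Prod.mk_mul_mk, ← Prod.mk_mul_mk, map_mul, map_mul,
      hD.joint_conj, h1, h2, h3, h4]
    group

/-- Lifts of `g` exist near each point, but they are needed on entire pairwise intersections. The
refinement lemma for intersections supplies a cover for which this is the case. -/
theorem exists_transports [T2Space X] [ParacompactSpace X] (hp : HasLocalSections D.p₁)
    (hi : ReflectsSmooth D.i₂ E X) (c : CechCocycle E X Γ₁) :
    ∃ d : CechCocycle E X Γ₂, D.Transports c d := by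
  obtain ⟨W, r, hr, hW⟩ := c.cover.exists_refinement_inter
    (fun i j O => ∃ k : X → D.K, ContMDiffOn 𝓘(ℝ, E) (𝓡 D.K.dim) ∞ k O ∧
      ∀ y ∈ O, D.p₁ (k y) = c.g i j y)
    (fun i j O O' hO ⟨k, hk, hkg⟩ => ⟨k, hk.mono hO, fun y hy => hkg y (hO hy)⟩)
    (fun i j => ⟨fun _ => 1, contMDiffOn_const, fun y hy => hy.elim⟩)
    (fun i j x hx => by
      obtain ⟨O, hO, hxO, -, hk⟩ := hp.exists_lift hD.shortExact₂.surjective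
        ((c.cover.isOpen i).inter (c.cover.isOpen j)) (c.smooth_g i j) hx
      exact ⟨O, hO, hxO, hk⟩)
  choose k hk hkg using hW
  exact hD.exists_transports_of_lift hi c W r hr k hk hkg

/-- If cocycles are related by a coboundary `(h, e)` and `h` lifts, then so are their transports. -/
theorem equivOn_of_lift (hi : ReflectsSmooth D.i₂ E X)
    {c c' : CechCocycle E X Γ₁} {d d' : CechCocycle E X Γ₂}
    {q : d.cover.ι → c.cover.ι} {k : d.cover.ι → d.cover.ι → X → D.K}
    (hk : ∀ i j, ContMDiffOn 𝓘(ℝ, E) (𝓡 D.K.dim) ∞ (k i j) (d.cover.U i ∩ d.cover.U j))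
    (hkg : ∀ i j, ∀ x ∈ d.cover.U i ∩ d.cover.U j,
      D.p₁ (k i j x) = c.g (q i) (q j) x ∧ D.p₂ (k i j x) = d.g i j x)
    (hka : ∀ i j l, ∀ x ∈ d.cover.U i ∩ d.cover.U j ∩ d.cover.U l,
      hD.joint (c.a (q i) (q j) (q l) x, d.a i j l x) = k i l x * (k i j x)⁻¹ * (k j l x)⁻¹)
    {q' : d'.cover.ι → c'.cover.ι} {k' : d'.cover.ι → d'.cover.ι → X → D.K}
    (hk' : ∀ i j, ContMDiffOn 𝓘(ℝ, E) (𝓡 D.K.dim) ∞ (k' i j) (d'.cover.U i ∩ d'.cover.U j))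
    (hkg' : ∀ i j, ∀ x ∈ d'.cover.U i ∩ d'.cover.U j,
      D.p₁ (k' i j x) = c'.g (q' i) (q' j) x ∧ D.p₂ (k' i j x) = d'.g i j x)
    (hka' : ∀ i j l, ∀ x ∈ d'.cover.U i ∩ d'.cover.U j ∩ d'.cover.U l,
      hD.joint (c'.a (q' i) (q' j) (q' l) x, d'.a i j l x) =
        k' i l x * (k' i j x)⁻¹ * (k' j l x)⁻¹)
    {V : OpenCover X} {r : V.ι → d.cover.ι} {r' : V.ι → d'.cover.ι}
    (hr : ∀ v, V.U v ⊆ d.cover.U (r v)) (hr' : ∀ v, V.U v ⊆ d'.cover.U (r' v))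
    {h : V.ι → X → D.K} {e : V.ι → V.ι → X → Γ₁.H}
    (hh : ∀ i, ContMDiffOn 𝓘(ℝ, E) (𝓡 D.K.dim) ∞ (h i) (V.U i))
    (he : ∀ i j, ContMDiffOn 𝓘(ℝ, E) (𝓡 Γ₁.H.dim) ∞ (e i j) (V.U i ∩ V.U j))
    (hhe : ∀ i j, ∀ x ∈ V.U i ∩ V.U j,
      Γ₁.t (e i j x) * D.p₁ (h j x) * c.g (q (r i)) (q (r j)) x =
        c'.g (q' (r' i)) (q' (r' j)) x * D.p₁ (h i x))
    (hea : ∀ i j l, ∀ x ∈ V.U i ∩ V.U j ∩ V.U l,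
      c'.a (q' (r' i)) (q' (r' j)) (q' (r' l)) x *
        Γ₁.act (c'.g (q' (r' j)) (q' (r' l)) x) (e i j x) * e j l x =
        e i l x * Γ₁.act (D.p₁ (h l x)) (c.a (q (r i)) (q (r j)) (q (r l)) x)) :
    d.EquivOn d' V r r' := by
  -- The second component of the new coboundary is the failure of the lifts `h` to intertwine `k`
  -- and `k'`. It lies over `t e` by the first coboundary equation.
  have hex : ∀ i j x, ∃ b : Γ₂.H, x ∈ V.U i ∩ V.U j → hD.joint (e i j x, b) =
      k' (r' i) (r' j) x * h i x * (k (r i) (r j) x)⁻¹ * (h j x)⁻¹ := by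
    intro i j x
    by_cases hx : x ∈ V.U i ∩ V.U j
    · obtain ⟨b, hb⟩ := hD.exists_joint_eq (h₁ := e i j x)
        (x := k' (r' i) (r' j) x * h i x * (k (r i) (r j) x)⁻¹ * (h j x)⁻¹) (by
          rw [map_mul, map_mul, map_mul, map_inv, map_inv,
            (hkg' _ _ x ⟨hr' i hx.1, hr' j hx.2⟩).1, (hkg _ _ x ⟨hr i hx.1, hr j hx.2⟩).1,
            ← hhe i j x hx]
          group)
      exact ⟨b, fun _ => hb⟩
    · exact ⟨1, fun h => absurd h hx⟩
  choose ε hε using hex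
  refine ⟨fun i x => D.p₂ (h i x), ε, fun i => hD.shortExact₁.smooth_right.comp_contMDiffOn (hh i),
    fun i j => hi _ _ ?_, fun i j x hx => ?_, fun i j l x hx => ?_⟩
  · have h1 := (hk' (r' i) (r' j)).mono (Set.inter_subset_inter (hr' i) (hr' j))
    have h2 := (hh i).mono (Set.inter_subset_left (t := V.U j))
    have h3 := (hk (r i) (r j)).mono (Set.inter_subset_inter (hr i) (hr j))
    have h4 := (hh j).mono (Set.inter_subset_right (s := V.U i))
    have h5 := hD.shortExact₁.smooth_left.comp_contMDiffOn (he i j)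
    exact ((((h1.mul h2).mul h3.inv).mul h4.inv).mul h5.inv).congr fun x hx =>
      hD.joint_eq_iff.1 (hε i j x hx)
  · have h1 : hD.joint (e i j x, ε i j x) * h j x * k (r i) (r j) x = k' (r' i) (r' j) x * h i x := by
      rw [hε i j x hx]
      group
    have h2 := congrArg D.p₂ h1
    simp only [map_mul, hD.p₂_joint] at h2
    rwa [(hkg _ _ x ⟨hr i hx.1, hr j hx.2⟩).2, (hkg' _ _ x ⟨hr' i hx.1, hr' j hx.2⟩).2] at h2
  · have h1 := hka (r i) (r j) (r l) x ⟨⟨hr i hx.1.1, hr j hx.1.2⟩, hr l hx.2⟩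
    have h2 := hka' (r' i) (r' j) (r' l) x ⟨⟨hr' i hx.1.1, hr' j hx.1.2⟩, hr' l hx.2⟩
    have h3 := hε i j x hx.1
    have h4 := hε j l x ⟨hx.1.2, hx.2⟩
    have h5 := hε i l x ⟨hx.1.1, hx.2⟩
    have h6 := hkg' (r' j) (r' l) x ⟨hr' j hx.1.2, hr' l hx.2⟩
    refine hD.eq_of_joint_eq ?_ (hea i j l x hx)
    rw [← h6.1, ← h6.2, ← Prod.mk_mul_mk, ← Prod.mk_mul_mk, ← Prod.mk_mul_mk, map_mul, map_mul,
      map_mul, hD.joint_conj, hD.joint_conj, h1, h2, h3, h4, h5]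
    group

/-- Transports of equivalent cocycles are equivalent. -/
theorem equivalent_of_transports (hp : HasLocalSections D.p₁)
    (hi : ReflectsSmooth D.i₂ E X) {c c' : CechCocycle E X Γ₁} {d d' : CechCocycle E X Γ₂}
    (hcc' : c.Equivalent c') (hd : D.Transports c d) (hd' : D.Transports c' d') :
    d.Equivalent d' := by
  obtain ⟨q, k, hq, hk, hkg, hka⟩ := hD.transports_iff.1 hd
  obtain ⟨q', k', hq', hk', hkg', hka'⟩ := hD.transports_iff.1 hd'
  obtain ⟨W, s, s', h, e, hs, hs', hrest⟩ := hcc'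
  have hW : c.EquivOn c' W s s' := ⟨h, e, hrest⟩
  -- On `V` the cocycle `c` is indexed in two ways, through `q` and through `s`, and `c'` likewise.
  -- The coboundaries between the two indexings are attached at both ends of the given equivalence.
  let V := (d.cover.inter d'.cover).inter W
  have hV1 : ∀ v : V.ι, V.U v ⊆ d.cover.U v.1.1 := fun v x hx => hx.1.1
  have hV2 : ∀ v : V.ι, V.U v ⊆ d'.cover.U v.1.2 := fun v x hx => hx.1.2
  have hV3 : ∀ v : V.ι, V.U v ⊆ W.U v.2 := fun v x hx => hx.2
  have hE : c.EquivOn c' V (fun v => q v.1.1) (fun v => q' v.1.2) :=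
    ((c.equivOn_index V (fun v => q v.1.1) (fun v => s v.2) (fun v => (hV1 v).trans (hq _))
      (fun v => (hV3 v).trans (hs _))).trans (hW.comp V (fun v => v.2) hV3)).trans
      (c'.equivOn_index V (fun v => s' v.2) (fun v => q' v.1.2)
        (fun v => (hV3 v).trans (hs' _)) (fun v => (hV2 v).trans (hq' _)))
  obtain ⟨h, e, hh, he, hhe, hea⟩ := hE
  -- A further refinement makes `h` liftable to K. It has to be lifted only on single members of the
  -- cover, so the refinement by points suffices.
  obtain ⟨Z, r, hr, hZ⟩ := V.exists_refinement
    (fun i O => ∃ f : X → D.K, ContMDiffOn 𝓘(ℝ, E) (𝓡 D.K.dim) ∞ f O ∧ ∀ y ∈ O, D.p₁ (f y) = h i y)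
    (fun i x hx => hp.exists_lift hD.shortExact₂.surjective (V.isOpen i) (hh i) hx)
  choose f hf hfh using hZ
  have hr1 : ∀ z, Z.U z ⊆ d.cover.U (r z).1.1 := fun z => (hr z).trans (hV1 _)
  have hr2 : ∀ z, Z.U z ⊆ d'.cover.U (r z).1.2 := fun z => (hr z).trans (hV2 _)
  refine (hD.equivOn_of_lift hi hk hkg hka hk' hkg' hka' hr1 hr2 hf
    (e := fun i j => e (r i) (r j))
    (fun i j => (he _ _).mono (Set.inter_subset_inter (hr i) (hr j)))
    (fun i j x hx => ?_) (fun i j l x hx => ?_)).equivalent hr1 hr2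
  · rw [hfh i x hx.1, hfh j x hx.2]
    exact hhe _ _ x ⟨hr i hx.1, hr j hx.2⟩
  · rw [hfh l x hx.2]
    exact hea _ _ _ x ⟨⟨hr i hx.1.1, hr j hx.1.2⟩, hr l hx.2⟩

/-- If `c` is transported to `d`, then `d` is transported to a restriction of `c`. -/
theorem exists_transports_swap {c : CechCocycle E X Γ₁} {d : CechCocycle E X Γ₂}
    (h : D.Transports c d) : ∃ c' : CechCocycle E X Γ₁, c'.Equivalent c ∧ D.swap.Transports d c' := by
  obtain ⟨r, k, hr, hk, hkg, hka⟩ := hD.transports_iff.1 h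
  refine ⟨c.restrict d.cover r hr, c.restrict_equivalent d.cover r hr,
    hD.swap.transports_iff.2 ⟨id, k, fun _ => subset_rfl, hk, fun i j x hx => (hkg i j x hx).symm,
      fun i j l x hx => Eq.trans ?_ (hka i j l x hx)⟩⟩
  -- The same lifts serve for both directions; the two versions of `joint` differ by the order of
  -- commuting factors.
  exact (hD.commute _ _).eq

/-- The map on cohomology induced by a butterfly. -/
theorem exists_map [T2Space X] [ParacompactSpace X] (hp : HasLocalSections D.p₁)
    (hi : ReflectsSmooth D.i₂ E X) : ∃ F : CechH1 E X Γ₁ → CechH1 E X Γ₂,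
      ∀ c d, D.Transports c d → F (Quot.mk _ c) = Quot.mk _ d := by
  -- Any choice of transports descends to classes, because transports of equivalent cocycles are
  -- equivalent. Applied to `c` and itself, this also shows independence of the choice.
  choose T hT using hD.exists_transports (E := E) (X := X) hp hi
  refine ⟨Quot.lift (fun c => Quot.mk _ (T c)) fun c c' h =>
    Quot.sound (hD.equivalent_of_transports hp hi h (hT c) (hT c')), fun c d h => ?_⟩
  exact Quot.sound (hD.equivalent_of_transports hp hi
    ((c.equivOn_index c.cover id id (fun _ => subset_rfl) (fun _ => subset_rfl)).equivalent
      (fun _ => subset_rfl) (fun _ => subset_rfl)) (hT c) h)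

/-- An invertible butterfly induces a bijection on cohomology. -/
theorem existsUnique_equiv [T2Space X] [ParacompactSpace X] (hp₁ : HasLocalSections D.p₁)
    (hp₂ : HasLocalSections D.p₂) (hi₁ : ReflectsSmooth D.i₁ E X)
    (hi₂ : ReflectsSmooth D.i₂ E X) : ∃! Φ : CechH1 E X Γ₁ ≃ CechH1 E X Γ₂,
      ∀ c d, D.Transports c d → Φ (Quot.mk _ c) = Quot.mk _ d := by
  obtain ⟨F, hF⟩ := hD.exists_map (E := E) (X := X) hp₁ hi₂
  obtain ⟨F', hF'⟩ := hD.swap.exists_map (E := E) (X := X) hp₂ hi₁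
  refine ⟨⟨F, F', fun z => ?_, fun z => ?_⟩, hF, fun Φ hΦ => Equiv.ext fun z => ?_⟩
  · obtain ⟨c, rfl⟩ := Quot.exists_rep z
    obtain ⟨d, hd⟩ := hD.exists_transports hp₁ hi₂ c
    obtain ⟨c', hc', hdc'⟩ := hD.exists_transports_swap hd
    rw [hF c d hd, hF' d c' hdc']
    exact Quot.sound hc'
  · obtain ⟨d, rfl⟩ := Quot.exists_rep z
    obtain ⟨c, hc⟩ := hD.swap.exists_transports hp₂ hi₁ d
    obtain ⟨d', hd', hcd'⟩ := hD.swap.exists_transports_swap hc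
    rw [hF' d c hc, hF c d' hcd']
    exact Quot.sound hd'
  -- Uniqueness: every class has a representative that can be transported, so the condition
  -- determines the value of the bijection on it.
  · obtain ⟨c, rfl⟩ := Quot.exists_rep z
    obtain ⟨d, hd⟩ := hD.exists_transports hp₁ hi₂ c
    exact (hΦ c d hd).trans (hF c d hd).symm

end IsInvertibleButterfly
end ButterflyDiagram
end Butterfly

/-! ### Homomorphisms between closed linear groups -/

section ClosedLinear
variable {𝔸 : Type*} [NormedRing 𝔸] [NormedAlgebra ℝ 𝔸] [FiniteDimensional ℝ 𝔸]

/-- The inclusion of a closed linear group into the algebra is an immersion. -/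
theorem mfderiv_val_closed_injective {G : Type*} [Group G] [TopologicalSpace G] {r : G →* 𝔸ˣ}
    (hr : Topology.IsClosedEmbedding r) (g : G) :
    letI := closedChartedSpace hr
    Function.Injective (mfderiv (𝓡 (expChart hr).dim) 𝓘(ℝ, 𝔸) (fun h => (r h : 𝔸)) g) := by
  let _ := closedChartedSpace hr
  have := closed_isManifold hr
  let Ψ : 𝔸 → EuclideanSpace ℝ (Fin (expChart hr).dim) :=
    fun a => (expChart hr).lg (((r g⁻¹ : 𝔸ˣ) : 𝔸) * a)
  have hmem : (((r g⁻¹ : 𝔸ˣ) : 𝔸) * r g) ∈ (expChart hr).O :=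
    (mem_chartOf_source hr g g).1 (mem_chart_source _ g)
  have hΨ : ContDiffAt ℝ ∞ Ψ (r g) :=
    ContDiffAt.comp (r g : 𝔸) (g := (expChart hr).lg)
      ((expChart hr).smooth_lg.contDiffAt ((expChart hr).isOpen_O.mem_nhds hmem))
      (contDiff_const.mul contDiff_id).contDiffAt
  -- The chart at `g` factors through the inclusion into the algebra, and the derivative of a chart
  -- is invertible. So the derivative of the inclusion is injective.
  have hcomp : (extChartAt (𝓡 (expChart hr).dim) g : G → _) = Ψ ∘ fun h => (r h : 𝔸) := by
    ext1 h
    exact chartOf_apply hr g h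
  have hinv := isInvertible_mfderiv_extChartAt (I := 𝓡 (expChart hr).dim)
    (mem_extChartAt_source (I := 𝓡 (expChart hr).dim) g)
  have hinj := hinv.injective
  rw [hcomp, mfderiv_comp g (hΨ.contMDiffAt.mdifferentiableAt (by simp))
    ((contMDiff_val_closed hr).contMDiffAt.mdifferentiableAt (by simp))] at hinj
  exact Function.Injective.of_comp hinj

variable {G : Type u} [Group G] {r : G →* 𝔸ˣ} {hinj : Function.Injective r}
  {hcl : IsClosed (Set.range r)}

theorem LieGrp.mfderiv_val_ofClosed_injective (g : LieGrp.ofClosed G r hinj hcl) :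
    Function.Injective (mfderiv (𝓡 (LieGrp.ofClosed G r hinj hcl).dim) 𝓘(ℝ, 𝔸)
      (fun h : LieGrp.ofClosed G r hinj hcl => (r h : 𝔸)) g) :=
  letI : TopologicalSpace G := TopologicalSpace.induced r inferInstance
  mfderiv_val_closed_injective (isClosedEmbedding_induced G r hinj hcl) g

section Retraction
variable {K : LieGrp.{u}} {i : LieGrp.ofClosed G r hinj hcl →* K} {L : K → 𝔸}
  (hL : ContMDiff (𝓡 K.dim) 𝓘(ℝ, 𝔸) ∞ L) (hLi : ∀ h, L (i h) = r h)
include hL hLi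

/-- By hypothesis `L ∘ i` is the inclusion of the closed linear group into its algebra. That
inclusion is an immersion, a topological embedding, and detects smoothness; in this and the next two
lemmas each of these properties is passed from `L ∘ i` to `i`. -/
theorem mfderiv_injective_of_retraction
    (hi : ContMDiff (𝓡 (LieGrp.ofClosed G r hinj hcl).dim) (𝓡 K.dim) ∞ i)
    (h : LieGrp.ofClosed G r hinj hcl) :
    Function.Injective (mfderiv (𝓡 (LieGrp.ofClosed G r hinj hcl).dim) (𝓡 K.dim) i h) := by
  have h1 := LieGrp.mfderiv_val_ofClosed_injective h
  have h2 : (fun h : LieGrp.ofClosed G r hinj hcl => (r h : 𝔸)) = L ∘ i := funext fun h => (hLi h).symm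
  rw [h2, mfderiv_comp h (hL.contMDiffAt.mdifferentiableAt (by simp))
    (hi.contMDiffAt.mdifferentiableAt (by simp))] at h1
  exact Function.Injective.of_comp h1

theorem isEmbedding_of_retraction (hi : Continuous i) : Topology.IsEmbedding i := by
  have h1 : Topology.IsEmbedding fun h : LieGrp.ofClosed G r hinj hcl => (r h : 𝔸) :=
    letI : TopologicalSpace G := TopologicalSpace.induced r inferInstance
    val_isEmbedding (isClosedEmbedding_induced G r hinj hcl)
  have h2 : (fun h : LieGrp.ofClosed G r hinj hcl => (r h : 𝔸)) = L ∘ i := funext fun h => (hLi h).symm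
  rw [h2] at h1
  exact Topology.IsEmbedding.of_comp hi hL.continuous h1

theorem reflectsSmooth_of_retraction (E : Type*) [NormedAddCommGroup E]
    [NormedSpace ℝ E] (X : Type w) [TopologicalSpace X] [ChartedSpace E X] :
    ReflectsSmooth i E X := by
  intro f s hf x hx
  rw [LieGrp.contMDiffWithinAt_ofClosed_iff]
  refine (hL.contMDiffAt.comp_contMDiffWithinAt x (hf x hx)).congr (fun y _ => ?_) ?_ <;>
  exact (hLi _).symm

end Retraction

variable {𝔹 : Type*} [NormedRing 𝔹] [NormedAlgebra ℝ 𝔹] [FiniteDimensional ℝ 𝔹]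
  {K : Type u} [Group K] {q : K →* 𝔹ˣ} {hinj' : Function.Injective q}
  {hcl' : IsClosed (Set.range q)}

/-- A surjective homomorphism of closed linear groups with a smooth local section near the unit has
smooth local sections. -/
theorem hasLocalSections_ofClosed {p : LieGrp.ofClosed K q hinj' hcl' →* LieGrp.ofClosed G r hinj hcl}
    {O : Set 𝔸} (hO : IsOpen O) (h1 : (1 : 𝔸) ∈ O) {s : 𝔸 → 𝔹} (hs : ContDiffOn ℝ ∞ s O)
    (hsec : ∀ g : LieGrp.ofClosed G r hinj hcl, (r g : 𝔸) ∈ O →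
      ∃ k : LieGrp.ofClosed K q hinj' hcl', (q k : 𝔹) = s (r g) ∧ p k = g) :
    HasLocalSections p := by
  classical
  choose! σ hσ hpσ using hsec
  let O' : Set (LieGrp.ofClosed G r hinj hcl) := {g | (r g : 𝔸) ∈ O}
  have hval := LieGrp.contMDiff_val_ofClosed hinj hcl
  have hO' : IsOpen O' := hO.preimage hval.continuous
  have hσs : ContMDiffOn (𝓡 (LieGrp.ofClosed G r hinj hcl).dim)
      (𝓡 (LieGrp.ofClosed K q hinj' hcl').dim) ∞ σ O' := by
    intro g hg
    rw [LieGrp.contMDiffWithinAt_ofClosed_iff]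
    have h2 : ContMDiffAt 𝓘(ℝ, 𝔸) 𝓘(ℝ, 𝔹) ∞ s (r g : 𝔸) :=
      (hs.contDiffAt (hO.mem_nhds hg)).contMDiffAt
    exact (h2.comp_contMDiffWithinAt g hval.contMDiffAt.contMDiffWithinAt).congr
      (fun y hy => hσ y hy) (hσ g hg)
  intro k
  have hone : (1 : LieGrp.ofClosed G r hinj hcl) ∈ O' := by
    change ((r 1 : 𝔸ˣ) : 𝔸) ∈ O
    rw [map_one]
    exact h1
  have hleft : ContMDiff (𝓡 (LieGrp.ofClosed G r hinj hcl).dim)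
      (𝓡 (LieGrp.ofClosed G r hinj hcl).dim) ∞
      (fun g : LieGrp.ofClosed G r hinj hcl => (p k)⁻¹ * g) := contMDiff_mul_left
  -- The section near the unit is translated to `p k`. Since `σ 1` need not be 1, the factor `(σ
  -- 1)⁻¹`, which lies in the kernel of `p`, is inserted to make the section pass through `k`.
  refine ⟨(fun g => (p k)⁻¹ * g) ⁻¹' O', fun g => k * (σ 1)⁻¹ * σ ((p k)⁻¹ * g),
    hO'.preimage hleft.continuous, ?_, ?_, fun g hg => ?_, ?_⟩
  · rw [Set.mem_preimage, inv_mul_cancel]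
    exact hone
  · exact contMDiffOn_const.mul (hσs.comp hleft.contMDiffOn subset_rfl)
  · rw [map_mul, map_mul, map_inv, hpσ _ hg, hpσ _ hone]
    group
  · simp

/-- The derivative of a local section is a right inverse of the derivative of `p`. As the section
passes through `k`, this is the derivative at `k` itself and not at another point of the fibre. -/
theorem HasLocalSections.mfderiv_surjective {K G : LieGrp.{u}} {p : K →* G}
    (hs : HasLocalSections p) (hp : ContMDiff (𝓡 K.dim) (𝓡 G.dim) ∞ p) (k : K) :
    Function.Surjective (mfderiv (𝓡 K.dim) (𝓡 G.dim) p k) := by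
  obtain ⟨O, σ, hO, hk, hσ, hpσ, hσk⟩ := hs k
  have h1 : MDifferentiableAt (𝓡 G.dim) (𝓡 K.dim) σ (p k) :=
    (hσ.contMDiffAt (hO.mem_nhds hk)).mdifferentiableAt (by simp)
  have h2 : MDifferentiableAt (𝓡 K.dim) (𝓡 G.dim) p (σ (p k)) :=
    hp.contMDiffAt.mdifferentiableAt (by simp)
  have h3 : mfderiv (𝓡 G.dim) (𝓡 G.dim) (p ∘ σ) (p k) = ContinuousLinearMap.id ℝ _ := by
    have : (p ∘ σ) =ᶠ[𝓝 (p k)] id := by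
      filter_upwards [hO.mem_nhds hk] with g hg using hpσ g hg
    rw [this.mfderiv_eq, mfderiv_id]
  rw [mfderiv_comp (p k) h2 h1] at h3
  have h4 : Function.Surjective (mfderiv (𝓡 K.dim) (𝓡 G.dim) p (σ (p k))) := fun v =>
    ⟨mfderiv (𝓡 G.dim) (𝓡 K.dim) σ (p k) v, DFunLike.congr_fun h3 v⟩
  rwa [hσk] at h4

end ClosedLinear

/-! ### Parity -/

section Parity
variable {𝕜 : Type*} [RCLike 𝕜] {V V' : Type*} [AddCommGroup V] [Module 𝕜 V] [AddCommGroup V']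
  [Module 𝕜 V']

theorem parity_cases : ∀ i : ZMod 2, i = 0 ∨ i = 1 := by decide

theorem univ_parity : (Set.univ : Set (ZMod 2)) = {0, 1} :=
  (Set.eq_univ_of_forall parity_cases).symm

variable (𝕜) in
/-- The sign `(-1)ⁱ` of a parity. -/
def paritySign (i : ZMod 2) : 𝕜 := if i = 0 then 1 else -1

theorem paritySign_zero : paritySign 𝕜 0 = 1 := rfl

theorem paritySign_one : paritySign 𝕜 1 = -1 := rfl

theorem paritySign_add (i j : ZMod 2) :
    paritySign 𝕜 (i + j) = paritySign 𝕜 i * paritySign 𝕜 j := by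
  rcases parity_cases i with rfl | rfl
  · rw [zero_add, paritySign_zero, one_mul]
  · rcases parity_cases j with rfl | rfl
    · rw [add_zero, paritySign_zero, mul_one]
    · rw [paritySign_one, neg_mul_neg, one_mul]
      exact if_pos (by decide)

/-- The eigenspaces of an involution. -/
def parityGrading (η : V →ₗ[𝕜] V) (i : ZMod 2) : Submodule 𝕜 V :=
  LinearMap.ker (η - paritySign 𝕜 i • LinearMap.id)

theorem mem_parityGrading {η : V →ₗ[𝕜] V} {i : ZMod 2} {x : V} :
    x ∈ parityGrading η i ↔ η x = paritySign 𝕜 i • x := by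
  simp [parityGrading, sub_eq_zero]

theorem eq_add_parity (η : V →ₗ[𝕜] V) (x : V) :
    x = (2⁻¹ : 𝕜) • (x + η x) + (2⁻¹ : 𝕜) • (x - η x) := by
  rw [← smul_add, add_add_sub_cancel, ← two_smul 𝕜 x, smul_smul, inv_mul_cancel₀ two_ne_zero,
    one_smul]

/-- As 2 is invertible, x = (x + ηx)/2 + (x - ηx)/2 splits the space into the two eigenspaces. -/
theorem isInternal_parityGrading {η : V →ₗ[𝕜] V} (hη : ∀ x, η (η x) = x) :
    DirectSum.IsInternal (parityGrading η) := by
  rw [DirectSum.isInternal_submodule_iff_isCompl (parityGrading η) (i := 0) (j := 1) (by decide)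
    univ_parity]
  constructor
  · rw [Submodule.disjoint_def]
    intro x h0 h1
    rw [mem_parityGrading, paritySign_zero, one_smul] at h0
    rw [mem_parityGrading, paritySign_one, neg_one_smul, h0] at h1
    have h2 : (2 : 𝕜) • x = 0 := by rw [two_smul]; nth_rewrite 1 [h1]; simp
    exact (smul_eq_zero.1 h2).resolve_left two_ne_zero
  · rw [codisjoint_iff, eq_top_iff]
    intro x _
    rw [eq_add_parity η x]
    refine Submodule.add_mem_sup (Submodule.smul_mem _ _ ?_) (Submodule.smul_mem _ _ ?_)
    · rw [mem_parityGrading, paritySign_zero, map_add, hη, one_smul, add_comm]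
    · rw [mem_parityGrading, paritySign_one, map_sub, hη, neg_one_smul, neg_sub]

/-- A ℤ/2-grading is the same as an involution. Membership in a graded part becomes an equation, and
evenness of a map becomes commutation with the involution, which is easy to carry through
compositions and inverses. -/
theorem exists_parity {S : ZMod 2 → Submodule 𝕜 V} (hS : DirectSum.IsInternal S) :
    ∃ η : V →ₗ[𝕜] V, (∀ x, η (η x) = x) ∧ ∀ i x, x ∈ S i ↔ η x = paritySign 𝕜 i • x := by
  have hc : IsCompl (S 0) (S 1) :=
    (DirectSum.isInternal_submodule_iff_isCompl S (i := 0) (j := 1) (by decide)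
      univ_parity).1 hS
  let η : V →ₗ[𝕜] V := (S 0).subtype.coprod (-(S 1).subtype) ∘ₗ
    (Submodule.prodEquivOfIsCompl _ _ hc).symm.toLinearMap
  have h0 : ∀ x ∈ S 0, η x = x := fun x hx => by
    change (S 0).subtype.coprod (-(S 1).subtype)
      ((Submodule.prodEquivOfIsCompl _ _ hc).symm ((⟨x, hx⟩ : S 0) : V)) = _
    rw [Submodule.prodEquivOfIsCompl_symm_apply_left]
    simp
  have h1 : ∀ x ∈ S 1, η x = -x := fun x hx => by
    change (S 0).subtype.coprod (-(S 1).subtype)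
      ((Submodule.prodEquivOfIsCompl _ _ hc).symm ((⟨x, hx⟩ : S 1) : V)) = _
    rw [Submodule.prodEquivOfIsCompl_symm_apply_right]
    simp
  have hx : ∀ x, ∃ y ∈ S 0, ∃ z ∈ S 1, y + z = x := fun x =>
    Submodule.mem_sup.1 (hc.sup_eq_top ▸ Submodule.mem_top)
  have hη : ∀ x, η (η x) = x := fun x => by
    obtain ⟨y, hy, z, hz, rfl⟩ := hx x
    simp [h0 y hy, h1 z hz]
  refine ⟨η, hη, fun i x => ?_⟩
  obtain ⟨y, hy, z, hz, rfl⟩ := hx x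
  have h2 : ∀ x : V, x = -x → x = 0 := fun x h => by
    have : (2 : 𝕜) • x = 0 := by rw [two_smul]; nth_rewrite 1 [h]; simp
    exact (smul_eq_zero.1 this).resolve_left two_ne_zero
  rw [map_add, h0 y hy, h1 z hz]
  rcases parity_cases i with rfl | rfl
  · rw [paritySign_zero, one_smul, add_right_inj, Submodule.add_mem_iff_right _ hy]
    refine ⟨fun h => ?_, fun h => ?_⟩
    · rw [Submodule.disjoint_def.1 hc.disjoint z h hz, neg_zero]
    · rw [h2 z h.symm]
      exact Submodule.zero_mem _
  · rw [paritySign_one, neg_one_smul, neg_add, add_left_inj, Submodule.add_mem_iff_left _ hz]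
    refine ⟨fun h => ?_, fun h => ?_⟩
    · rw [Submodule.disjoint_def.1 hc.disjoint y hy h, neg_zero]
    · rw [h2 y h]
      exact Submodule.zero_mem _

/-- The involution that acts on the part of degree `i` by the sign `(-1)ⁱ`. -/
def parity {S : ZMod 2 → Submodule 𝕜 V} (hS : DirectSum.IsInternal S) : V →ₗ[𝕜] V :=
  (exists_parity hS).choose

variable {S : ZMod 2 → Submodule 𝕜 V} (hS : DirectSum.IsInternal S)

theorem parity_parity (x : V) : parity hS (parity hS x) = x := (exists_parity hS).choose_spec.1 x

theorem mem_iff_parity {i : ZMod 2} {x : V} : x ∈ S i ↔ parity hS x = paritySign 𝕜 i • x :=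
  (exists_parity hS).choose_spec.2 i x

include hS in
theorem homogeneous_induction {p : V → Prop} (hadd : ∀ x y, p x → p y → p (x + y))
    (hhom : ∀ i, ∀ x ∈ S i, p x) (x : V) : p x := by
  rw [eq_add_parity (parity hS) x]
  refine hadd _ _ (hhom 0 _ (Submodule.smul_mem _ _ ((mem_iff_parity hS).2 ?_)))
    (hhom 1 _ (Submodule.smul_mem _ _ ((mem_iff_parity hS).2 ?_)))
  · rw [paritySign_zero, map_add, parity_parity, one_smul, add_comm]
  · rw [paritySign_one, map_sub, parity_parity, neg_one_smul, neg_sub]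

/-- A linear map is homogeneous iff it commutes with the parity up to sign. -/
theorem homogeneous_iff_parity {S' : ZMod 2 → Submodule 𝕜 V'} (hS' : DirectSum.IsInternal S')
    (f : V →ₗ[𝕜] V') (d : ZMod 2) :
    (∀ i, ∀ x ∈ S i, f x ∈ S' (d + i)) ↔
      ∀ x, parity hS' (f x) = paritySign 𝕜 d • f (parity hS x) := by
  refine ⟨fun h => homogeneous_induction hS (fun x y hx hy => ?_) fun i x hx => ?_, fun h i x hx => ?_⟩
  · simp only [map_add, hx, hy, smul_add]
  · rw [(mem_iff_parity hS').1 (h i x hx), (mem_iff_parity hS).1 hx, map_smul, smul_smul,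
      paritySign_add]
  · rw [mem_iff_parity hS', h, (mem_iff_parity hS).1 hx, map_smul, smul_smul, paritySign_add]

/-- A linear automorphism is even iff it commutes with the parity. -/
theorem even_iff_parity (f : V ≃ₗ[𝕜] V) :
    (∀ i x, f x ∈ S i ↔ x ∈ S i) ↔ ∀ x, parity hS (f x) = f (parity hS x) := by
  refine ⟨fun h x => ?_, fun h i x => ?_⟩
  · have := (homogeneous_iff_parity hS hS f.toLinearMap 0).1
      (fun i x hx => by rw [zero_add]; exact (h i x).2 hx) x
    rwa [paritySign_zero, one_smul] at this
  · rw [mem_iff_parity hS, mem_iff_parity hS, h, ← map_smul, f.injective.eq_iff]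

end Parity

/-! ### Twisted endomorphisms -/

section Twisted
variable {𝕜 : Type*} [RCLike 𝕜] {R C M : Type*} [Ring R] [Algebra 𝕜 R] [Ring C] [Algebra 𝕜 C]
  [AddCommGroup M] [Module 𝕜 M] [Module R M] [Module C M] [IsScalarTower 𝕜 R M]
  [IsScalarTower 𝕜 C M] [SMulCommClass C R M]

variable (R C M) in
/-- The `R`-module `M` is a progenerator, and `C` is its endomorphism ring. -/
structure IsMoritaPair : Prop where
  dualBasis : ∃ (n : ℕ) (x : Fin n → M) (l : Fin n → M →ₗ[R] R), ∀ m, ∑ i, l i m • x i = m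
  trace : ∃ (n : ℕ) (x : Fin n → M) (l : Fin n → M →ₗ[R] R), ∑ i, l i (x i) = 1
  faithful : ∀ c : C, (∀ m : M, c • m = 0) → c = 0
  full : ∀ f : M →ₗ[R] M, ∃ c : C, ∀ m, f m = c • m

variable (𝕜 M) in
/-- The linear maps `f` with `f (r • m) = σ r • f m`. -/
def twistedEnd (σ : R → R) : Submodule 𝕜 (Module.End 𝕜 M) where
  carrier := {f | ∀ (r : R) (m : M), f (r • m) = σ r • f m}
  zero_mem' _ _ := by simp
  add_mem' hf hg r m := by rw [LinearMap.add_apply, hf, hg, ← smul_add]; rfl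
  smul_mem' c f hf r m := by
    rw [LinearMap.smul_apply, hf, LinearMap.smul_apply, smul_algebra_smul_comm]

theorem mul_mem_twistedEnd {σ τ : R → R} {f g : Module.End 𝕜 M} (hf : f ∈ twistedEnd 𝕜 M σ)
    (hg : g ∈ twistedEnd 𝕜 M τ) (h : ∀ r, σ (τ r) = r) : f * g ∈ twistedEnd 𝕜 M (id : R → R) := by
  intro r m
  rw [Module.End.mul_apply, hg, hf, h]
  rfl

/-- The twisted endomorphism `m ↦ σ (l m) • x`. -/
def twistedRankOne (σ : R →ₗ[𝕜] R) (l : M →ₗ[R] R) (x : M) : Module.End 𝕜 M :=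
  (LinearMap.toSpanSingleton R M x).restrictScalars 𝕜 ∘ₗ σ ∘ₗ l.restrictScalars 𝕜

theorem twistedRankOne_apply (σ : R →ₗ[𝕜] R) (l : M →ₗ[R] R) (x m : M) :
    twistedRankOne σ l x m = σ (l m) • x := rfl

theorem twistedRankOne_mem (σ : R ≃ₐ[𝕜] R) (l : M →ₗ[R] R) (x : M) :
    twistedRankOne σ.toLinearMap l x ∈ twistedEnd 𝕜 M σ := fun r m => by
  simp only [twistedRankOne_apply, map_smul, smul_eq_mul, AlgEquiv.toLinearMap_apply, map_mul,
    mul_smul]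

namespace IsMoritaPair
variable (h : IsMoritaPair R C M)
include h

/-- The identity is a sum of compositions of `σ`-twisted and `σ⁻¹`-twisted endomorphisms. -/
theorem exists_sum_mul_eq_one (σ : R ≃ₐ[𝕜] R) :
    ∃ (n : ℕ) (f g : Fin n → Module.End 𝕜 M), (∀ i, f i ∈ twistedEnd 𝕜 M σ) ∧
      (∀ i, g i ∈ twistedEnd 𝕜 M σ.symm) ∧ ∑ i, f i * g i = 1 := by
  -- With ∑ lᵢ(m) xᵢ = m and ∑ tⱼ(yⱼ) = 1, the products of m ↦ σ(tⱼ(m)) xᵢ and m ↦ σ⁻¹(lᵢ(m)) yⱼ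
  -- send m to lᵢ(m) σ(tⱼ(yⱼ)) xᵢ. Summation over j removes the middle factor, and summation over i
  -- gives m.
  obtain ⟨n, x, l, hl⟩ := h.dualBasis
  obtain ⟨k, y, t, ht⟩ := h.trace
  refine ⟨n * k, fun p => twistedRankOne σ.toLinearMap (t (finProdFinEquiv.symm p).2)
      (x (finProdFinEquiv.symm p).1), fun p => twistedRankOne σ.symm.toLinearMap
      (l (finProdFinEquiv.symm p).1) (y (finProdFinEquiv.symm p).2),
    fun p => twistedRankOne_mem _ _ _, fun p => twistedRankOne_mem _ _ _, ?_⟩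
  ext m
  rw [LinearMap.sum_apply, finProdFinEquiv.symm.sum_comp (fun p : Fin n × Fin k =>
    (twistedRankOne σ.toLinearMap (t p.2) (x p.1) *
      twistedRankOne σ.symm.toLinearMap (l p.1) (y p.2)) m), Fintype.sum_prod_type]
  simp only [Module.End.mul_apply, twistedRankOne_apply, map_smul, smul_eq_mul,
    AlgEquiv.toLinearMap_apply, map_mul, AlgEquiv.apply_symm_apply, mul_smul, ← Finset.smul_sum,
    ← Finset.sum_smul, ← map_sum, ht, map_one, one_smul, hl, Module.End.one_apply]

theorem eq_of_smul_eq {c c' : C} (hc : ∀ m : M, c • m = c' • m) : c = c' :=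
  sub_eq_zero.1 (h.faithful _ fun m => by rw [sub_smul, hc, sub_self])

theorem exists_smul_eq {f : Module.End 𝕜 M} (hf : f ∈ twistedEnd 𝕜 M (id : R → R)) :
    ∃ c : C, ∀ m, c • m = f m := by
  obtain ⟨c, hc⟩ := h.full { toFun := f, map_add' := map_add f, map_smul' := hf }
  exact ⟨c, fun m => (hc m).symm⟩

/-- The ring `C` as the ring of `R`-linear endomorphisms. -/
def equivEnd : C ≃ₗ[𝕜] twistedEnd 𝕜 M (id : R → R) :=
  LinearEquiv.ofBijective
    ((Algebra.lsmul 𝕜 𝕜 M : C →ₐ[𝕜] Module.End 𝕜 M).toLinearMap.codRestrict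
      (twistedEnd 𝕜 M (id : R → R)) fun c r m => smul_comm c r m)
    ⟨fun _ _ hc => h.eq_of_smul_eq fun m => LinearMap.congr_fun (congrArg Subtype.val hc) m,
      fun f =>
        let ⟨c, hc⟩ := h.exists_smul_eq f.2
        ⟨c, Subtype.ext (LinearMap.ext hc)⟩⟩

theorem equivEnd_symm_smul (f : twistedEnd 𝕜 M (id : R → R)) (m : M) :
    h.equivEnd.symm f • m = (f : Module.End 𝕜 M) m := by
  obtain ⟨c, rfl⟩ := h.equivEnd.surjective f
  rw [LinearEquiv.symm_apply_apply]
  rfl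

/-- An invertible twisted endomorphism normalizes the action of `C`. -/
theorem exists_algEquiv {σ : R ≃ₐ[𝕜] R} (f : M ≃ₗ[𝕜] M) (hf : ∀ (r : R) m, f (r • m) = σ r • f m) :
    ∃ τ : C ≃ₐ[𝕜] C, ∀ (c : C) m, f (c • m) = τ c • f m := by
  have hf' : ∀ (r : R) m, f.symm (r • m) = σ.symm r • f.symm m := fun r m => by
    rw [LinearEquiv.symm_apply_eq, hf, AlgEquiv.apply_symm_apply, LinearEquiv.apply_symm_apply]
  -- In f c f⁻¹ the twists by σ and σ⁻¹ cancel, so this map is `R`-linear and is the action of an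
  -- element of `C`. The inverse of the resulting map is obtained from `f.symm`; all identities are
  -- checked on `M` by faithfulness.
  have key : ∀ (f : M ≃ₗ[𝕜] M) (σ : R ≃ₐ[𝕜] R), (∀ (r : R) m, f (r • m) = σ r • f m) →
      (∀ (r : R) m, f.symm (r • m) = σ.symm r • f.symm m) →
      ∀ c : C, ∃ d : C, ∀ m, d • f m = f (c • m) := by
    intro f σ hf hf' c
    obtain ⟨d, hd⟩ := h.exists_smul_eq (𝕜 := 𝕜)
      (f := f.toLinearMap * Algebra.lsmul 𝕜 𝕜 M c * f.symm.toLinearMap)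
      (fun r m => by
        change f (c • f.symm (r • m)) = r • f (c • f.symm m)
        rw [hf', smul_comm, hf, AlgEquiv.apply_symm_apply])
    exact ⟨d, fun m => by rw [hd]; simp⟩
  choose τ hτ using key f σ hf hf'
  choose τ' hτ' using key f.symm σ.symm hf' hf
  have hτf : ∀ c m, τ c • m = f (c • f.symm m) := fun c m => by rw [← hτ, f.apply_symm_apply]
  have hτf' : ∀ c m, τ' c • m = f.symm (c • f m) := fun c m => by rw [← hτ', f.symm_apply_apply]
  refine ⟨AlgEquiv.ofLinearEquiv
    { toFun := τ
      invFun := τ'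
      map_add' := fun c d => h.eq_of_smul_eq fun m => by simp [hτf, add_smul]
      map_smul' := fun t c => h.eq_of_smul_eq fun m => by simp [hτf, smul_assoc]
      left_inv := fun c => h.eq_of_smul_eq fun m => by simp [hτf, hτf']
      right_inv := fun c => h.eq_of_smul_eq fun m => by simp [hτf, hτf'] }
    (h.eq_of_smul_eq fun m => ?_) (fun c d => h.eq_of_smul_eq fun m => ?_),
    fun c m => (hτ c m).symm⟩
  · change τ 1 • m = _
    simp [hτf]
  · change τ (c * d) • m = (τ c * τ d) • m
    simp [hτf, mul_smul]

end IsMoritaPair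
end Twisted

/-! ### Invertible bimodules -/

namespace SuperBimodule
open scoped TensorProduct
variable {𝕜 : Type v} [RCLike 𝕜] {A B : Type u} [Ring A] [Algebra 𝕜 A] [Ring B] [Algebra 𝕜 B]
  {𝒜 : ZMod 2 → Submodule 𝕜 A} {ℬ : ZMod 2 → Submodule 𝕜 B}

/-- This is the order in which the commutation is needed to view `Bᵐᵒᵖ` as the endomorphism ring of
the left `A`-module. -/
instance smulComm_symm (M : SuperBimodule 𝒜 ℬ) : SMulCommClass Bᵐᵒᵖ A M := SMulCommClass.symm A Bᵐᵒᵖ M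

/-- The bilinear map `β` exhibits `A` as the relative tensor product `M ⊗_B N`. -/
structure IsTensorPairing (M : SuperBimodule 𝒜 ℬ) (N : SuperBimodule ℬ 𝒜)
    (β : M →ₗ[𝕜] N →ₗ[𝕜] A) : Prop where
  map_left : ∀ (a : A) m n, β (a • m) n = a * β m n
  map_right : ∀ m n (a : A), β m (MulOpposite.op a • n) = β m n * a
  balanced : ∀ m (b : B) n, β (MulOpposite.op b • m) n = β m (b • n)
  factors : ∀ {V : Type u} [AddCommGroup V] [Module 𝕜 V] (γ : M →ₗ[𝕜] N →ₗ[𝕜] V),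
    (∀ m (b : B) n, γ (MulOpposite.op b • m) n = γ m (b • n)) →
    ∃ T : A →ₗ[𝕜] V, ∀ m n, T (β m n) = γ m n
  exists_sum : ∃ (k : ℕ) (x : Fin k → M) (y : Fin k → N), ∑ i, β (x i) (y i) = 1

/-- The pairing is the composition of (m, n) ↦ m ⊗ n with the isomorphism. `factors` is the
universal property of the quotient, and `exists_sum` holds since the preimage of 1 is a finite sum
of pure tensors. -/
theorem TensorIso.exists_pairing [GradedAlgebra 𝒜] [FiniteDimensional 𝕜 A]
    {M : SuperBimodule 𝒜 ℬ} {N : SuperBimodule ℬ 𝒜} (τ : TensorIso M N (regular 𝒜)) :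
    ∃ β : M →ₗ[𝕜] N →ₗ[𝕜] A, IsTensorPairing M N β := by
  let e : RelTensor M N ≃ₗ[𝕜] A := τ.toEquiv
  let β : M →ₗ[𝕜] N →ₗ[𝕜] A :=
    (TensorProduct.mk 𝕜 M N).compr₂ (e.toLinearMap ∘ₗ (balancing M N).mkQ)
  have hβ : ∀ m n, β m n = τ.toEquiv (relTmul M N m n) := fun _ _ => rfl
  refine ⟨β, ⟨fun a m n => ?_, fun m n a => ?_, fun m b n => ?_, fun {V} _ _ γ hγ => ?_, ?_⟩⟩
  · rw [hβ, hβ, τ.map_left]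
    rfl
  · rw [hβ, hβ, τ.map_right]
    rfl
  · rw [hβ, hβ]
    congr 1
    exact (Submodule.Quotient.eq _).2 (Submodule.subset_span ⟨m, b, n, rfl⟩)
  · have hle : balancing M N ≤ LinearMap.ker (TensorProduct.lift γ) := by
      refine Submodule.span_le.2 ?_
      rintro _ ⟨m, b, n, rfl⟩
      rw [SetLike.mem_coe, LinearMap.mem_ker, map_sub, TensorProduct.lift.tmul,
        TensorProduct.lift.tmul, hγ, sub_self]
    refine ⟨(balancing M N).liftQ _ hle ∘ₗ e.symm.toLinearMap, fun m n => ?_⟩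
    have : e.symm (β m n) = relTmul M N m n := e.symm_apply_apply _
    rw [LinearMap.comp_apply, LinearEquiv.coe_coe, this]
    exact TensorProduct.lift.tmul m n
  · have key : ∀ z : M ⊗[𝕜] N, ∃ (k : ℕ) (x : Fin k → M) (y : Fin k → N),
        ∑ i, β (x i) (y i) = e (Submodule.Quotient.mk z) := by
      intro z
      induction z with
      | zero => exact ⟨0, Fin.elim0, Fin.elim0, by simp⟩
      | tmul m n => exact ⟨1, fun _ => m, fun _ => n, by
        rw [Fin.sum_univ_one]
        rfl⟩
      | add z z' hz hz' =>
        obtain ⟨k, x, y, h⟩ := hz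
        obtain ⟨k', x', y', h'⟩ := hz'
        refine ⟨k + k', Fin.append x x', Fin.append y y', ?_⟩
        rw [Fin.sum_univ_add, Submodule.Quotient.mk_add, map_add, ← h, ← h']
        simp
    obtain ⟨z, hz⟩ := Submodule.Quotient.mk_surjective _ (e.symm 1)
    obtain ⟨k, x, y, h⟩ := key z
    exact ⟨k, x, y, by rw [h, hz, e.apply_symm_apply]⟩

/-! ### Morita theory from two tensor pairings that need not be compatible -/

section Pairings
variable {M : SuperBimodule 𝒜 ℬ} {N : SuperBimodule ℬ 𝒜} {β : M →ₗ[𝕜] N →ₗ[𝕜] A}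
  {γ : N →ₗ[𝕜] M →ₗ[𝕜] B} (hβ : IsTensorPairing M N β) (hγ : IsTensorPairing N M γ)
include hβ hγ

/-- For fixed z, the expression m γ(n, z) is balanced over B, so it is a function of β(m, n). If
β(x, ·) = 0, then x γ(yᵢ, zᵢ) = 0 for all i, and these elements sum to x when ∑ γ(yᵢ, zᵢ) = 1. -/
theorem eq_zero_of_pairing_left {x : M} (hx : ∀ n, β x n = 0) : x = 0 := by
  obtain ⟨k, y, z, hyz⟩ := hγ.exists_sum
  have h : ∀ i, MulOpposite.op (γ (y i) (z i)) • x = 0 := by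
    intro i
    obtain ⟨T, hT⟩ := hβ.factors (V := M) (LinearMap.mk₂ 𝕜 (fun m n => MulOpposite.op (γ n (z i)) • m)
      (fun _ _ _ => smul_add _ _ _) (fun c m n => smul_algebra_smul_comm c _ m)
      (fun m n n' => by simp [add_smul]) (fun c m n => by simp))
      (fun m b n => by
        simp only [LinearMap.mk₂_apply, smul_smul, ← MulOpposite.op_mul, hγ.map_left])
    have := hT x (y i)
    rw [hx, map_zero] at this
    exact this.symm
  have h2 : MulOpposite.op (∑ i, γ (y i) (z i)) • x = 0 := by
    rw [Finset.op_sum, Finset.sum_smul]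
    exact Finset.sum_eq_zero fun i _ => h i
  rwa [hyz, MulOpposite.op_one, one_smul] at h2

theorem eq_zero_of_pairing_right {x : M} (hx : ∀ n, γ n x = 0) : x = 0 := by
  obtain ⟨k, y, z, hyz⟩ := hβ.exists_sum
  have h : ∀ i, β (y i) (z i) • x = 0 := by
    intro i
    obtain ⟨T, hT⟩ := hγ.factors (V := M) (LinearMap.mk₂ 𝕜 (fun n m => β (y i) n • m)
      (fun n n' m => by simp [add_smul]) (fun c n m => by simp)
      (fun _ _ _ => smul_add _ _ _) (fun c n m => smul_algebra_smul_comm c _ m))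
      (fun n a m => by
        simp only [LinearMap.mk₂_apply, smul_smul, hβ.map_right])
    have := hT (z i) x
    rw [hx, map_zero] at this
    exact this.symm
  have h2 : (∑ i, β (y i) (z i)) • x = 0 := by
    rw [Finset.sum_smul]
    exact Finset.sum_eq_zero fun i _ => h i
  rwa [hyz, one_smul] at h2

/-- The two tensor isomorphisms are not assumed to satisfy the associativity of a Morita context. As
a substitute, (n, m) ↦ β(x, n) m is balanced over A, hence factors through γ by a right B-linear map
B → M. Its value t = θ(x) at 1 satisfies t γ(n, m) = β(x, n) m. If ∑ β(xᵢ, yᵢ) = 1, then θ(xᵢ) and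
γ(yᵢ, ·) form a dual basis. -/
theorem isMoritaPair_right_of_pairing : IsMoritaPair Bᵐᵒᵖ A M where
  dualBasis := by
    have hθ : ∀ x : M, ∃ t : M, ∀ n m, MulOpposite.op (γ n m) • t = β x n • m := by
      intro x
      obtain ⟨T, hT⟩ := hγ.factors (V := M) (LinearMap.mk₂ 𝕜 (fun n m => β x n • m)
        (fun n n' m => by simp [add_smul]) (fun c n m => by simp)
        (fun _ _ _ => smul_add _ _ _) (fun c n m => smul_algebra_smul_comm c _ m))
        (fun n a m => by simp only [LinearMap.mk₂_apply, smul_smul, hβ.map_right])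
      obtain ⟨k, y, z, hyz⟩ := hγ.exists_sum
      -- `T` is right `B`-linear
      have hTb : ∀ b, MulOpposite.op b • T 1 = T b := by
        intro b
        have : b = ∑ i, γ (y i) (MulOpposite.op b • z i) := by
          simp only [hγ.map_right, ← Finset.sum_mul, hyz, one_mul]
        conv_rhs => rw [this]
        rw [← hyz, map_sum, map_sum, Finset.smul_sum]
        refine Finset.sum_congr rfl fun i _ => ?_
        rw [hT, hT, LinearMap.mk₂_apply, LinearMap.mk₂_apply, smul_comm]
      exact ⟨T 1, fun n m => by rw [hTb, hT, LinearMap.mk₂_apply]⟩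
    choose θ hθ using hθ
    obtain ⟨k, x, y, hxy⟩ := hβ.exists_sum
    refine ⟨k, fun i => θ (x i), fun i =>
      { toFun := fun m => MulOpposite.op (γ (y i) m)
        map_add' := fun m m' => by simp
        map_smul' := fun b m => by
          conv_lhs => rw [← MulOpposite.op_unop b, hγ.map_right]
          rfl }, fun m => ?_⟩
    simp only [LinearMap.coe_mk, AddHom.coe_mk, hθ, ← Finset.sum_smul, hxy, one_smul]
  trace := by
    obtain ⟨k, y, x, hxy⟩ := hγ.exists_sum
    refine ⟨k, x, fun i =>
      { toFun := fun m => MulOpposite.op (γ (y i) m)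
        map_add' := fun m m' => by simp
        map_smul' := fun b m => by
          conv_lhs => rw [← MulOpposite.op_unop b, hγ.map_right]
          rfl }, ?_⟩
    simp only [LinearMap.coe_mk, AddHom.coe_mk, ← Finset.op_sum, hxy, MulOpposite.op_one]
  faithful a ha := by
    obtain ⟨k, x, y, hxy⟩ := hβ.exists_sum
    rw [← mul_one a, ← hxy, Finset.mul_sum]
    refine Finset.sum_eq_zero fun i _ => ?_
    rw [← hβ.map_left, ha, map_zero, LinearMap.zero_apply]
  full f := by
    -- For `B`-linear `f`, the assignment β(m, n) ↦ β(f m, n) is a well-defined right `A`-linear map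
    -- `F`, that is, left multiplication by `F 1`. By nondegeneracy of β, `f` is the action of `F
    -- 1`.
    obtain ⟨F, hF⟩ := hβ.factors (V := A) (β ∘ₗ f.restrictScalars 𝕜) (fun m b n => by
      simp only [LinearMap.comp_apply, LinearMap.coe_restrictScalars, map_smul, hβ.balanced])
    obtain ⟨k, x, y, hxy⟩ := hβ.exists_sum
    have hFa : ∀ a, F 1 * a = F a := by
      intro a
      have : a = ∑ i, β (x i) (MulOpposite.op a • y i) := by
        simp only [hβ.map_right, ← Finset.sum_mul, hxy, one_mul]
      conv_rhs => rw [this]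
      rw [← hxy, map_sum, map_sum, Finset.sum_mul]
      refine Finset.sum_congr rfl fun i _ => ?_
      rw [hF, hF, LinearMap.comp_apply, hβ.map_right]
    refine ⟨F 1, fun m => sub_eq_zero.1 (eq_zero_of_pairing_left hβ hγ fun n => ?_)⟩
    rw [map_sub, LinearMap.sub_apply, hβ.map_left, hFa, hF, sub_eq_zero]
    rfl

/-- The mirror image of the previous argument: now θ(x) satisfies β(m, n) θ(x) = m γ(n, x), and the
dual basis consists of θ(xᵢ) and β(·, yᵢ), where ∑ γ(yᵢ, xᵢ) = 1. -/
theorem isMoritaPair_left_of_pairing : IsMoritaPair A Bᵐᵒᵖ M where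
  dualBasis := by
    have hθ : ∀ x : M, ∃ t : M, ∀ m n, β m n • t = MulOpposite.op (γ n x) • m := by
      intro x
      obtain ⟨T, hT⟩ := hβ.factors (V := M)
        (LinearMap.mk₂ 𝕜 (fun m n => MulOpposite.op (γ n x) • m)
        (fun _ _ _ => smul_add _ _ _) (fun c m n => smul_algebra_smul_comm c _ m)
        (fun m n n' => by simp [add_smul]) (fun c m n => by simp))
        (fun m b n => by
          simp only [LinearMap.mk₂_apply, smul_smul, ← MulOpposite.op_mul, hγ.map_left])
      obtain ⟨k, y, z, hyz⟩ := hβ.exists_sum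
      -- `T` is left `A`-linear
      have hTa : ∀ a, a • T 1 = T a := by
        intro a
        have : a = ∑ i, β (a • y i) (z i) := by
          simp only [hβ.map_left, ← Finset.mul_sum, hyz, mul_one]
        conv_rhs => rw [this]
        rw [← hyz, map_sum, map_sum, Finset.smul_sum]
        refine Finset.sum_congr rfl fun i _ => ?_
        rw [hT, hT, LinearMap.mk₂_apply, LinearMap.mk₂_apply, smul_comm]
      exact ⟨T 1, fun m n => by rw [hTa, hT, LinearMap.mk₂_apply]⟩
    choose θ hθ using hθ
    obtain ⟨k, y, x, hxy⟩ := hγ.exists_sum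
    refine ⟨k, fun i => θ (x i), fun i =>
      { toFun := fun m => β m (y i)
        map_add' := fun m m' => by simp
        map_smul' := fun a m => hβ.map_left a m _ }, fun m => ?_⟩
    simp only [LinearMap.coe_mk, AddHom.coe_mk, hθ, ← Finset.sum_smul, ← Finset.op_sum, hxy,
      MulOpposite.op_one, one_smul]
  trace := by
    obtain ⟨k, x, y, hxy⟩ := hβ.exists_sum
    exact ⟨k, x, fun i =>
      { toFun := fun m => β m (y i)
        map_add' := fun m m' => by simp
        map_smul' := fun a m => hβ.map_left a m _ }, hxy⟩
  faithful b hb := by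
    obtain ⟨k, y, x, hxy⟩ := hγ.exists_sum
    apply MulOpposite.unop_injective
    rw [MulOpposite.unop_zero, ← one_mul b.unop, ← hxy, Finset.sum_mul]
    refine Finset.sum_eq_zero fun i _ => ?_
    rw [← hγ.map_right, MulOpposite.op_unop, hb, map_zero]
  full f := by
    obtain ⟨F, hF⟩ := hγ.factors (V := B) (γ.compl₂ (f.restrictScalars 𝕜)) (fun n a m => by
      simp only [LinearMap.compl₂_apply, LinearMap.coe_restrictScalars, map_smul, hγ.balanced])
    obtain ⟨k, y, x, hxy⟩ := hγ.exists_sum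
    have hFb : ∀ b, b * F 1 = F b := by
      intro b
      have : b = ∑ i, γ (b • y i) (x i) := by
        simp only [hγ.map_left, ← Finset.mul_sum, hxy, mul_one]
      conv_rhs => rw [this]
      rw [← hxy, map_sum, map_sum, Finset.mul_sum]
      refine Finset.sum_congr rfl fun i _ => ?_
      rw [hF, hF, LinearMap.compl₂_apply, LinearMap.compl₂_apply, hγ.map_left]
    refine ⟨MulOpposite.op (F 1), fun m => sub_eq_zero.1
      (eq_zero_of_pairing_right hβ hγ fun n => ?_)⟩
    rw [map_sub, hγ.map_right, hFb, hF, sub_eq_zero]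
    rfl

end Pairings

variable [GradedAlgebra 𝒜] [FiniteDimensional 𝕜 A] [GradedAlgebra ℬ] [FiniteDimensional 𝕜 B]

theorem IsInvertible.isMoritaPair_right {M : SuperBimodule 𝒜 ℬ} (hM : M.IsInvertible) :
    IsMoritaPair Bᵐᵒᵖ A M := by
  obtain ⟨N, ⟨τ⟩, ⟨τ'⟩⟩ := hM
  obtain ⟨β, hβ⟩ := τ.exists_pairing
  obtain ⟨γ, hγ⟩ := τ'.exists_pairing
  exact isMoritaPair_right_of_pairing hβ hγ

theorem IsInvertible.isMoritaPair_left {M : SuperBimodule 𝒜 ℬ} (hM : M.IsInvertible) :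
    IsMoritaPair A Bᵐᵒᵖ M := by
  obtain ⟨N, ⟨τ⟩, ⟨τ'⟩⟩ := hM
  obtain ⟨β, hβ⟩ := τ.exists_pairing
  obtain ⟨γ, hγ⟩ := τ'.exists_pairing
  exact isMoritaPair_left_of_pairing hβ hγ

end SuperBimodule

/-! ### Actions on twisted endomorphisms and their products -/

section TwistedActions
variable {𝕜 : Type*} [RCLike 𝕜] {R C M : Type*} [Ring R] [Algebra 𝕜 R] [Ring C] [Algebra 𝕜 C]
  [AddCommGroup M] [Module 𝕜 M] [Module R M] [Module C M] [IsScalarTower 𝕜 R M]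
  [IsScalarTower 𝕜 C M] [SMulCommClass C R M] {σ : R → R}

/-- Composition of a twisted endomorphism with the action of `c` on its values. -/
def twistedPost (c : C) (f : twistedEnd 𝕜 M σ) : twistedEnd 𝕜 M σ :=
  ⟨Algebra.lsmul 𝕜 𝕜 M c * f, fun r m => by
    change c • (f : Module.End 𝕜 M) (r • m) = σ r • c • (f : Module.End 𝕜 M) m
    rw [f.2, smul_comm]⟩

/-- Composition of a twisted endomorphism with the action of `c` on its arguments. -/
def twistedPre (c : C) (f : twistedEnd 𝕜 M σ) : twistedEnd 𝕜 M σ :=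
  ⟨f * Algebra.lsmul 𝕜 𝕜 M c, fun r m => by
    change (f : Module.End 𝕜 M) (c • r • m) = σ r • (f : Module.End 𝕜 M) (c • m)
    rw [smul_comm, f.2]⟩

theorem twistedEnd_ext {f g : twistedEnd 𝕜 M σ}
    (h : ∀ m, (f : Module.End 𝕜 M) m = (g : Module.End 𝕜 M) m) : f = g :=
  Subtype.ext (LinearMap.ext h)

/-- Conjugation of twisted endomorphisms with an involution of `M` over an involution of `R`. -/
def twistedConj (ε : M →ₗ[𝕜] M) (δ : R → R) (hε : ∀ (r : R) m, ε (r • m) = δ r • ε m)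
    (hσ : ∀ r, δ (σ (δ r)) = σ r) : twistedEnd 𝕜 M σ →ₗ[𝕜] twistedEnd 𝕜 M σ :=
  (LinearMap.mulLeft 𝕜 ε ∘ₗ LinearMap.mulRight 𝕜 ε).restrict fun f hf r m => by
    change ε (f (ε (r • m))) = σ r • ε (f (ε m))
    rw [hε, hf, hε, hσ]

/-- The product of a `σ`-twisted and a `σ⁻¹`-twisted endomorphism, as an element of `C`. -/
def twistedPairing (h : IsMoritaPair R C M) {σ τ : R → R} (hστ : ∀ r, σ (τ r) = r) :
    twistedEnd 𝕜 M σ →ₗ[𝕜] twistedEnd 𝕜 M τ →ₗ[𝕜] C :=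
  LinearMap.mk₂ 𝕜 (fun f g => h.equivEnd.symm ⟨(f : Module.End 𝕜 M) * (g : Module.End 𝕜 M),
      mul_mem_twistedEnd f.2 g.2 hστ⟩)
    (fun _ _ _ => (congrArg _ (Subtype.ext (add_mul _ _ _))).trans (map_add _ _ _))
    (fun c _ _ => (congrArg _ (Subtype.ext (smul_mul_assoc c _ _))).trans (map_smul _ c _))
    (fun _ _ _ => (congrArg _ (Subtype.ext (mul_add _ _ _))).trans (map_add _ _ _))
    (fun c _ _ => (congrArg _ (Subtype.ext (mul_smul_comm c _ _))).trans (map_smul _ c _))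

theorem twistedPairing_smul (h : IsMoritaPair R C M) {σ τ : R → R} (hστ : ∀ r, σ (τ r) = r)
    (f : twistedEnd 𝕜 M σ) (g : twistedEnd 𝕜 M τ) (m : M) :
    twistedPairing h hστ f g • m = (f : Module.End 𝕜 M) ((g : Module.End 𝕜 M) m) :=
  h.equivEnd_symm_smul _ m

end TwistedActions

/-! ### Tensor isomorphisms from Morita contexts, and the parity of an action -/

namespace SuperBimodule
open scoped TensorProduct
variable {𝕜 : Type v} [RCLike 𝕜] {A B : Type u} [Ring A] [Algebra 𝕜 A] [Ring B] [Algebra 𝕜 B]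
  {𝒜 : ZMod 2 → Submodule 𝕜 A} {ℬ : ZMod 2 → Submodule 𝕜 B}

/-- A Morita context in which one of the pairings has `1` in its image gives an isomorphism
`P ⊗_B Q ≅ A`. -/
theorem nonempty_tensorIso [GradedAlgebra 𝒜] [FiniteDimensional 𝕜 A] {P : SuperBimodule 𝒜 ℬ}
    {Q : SuperBimodule ℬ 𝒜} (β : P →ₗ[𝕜] Q →ₗ[𝕜] A) (γ : Q →ₗ[𝕜] P →ₗ[𝕜] B)
    (map_left : ∀ (a : A) p q, β (a • p) q = a * β p q)
    (map_right : ∀ p q (a : A), β p (MulOpposite.op a • q) = β p q * a)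
    (balanced : ∀ p (b : B) q, β (MulOpposite.op b • p) q = β p (b • q))
    (map_grading : ∀ i j, ∀ p ∈ P.grading i, ∀ q ∈ Q.grading j, β p q ∈ 𝒜 (i + j))
    (assoc : ∀ p q p', β p q • p' = MulOpposite.op (γ q p') • p)
    (assoc' : ∀ q p q', γ q p • q' = MulOpposite.op (β p q') • q)
    {n : ℕ} (x : Fin n → P) (y : Fin n → Q) (hxy : ∑ i, β (x i) (y i) = 1) :
    Nonempty (TensorIso P Q (regular 𝒜)) := by
  have hle : balancing P Q ≤ LinearMap.ker (TensorProduct.lift β) := by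
    refine Submodule.span_le.2 ?_
    rintro _ ⟨m, b, n, rfl⟩
    rw [SetLike.mem_coe, LinearMap.mem_ker, map_sub, TensorProduct.lift.tmul,
      TensorProduct.lift.tmul, balanced, sub_self]
  let T : RelTensor P Q →ₗ[𝕜] A := (balancing P Q).liftQ _ hle
  have hT : ∀ p q, T (relTmul P Q p q) = β p q := fun p q => TensorProduct.lift.tmul p q
  -- The inverse is a ↦ ∑ a xᵢ ⊗ yᵢ.
  let S : A →ₗ[𝕜] RelTensor P Q := ∑ i, (balancing P Q).mkQ ∘ₗ
    (TensorProduct.mk 𝕜 P Q).flip (y i) ∘ₗ (LinearMap.toSpanSingleton A P (x i)).restrictScalars 𝕜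
  have hS : ∀ a, S a = ∑ i, relTmul P Q (a • x i) (y i) := fun a => by
    simp only [S, LinearMap.sum_apply]
    rfl
  have hadd : ∀ p q q', relTmul P Q p (q + q') = relTmul P Q p q + relTmul P Q p q' := fun p q q' => by
    simp only [relTmul, TensorProduct.tmul_add, Submodule.Quotient.mk_add]
  have hST : ∀ z, S (T z) = z := by
    have : S ∘ₗ T = LinearMap.id := by
      refine Submodule.linearMap_qext _ (TensorProduct.ext' fun p q => ?_)
      change S (T (relTmul P Q p q)) = relTmul P Q p q
      rw [hT, hS]
      -- β(p, q) xᵢ ⊗ yᵢ = p γ(q, xᵢ) ⊗ yᵢ = p ⊗ γ(q, xᵢ) yᵢ = p ⊗ q β(xᵢ, yᵢ), by both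
      -- associativity laws and the balancing relation.
      have h1 : ∀ i, relTmul P Q (β p q • x i) (y i) =
          relTmul P Q p (MulOpposite.op (β (x i) (y i)) • q) := fun i => by
        rw [assoc, ← assoc']
        exact (Submodule.Quotient.eq _).2 (Submodule.subset_span ⟨_, _, _, rfl⟩)
      have h2 : ∀ s : Finset (Fin n), ∑ i ∈ s, relTmul P Q p (MulOpposite.op (β (x i) (y i)) • q) =
          relTmul P Q p (MulOpposite.op (∑ i ∈ s, β (x i) (y i)) • q) := fun s => by
        classical
        induction s using Finset.induction_on with
        | empty => simp [relTmul]
        | insert i s hi ih =>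
          rw [Finset.sum_insert hi, Finset.sum_insert hi, ih, MulOpposite.op_add, add_smul, hadd]
      rw [Finset.sum_congr rfl fun i _ => h1 i, h2, hxy, MulOpposite.op_one, one_smul]
    exact LinearMap.congr_fun this
  have hTS : ∀ a, T (S a) = a := fun a => by
    rw [hS, map_sum]
    simp only [hT, map_left, ← Finset.mul_sum, hxy, mul_one]
  let e : RelTensor P Q ≃ₗ[𝕜] A := { T with invFun := S, left_inv := hST, right_inv := hTS }
  have he : ∀ p q, e (relTmul P Q p q) = β p q := hT
  refine ⟨⟨e, fun a p q => ?_, fun a p q => ?_, fun i j p hp q hq => ?_⟩⟩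
  · exact ((he _ _).trans (map_left a p q)).trans (congrArg (a * ·) (he p q).symm)
  · exact ((he _ _).trans (map_right p q a)).trans (congrArg (· * a) (he p q).symm)
  · exact (he p q).symm ▸ map_grading i j p hp q hq

section ParityAction
variable [GradedAlgebra 𝒜] [GradedAlgebra ℬ] (M : SuperBimodule 𝒜 ℬ)

/-- On homogeneous elements this is the multiplicativity of signs. It says that the parity of `M` is
twisted over the parity of `A`, so that conjugation with it preserves spaces of twisted
endomorphisms. -/
theorem parity_smul (a : A) (m : M) : parity M.isInternal (a • m) =
    parity (DirectSum.Decomposition.isInternal 𝒜) a • parity M.isInternal m := by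
  revert a
  refine homogeneous_induction (DirectSum.Decomposition.isInternal 𝒜) (fun x y hx hy => ?_)
    fun i a ha => ?_
  · simp only [add_smul, map_add, hx, hy]
  · revert m
    refine homogeneous_induction M.isInternal (fun x y hx hy => ?_) fun j m hm => ?_
    · simp only [smul_add, map_add, hx, hy]
    · rw [(mem_iff_parity M.isInternal).1 (M.left_mem ha hm), (mem_iff_parity M.isInternal).1 hm,
        (mem_iff_parity _).1 ha, paritySign_add, mul_smul, smul_assoc,
        smul_algebra_smul_comm (paritySign 𝕜 j) a m]

theorem parity_op_smul (b : B) (m : M) : parity M.isInternal (MulOpposite.op b • m) =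
    MulOpposite.op (parity (DirectSum.Decomposition.isInternal ℬ) b) • parity M.isInternal m := by
  revert b
  refine homogeneous_induction (DirectSum.Decomposition.isInternal ℬ) (fun x y hx hy => ?_)
    fun i b hb => ?_
  · simp only [MulOpposite.op_add, add_smul, map_add, hx, hy]
  · revert m
    refine homogeneous_induction M.isInternal (fun x y hx hy => ?_) fun j m hm => ?_
    · simp only [smul_add, map_add, hx, hy]
    · rw [(mem_iff_parity M.isInternal).1 (M.right_mem hm hb), (mem_iff_parity M.isInternal).1 hm,
        (mem_iff_parity _).1 hb, paritySign_add, mul_comm, mul_smul, MulOpposite.op_smul, smul_assoc,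
        smul_algebra_smul_comm (paritySign 𝕜 j) (MulOpposite.op b) m]

theorem parity_evenAut (φ : evenAut 𝒜) (a : A) :
    parity (DirectSum.Decomposition.isInternal 𝒜) ((φ : A ≃ₐ[𝕜] A) a) =
      (φ : A ≃ₐ[𝕜] A) (parity (DirectSum.Decomposition.isInternal 𝒜) a) :=
  (even_iff_parity (DirectSum.Decomposition.isInternal 𝒜) (φ : A ≃ₐ[𝕜] A).toLinearEquiv).1 φ.2 a

variable {M}

/-- The degree of `a` can be read off from its action, because the action is faithful. -/
theorem mem_left_of_parity (h : IsMoritaPair Bᵐᵒᵖ A M) {a : A} {i : ZMod 2}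
    (ha : ∀ m, parity M.isInternal (a • m) = paritySign 𝕜 i • a • parity M.isInternal m) :
    a ∈ 𝒜 i := by
  refine (mem_iff_parity (DirectSum.Decomposition.isInternal 𝒜)).2 (h.eq_of_smul_eq fun m => ?_)
  have := ha (parity M.isInternal m)
  rwa [parity_smul, parity_parity, ← smul_assoc] at this

theorem mem_right_of_parity (h : IsMoritaPair A Bᵐᵒᵖ M) {b : B} {i : ZMod 2}
    (hb : ∀ m, parity M.isInternal (MulOpposite.op b • m) =
      paritySign 𝕜 i • MulOpposite.op b • parity M.isInternal m) :
    b ∈ ℬ i := by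
  refine (mem_iff_parity (DirectSum.Decomposition.isInternal ℬ)).2 (MulOpposite.op_injective
    (h.eq_of_smul_eq fun m => ?_))
  have := hb (parity M.isInternal m)
  rwa [parity_op_smul, parity_parity, ← smul_assoc, ← MulOpposite.op_smul] at this

end ParityAction

end SuperBimodule

/-! ### Bimodules of twisted endomorphisms, and lifting of automorphisms by Picard-surjectivity -/

namespace SuperBimodule
variable {𝕜 : Type v} [RCLike 𝕜] {A B : Type u} [Ring A] [Algebra 𝕜 A] [Ring B] [Algebra 𝕜 B]
  {𝒜 : ZMod 2 → Submodule 𝕜 A} {ℬ : ZMod 2 → Submodule 𝕜 B}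
  [GradedAlgebra 𝒜] [GradedAlgebra ℬ] (M : SuperBimodule 𝒜 ℬ)

/-- The space of linear maps `f` with `f (m ◁ b) = f m ◁ ψ b`. -/
abbrev RightTwist (ψ : evenAut ℬ) : Submodule 𝕜 (Module.End 𝕜 M) :=
  twistedEnd 𝕜 M fun r : Bᵐᵒᵖ => MulOpposite.op ((ψ : B ≃ₐ[𝕜] B) r.unop)

/-- The space of linear maps `f` with `f (a ▷ m) = φ a ▷ f m`. -/
abbrev LeftTwist (φ : evenAut 𝒜) : Submodule 𝕜 (Module.End 𝕜 M) :=
  twistedEnd 𝕜 M fun a : A => (φ : A ≃ₐ[𝕜] A) a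

/-- The parity on `RightTwist`. -/
def rightTwistParity (ψ : evenAut ℬ) : M.RightTwist ψ →ₗ[𝕜] M.RightTwist ψ :=
  twistedConj (parity M.isInternal)
    (fun r => MulOpposite.op (parity (DirectSum.Decomposition.isInternal ℬ) r.unop))
    (fun r m => M.parity_op_smul r.unop m)
    (fun r => by simp only [MulOpposite.unop_op, parity_evenAut, parity_parity])

/-- The parity on `LeftTwist`. -/
def leftTwistParity (φ : evenAut 𝒜) : M.LeftTwist φ →ₗ[𝕜] M.LeftTwist φ :=
  twistedConj (parity M.isInternal) (parity (DirectSum.Decomposition.isInternal 𝒜))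
    (fun a m => M.parity_smul a m)
    (fun r => by simp only [parity_evenAut, parity_parity])

/-- The grading is by the eigenvalues of conjugation with the parity; one of the two parities is
moved to the other side, as it is an involution. -/
theorem mem_rightTwist_grading {ψ : evenAut ℬ} {f : M.RightTwist ψ} {i : ZMod 2} :
    f ∈ parityGrading (M.rightTwistParity ψ) i ↔ ∀ m : M,
      parity M.isInternal ((f : Module.End 𝕜 M) m) =
        paritySign 𝕜 i • (f : Module.End 𝕜 M) (parity M.isInternal m) := by
  rw [mem_parityGrading]
  refine ⟨fun h m => ?_, fun h => twistedEnd_ext fun m => ?_⟩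
  · have := LinearMap.congr_fun (congrArg Subtype.val h) (parity M.isInternal m)
    change parity M.isInternal ((f : Module.End 𝕜 M) _) = _ at this
    rwa [parity_parity] at this
  · change parity M.isInternal ((f : Module.End 𝕜 M) _) = _
    rw [h, parity_parity]
    rfl

theorem mem_leftTwist_grading {φ : evenAut 𝒜} {f : M.LeftTwist φ} {i : ZMod 2} :
    f ∈ parityGrading (M.leftTwistParity φ) i ↔ ∀ m : M,
      parity M.isInternal ((f : Module.End 𝕜 M) m) =
        paritySign 𝕜 i • (f : Module.End 𝕜 M) (parity M.isInternal m) := by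
  rw [mem_parityGrading]
  refine ⟨fun h m => ?_, fun h => twistedEnd_ext fun m => ?_⟩
  · have := LinearMap.congr_fun (congrArg Subtype.val h) (parity M.isInternal m)
    change parity M.isInternal ((f : Module.End 𝕜 M) _) = _ at this
    rwa [parity_parity] at this
  · change parity M.isInternal ((f : Module.End 𝕜 M) _) = _
    rw [h, parity_parity]
    rfl

/-- The `A`-`A`-bimodule of linear maps `f` with `f (m ◁ b) = f m ◁ ψ b`. -/
def rightTwist (ψ : evenAut ℬ) : SuperBimodule 𝒜 𝒜 :=
  letI : Module A (M.RightTwist ψ) :=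
    { smul := fun a f => twistedPost a f
      one_smul := fun f => twistedEnd_ext fun m => one_smul A _
      mul_smul := fun a b f => twistedEnd_ext fun m => mul_smul a b _
      smul_zero := fun a => twistedEnd_ext fun m => smul_zero a
      smul_add := fun a f g => twistedEnd_ext fun m => smul_add a _ _
      add_smul := fun a b f => twistedEnd_ext fun m => add_smul a b _
      zero_smul := fun f => twistedEnd_ext fun m => zero_smul A _ }
  letI : Module Aᵐᵒᵖ (M.RightTwist ψ) :=
    { smul := fun a f => twistedPre a.unop f
      one_smul := fun f => twistedEnd_ext fun m => congrArg f.1 (one_smul A m)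
      mul_smul := fun a b f => twistedEnd_ext fun m => congrArg f.1 (mul_smul b.unop a.unop m)
      smul_zero := fun a => twistedEnd_ext fun m => rfl
      smul_add := fun a f g => twistedEnd_ext fun m => rfl
      add_smul := fun a b f => twistedEnd_ext fun m =>
        (congrArg f.1 (add_smul a.unop b.unop m)).trans (map_add f.1 _ _)
      zero_smul := fun f => twistedEnd_ext fun m =>
        (congrArg f.1 (zero_smul A m)).trans (map_zero f.1) }
  { carrier := M.RightTwist ψ
    leftTower := ⟨fun c a f => twistedEnd_ext fun m => smul_assoc c a _⟩
    rightTower := ⟨fun c a f => twistedEnd_ext fun m =>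
      (congrArg f.1 (smul_assoc c a.unop m)).trans (map_smul f.1 c _)⟩
    smulComm := ⟨fun a b f => twistedEnd_ext fun m => rfl⟩
    grading := parityGrading (M.rightTwistParity ψ)
    isInternal := isInternal_parityGrading fun f => twistedEnd_ext fun m => by
      change parity M.isInternal (parity M.isInternal (f.1 (parity M.isInternal
        (parity M.isInternal m)))) = f.1 m
      rw [parity_parity, parity_parity]
    left_mem := fun {i j a f} ha hf => (M.mem_rightTwist_grading).2 fun m => by
      change parity M.isInternal (a • f.1 m) = paritySign 𝕜 (i + j) • a • f.1 (parity M.isInternal m)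
      rw [parity_smul, (mem_iff_parity _).1 ha, (M.mem_rightTwist_grading).1 hf, smul_assoc,
        smul_algebra_smul_comm (paritySign 𝕜 j), paritySign_add, mul_smul]
    right_mem := fun {i j f a} hf ha => (M.mem_rightTwist_grading).2 fun m => by
      change parity M.isInternal (f.1 (a • m)) = paritySign 𝕜 (i + j) • f.1 (a • parity M.isInternal m)
      rw [(M.mem_rightTwist_grading).1 hf, parity_smul, (mem_iff_parity _).1 ha, smul_assoc, map_smul,
        paritySign_add, mul_smul] }

/-- The `B`-`B`-bimodule of linear maps `f` with `f (a ▷ m) = φ a ▷ f m`, where `B` acts on the left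
through the arguments of `f` and on the right through its values. -/
def leftTwist (φ : evenAut 𝒜) : SuperBimodule ℬ ℬ :=
  letI : Module B (M.LeftTwist φ) :=
    { smul := fun b f => twistedPre (MulOpposite.op b) f
      one_smul := fun f => twistedEnd_ext fun m => congrArg f.1 (one_smul Bᵐᵒᵖ m)
      mul_smul := fun a b f => twistedEnd_ext fun m =>
        congrArg f.1 (mul_smul (MulOpposite.op b) (MulOpposite.op a) m)
      smul_zero := fun a => twistedEnd_ext fun m => rfl
      smul_add := fun a f g => twistedEnd_ext fun m => rfl
      add_smul := fun a b f => twistedEnd_ext fun m =>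
        (congrArg f.1 (add_smul (MulOpposite.op a) (MulOpposite.op b) m)).trans (map_add f.1 _ _)
      zero_smul := fun f => twistedEnd_ext fun m =>
        (congrArg f.1 (zero_smul Bᵐᵒᵖ m)).trans (map_zero f.1) }
  letI : Module Bᵐᵒᵖ (M.LeftTwist φ) :=
    { smul := fun b f => twistedPost b f
      one_smul := fun f => twistedEnd_ext fun m => one_smul Bᵐᵒᵖ _
      mul_smul := fun a b f => twistedEnd_ext fun m => mul_smul a b _
      smul_zero := fun a => twistedEnd_ext fun m => smul_zero a
      smul_add := fun a f g => twistedEnd_ext fun m => smul_add a _ _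
      add_smul := fun a b f => twistedEnd_ext fun m => add_smul a b _
      zero_smul := fun f => twistedEnd_ext fun m => zero_smul Bᵐᵒᵖ _ }
  { carrier := M.LeftTwist φ
    leftTower := ⟨fun c b f => twistedEnd_ext fun m =>
      (congrArg f.1 (smul_assoc c (MulOpposite.op b) m)).trans (map_smul f.1 c _)⟩
    rightTower := ⟨fun c b f => twistedEnd_ext fun m => smul_assoc c b _⟩
    smulComm := ⟨fun a b f => twistedEnd_ext fun m => rfl⟩
    grading := parityGrading (M.leftTwistParity φ)
    isInternal := isInternal_parityGrading fun f => twistedEnd_ext fun m => by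
      change parity M.isInternal (parity M.isInternal (f.1 (parity M.isInternal
        (parity M.isInternal m)))) = f.1 m
      rw [parity_parity, parity_parity]
    left_mem := fun {i j b f} hb hf => (M.mem_leftTwist_grading).2 fun m => by
      change parity M.isInternal (f.1 (MulOpposite.op b • m)) =
        paritySign 𝕜 (i + j) • f.1 (MulOpposite.op b • parity M.isInternal m)
      rw [(M.mem_leftTwist_grading).1 hf, parity_op_smul, (mem_iff_parity _).1 hb, MulOpposite.op_smul,
        smul_assoc, map_smul, paritySign_add, mul_comm, mul_smul]
    right_mem := fun {i j f b} hf hb => (M.mem_leftTwist_grading).2 fun m => by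
      change parity M.isInternal (MulOpposite.op b • f.1 m) =
        paritySign 𝕜 (i + j) • MulOpposite.op b • f.1 (parity M.isInternal m)
      rw [parity_op_smul, (mem_iff_parity _).1 hb, (M.mem_leftTwist_grading).1 hf, MulOpposite.op_smul,
        smul_assoc, smul_algebra_smul_comm (paritySign 𝕜 i), paritySign_add, mul_comm, mul_smul] }

variable [FiniteDimensional 𝕜 A] [FiniteDimensional 𝕜 B] {M}

/-- The product of a ψ-twisted and a ψ⁻¹-twisted endomorphism is `B`-linear, so it is an element of
`A`. The products in the two orders form a Morita context, whose associativity is that of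
composition; the identity is a sum of products because `M` is a progenerator. -/
theorem nonempty_tensorIso_rightTwist (h : IsMoritaPair Bᵐᵒᵖ A M) {ψ ψ' : evenAut ℬ}
    (h1 : ψ * ψ' = 1) (h2 : ψ' * ψ = 1) :
    Nonempty (TensorIso (M.rightTwist ψ) (M.rightTwist ψ') (regular 𝒜)) := by
  have h1' : ∀ b : B, (ψ : B ≃ₐ[𝕜] B) ((ψ' : B ≃ₐ[𝕜] B) b) = b := fun b =>
    DFunLike.congr_fun (congrArg Subtype.val h1) b
  have h2' : ∀ b : B, (ψ' : B ≃ₐ[𝕜] B) ((ψ : B ≃ₐ[𝕜] B) b) = b := fun b =>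
    DFunLike.congr_fun (congrArg Subtype.val h2) b
  let β : M.RightTwist ψ →ₗ[𝕜] M.RightTwist ψ' →ₗ[𝕜] A := twistedPairing h
    fun r => congrArg MulOpposite.op (h1' r.unop)
  let γ : M.RightTwist ψ' →ₗ[𝕜] M.RightTwist ψ →ₗ[𝕜] A := twistedPairing h
    fun r => congrArg MulOpposite.op (h2' r.unop)
  have hβ : ∀ (f : M.RightTwist ψ) (g : M.RightTwist ψ') (m : M), β f g • m = f.1 (g.1 m) :=
    twistedPairing_smul h _
  have hγ : ∀ (g : M.RightTwist ψ') (f : M.RightTwist ψ) (m : M), γ g f • m = g.1 (f.1 m) :=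
    twistedPairing_smul h _
  have hgr : ∀ i j, ∀ f ∈ parityGrading (M.rightTwistParity ψ) i,
      ∀ g ∈ parityGrading (M.rightTwistParity ψ') j, β f g ∈ 𝒜 (i + j) :=
    fun i j f hf g hg => mem_left_of_parity h fun m => by
      rw [hβ, hβ, (M.mem_rightTwist_grading).1 hf, (M.mem_rightTwist_grading).1 hg, map_smul,
        smul_smul, paritySign_add]
  obtain ⟨n, f, g, hf, hg, hfg⟩ := h.exists_sum_mul_eq_one (𝕜 := 𝕜) (AlgEquiv.op (ψ : B ≃ₐ[𝕜] B))
  have hg' : ∀ i, g i ∈ M.RightTwist ψ' := fun i r m => by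
    rw [hg i r m]
    congr 1
    rw [AlgEquiv.symm_apply_eq]
    exact congrArg MulOpposite.op (h1' r.unop).symm
  refine nonempty_tensorIso (P := M.rightTwist ψ) (Q := M.rightTwist ψ') β γ
    (fun a f g => h.eq_of_smul_eq fun m => ?_) (fun f g a => h.eq_of_smul_eq fun m => ?_)
    (fun f a g => h.eq_of_smul_eq fun m => ?_) hgr
    (fun f g f' => twistedEnd_ext fun m => ?_) (fun g f g' => twistedEnd_ext fun m => ?_)
    (fun i => ⟨f i, hf i⟩) (fun i => ⟨g i, hg' i⟩) (h.eq_of_smul_eq fun m => ?_)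
  · exact (hβ _ _ m).trans ((congrArg (a • ·) (hβ f g m).symm).trans (mul_smul a (β f g) m).symm)
  · exact (hβ _ _ m).trans ((hβ f g (a • m)).symm.trans (mul_smul (β f g) a m).symm)
  · exact (hβ _ _ m).trans (hβ f (twistedPost a g) m).symm
  · exact (hβ f g (f'.1 m)).trans (congrArg f.1 (hγ g f' m).symm)
  · exact (hγ g f (g'.1 m)).trans (congrArg g.1 (hβ f g' m).symm)
  · rw [Finset.sum_smul, one_smul]
    refine (Finset.sum_congr rfl fun i _ => hβ ⟨f i, hf i⟩ ⟨g i, hg' i⟩ m).trans ?_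
    have := LinearMap.congr_fun hfg m
    rwa [LinearMap.sum_apply] at this

theorem nonempty_tensorIso_leftTwist (h : IsMoritaPair A Bᵐᵒᵖ M) {φ φ' : evenAut 𝒜}
    (h1 : φ * φ' = 1) (h2 : φ' * φ = 1) :
    Nonempty (TensorIso (M.leftTwist φ) (M.leftTwist φ') (regular ℬ)) := by
  have h1' : ∀ a : A, (φ : A ≃ₐ[𝕜] A) ((φ' : A ≃ₐ[𝕜] A) a) = a := fun a =>
    DFunLike.congr_fun (congrArg Subtype.val h1) a
  have h2' : ∀ a : A, (φ' : A ≃ₐ[𝕜] A) ((φ : A ≃ₐ[𝕜] A) a) = a := fun a =>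
    DFunLike.congr_fun (congrArg Subtype.val h2) a
  -- `B` acts from the right on `M`, so the pairing of `f` and `g` is the composition `g ∘ f`, and
  -- the factors are flipped.
  let β : M.LeftTwist φ →ₗ[𝕜] M.LeftTwist φ' →ₗ[𝕜] B :=
    (twistedPairing h h2').flip.compr₂ (MulOpposite.opLinearEquiv 𝕜).symm.toLinearMap
  let γ : M.LeftTwist φ' →ₗ[𝕜] M.LeftTwist φ →ₗ[𝕜] B :=
    (twistedPairing h h1').flip.compr₂ (MulOpposite.opLinearEquiv 𝕜).symm.toLinearMap
  have hβ : ∀ (f : M.LeftTwist φ) (g : M.LeftTwist φ') (m : M),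
      MulOpposite.op (β f g) • m = g.1 (f.1 m) := fun f g m => twistedPairing_smul h h2' g f m
  have hγ : ∀ (g : M.LeftTwist φ') (f : M.LeftTwist φ) (m : M),
      MulOpposite.op (γ g f) • m = f.1 (g.1 m) := fun g f m => twistedPairing_smul h h1' f g m
  have ext : ∀ {b b' : B}, (∀ m : M, MulOpposite.op b • m = MulOpposite.op b' • m) → b = b' :=
    fun hb => MulOpposite.op_injective (h.eq_of_smul_eq hb)
  have hgr : ∀ i j, ∀ f ∈ parityGrading (M.leftTwistParity φ) i,
      ∀ g ∈ parityGrading (M.leftTwistParity φ') j, β f g ∈ ℬ (i + j) :=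
    fun i j f hf g hg => mem_right_of_parity h fun m => by
      rw [hβ, hβ, (M.mem_leftTwist_grading).1 hg, (M.mem_leftTwist_grading).1 hf, map_smul,
        smul_smul, paritySign_add, mul_comm]
  -- The lemma is applied to φ' so that the products appear in the order `g ∘ f` of the pairing.
  obtain ⟨n, g, f, hg, hf, hfg⟩ := h.exists_sum_mul_eq_one (𝕜 := 𝕜) (φ' : A ≃ₐ[𝕜] A)
  have hf' : ∀ i, f i ∈ M.LeftTwist φ := fun i r m => by
    rw [hf i r m]
    congr 1
    rw [AlgEquiv.symm_apply_eq, h2']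
  refine nonempty_tensorIso (P := M.leftTwist φ) (Q := M.leftTwist φ') β γ
    (fun b f g => ext fun m => ?_) (fun f g b => ext fun m => ?_)
    (fun f b g => ext fun m => ?_) hgr
    (fun f g f' => twistedEnd_ext fun m => ?_) (fun g f g' => twistedEnd_ext fun m => ?_)
    (fun i => ⟨f i, hf' i⟩) (fun i => ⟨g i, hg i⟩) (ext fun m => ?_)
  · exact (hβ _ _ m).trans ((hβ f g (MulOpposite.op b • m)).symm.trans
      (mul_smul (MulOpposite.op (β f g)) (MulOpposite.op b) m).symm)
  · exact (hβ _ _ m).trans ((congrArg (MulOpposite.op b • ·) (hβ f g m).symm).trans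
      (mul_smul (MulOpposite.op b) (MulOpposite.op (β f g)) m).symm)
  · exact (hβ _ _ m).trans (hβ f (twistedPre (MulOpposite.op b) g) m).symm
  · exact (congrArg f'.1 (hβ f g m)).trans (hγ g f' (f.1 m)).symm
  · exact (congrArg g'.1 (hγ g f m)).trans (hβ f g' (g.1 m)).symm
  · rw [MulOpposite.op_one, one_smul, Finset.op_sum, Finset.sum_smul]
    refine (Finset.sum_congr rfl fun i _ => hβ ⟨f i, hf' i⟩ ⟨g i, hg i⟩ m).trans ?_
    have := LinearMap.congr_fun hfg m
    rwa [LinearMap.sum_apply] at this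

theorem isInvertible_rightTwist (h : IsMoritaPair Bᵐᵒᵖ A M) (ψ : evenAut ℬ) :
    (M.rightTwist ψ).IsInvertible :=
  ⟨M.rightTwist ψ⁻¹, nonempty_tensorIso_rightTwist h (mul_inv_cancel ψ) (inv_mul_cancel ψ),
    nonempty_tensorIso_rightTwist h (inv_mul_cancel ψ) (mul_inv_cancel ψ)⟩

theorem isInvertible_leftTwist (h : IsMoritaPair A Bᵐᵒᵖ M) (φ : evenAut 𝒜) :
    (M.leftTwist φ).IsInvertible :=
  ⟨M.leftTwist φ⁻¹, nonempty_tensorIso_leftTwist h (mul_inv_cancel φ) (inv_mul_cancel φ),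
    nonempty_tensorIso_leftTwist h (inv_mul_cancel φ) (mul_inv_cancel φ)⟩

/-- If `A` is Picard-surjective, then every even automorphism of `B` is covered by a triple. -/
theorem exists_triple_of_right (h : IsMoritaPair Bᵐᵒᵖ A M) (hA : PicardSurjective 𝒜)
    (ψ : evenAut ℬ) : ∃ k : M.tripleGroup, k.1.2.1 = ψ := by
  obtain ⟨φ, ⟨F⟩⟩ := hA _ (isInvertible_rightTwist h ψ)
  let e : M.RightTwist ψ ≃ₗ[𝕜] A := F.toEquiv
  have he1 : ∀ (a : A) (f : M.RightTwist ψ), e (twistedPost a f) = a * e f := F.map_left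
  have he2 : ∀ (a : A) (f : M.RightTwist ψ), e (twistedPre a f) = e f * (φ : A ≃ₐ[𝕜] A) a :=
    F.map_right
  have he3 : ∀ i, ∀ f ∈ parityGrading (M.rightTwistParity ψ) i, e f ∈ 𝒜 i := F.map_grading
  -- In A_φ the left action of φ(a) and the right action of a agree on 1. For the corresponding `f`
  -- this says f(am) = φ(a) f(m).
  set f := e.symm 1
  have hef : e f = 1 := e.apply_symm_apply 1
  have hpost : ∀ a, e.symm a = twistedPost a f := fun a => by
    rw [LinearEquiv.symm_apply_eq, he1, hef, mul_one]
  have hfa : ∀ (a : A) (m : M), f.1 (a • m) = (φ : A ≃ₐ[𝕜] A) a • f.1 m := by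
    intro a m
    have : twistedPre a f = twistedPost ((φ : A ≃ₐ[𝕜] A) a) f :=
      e.injective (by rw [he1, he2, hef, one_mul, mul_one])
    exact LinearMap.congr_fun (congrArg Subtype.val this) m
  -- The isomorphism commutes with the parities, and 1 is even.
  have heven : f ∈ parityGrading (M.rightTwistParity ψ) 0 := by
    have hgr : DirectSum.IsInternal (parityGrading (M.rightTwistParity ψ)) :=
      (M.rightTwist ψ).isInternal
    have hp := (homogeneous_iff_parity hgr (DirectSum.Decomposition.isInternal 𝒜) e.toLinearMap
      0).1 (fun i x hx => by rw [zero_add]; exact he3 i x hx) f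
    rw [paritySign_zero, one_smul, LinearEquiv.coe_coe, hef,
      (mem_iff_parity (DirectSum.Decomposition.isInternal 𝒜)).1 SetLike.GradedOne.one_mem,
      paritySign_zero, one_smul, ← hef, e.injective.eq_iff] at hp
    rw [mem_iff_parity hgr, ← hp, paritySign_zero, one_smul]
  obtain ⟨n, u, v, hu, hv, huv⟩ := h.exists_sum_mul_eq_one (𝕜 := 𝕜) (AlgEquiv.op (ψ : B ≃ₐ[𝕜] B))
  -- Every ψ-twisted uᵢ is aᵢ f for some aᵢ in A. Hence m = ∑ uᵢ(vᵢ(m)) = ∑ aᵢ f(vᵢ(m)) = f(∑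
  -- φ⁻¹(aᵢ) vᵢ(m)).
  have hsurj : Function.Surjective f.1 := by
    intro m
    have hm := LinearMap.congr_fun huv m
    rw [LinearMap.sum_apply, Module.End.one_apply] at hm
    refine ⟨∑ i, (φ : A ≃ₐ[𝕜] A).symm (e ⟨u i, hu i⟩) • v i m, ?_⟩
    rw [map_sum]
    refine Eq.trans ?_ hm
    refine Finset.sum_congr rfl fun i _ => ?_
    rw [hfa, AlgEquiv.apply_symm_apply]
    have := hpost (e ⟨u i, hu i⟩)
    rw [e.symm_apply_apply] at this
    exact (LinearMap.congr_fun (congrArg Subtype.val this) (v i m)).symm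
  let f' : M ≃ₗ[𝕜] M := LinearEquiv.ofBijective f.1
    ⟨LinearMap.injective_iff_surjective.2 hsurj, hsurj⟩
  refine ⟨⟨(φ, ψ, f'), (even_iff_parity M.isInternal f').2 fun m => ?_, fun a b m => ?_⟩, rfl⟩
  · have := (M.mem_rightTwist_grading).1 heven m
    rwa [paritySign_zero, one_smul] at this
  · change f.1 (a • MulOpposite.op b • m) = _
    rw [hfa, f.2]
    rfl

/-- If `B` is Picard-surjective, then every even automorphism of `A` is covered by a triple. -/
theorem exists_triple_of_left (h : IsMoritaPair A Bᵐᵒᵖ M) (hB : PicardSurjective ℬ)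
    (φ : evenAut 𝒜) : ∃ k : M.tripleGroup, k.1.1 = φ := by
  obtain ⟨ψ, ⟨F⟩⟩ := hB _ (isInvertible_leftTwist h φ)
  let e : M.LeftTwist φ ≃ₗ[𝕜] B := F.toEquiv
  have he1 : ∀ (b : B) (f : M.LeftTwist φ), e (twistedPre (MulOpposite.op b) f) = b * e f :=
    F.map_left
  have he2 : ∀ (b : B) (f : M.LeftTwist φ),
      e (twistedPost (MulOpposite.op b) f) = e f * (ψ : B ≃ₐ[𝕜] B) b := F.map_right
  have he3 : ∀ i, ∀ f ∈ parityGrading (M.leftTwistParity φ) i, e f ∈ ℬ i := F.map_grading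
  set f := e.symm 1
  have hef : e f = 1 := e.apply_symm_apply 1
  have hfb : ∀ (b : B) (m : M), f.1 (MulOpposite.op ((ψ : B ≃ₐ[𝕜] B) b) • m) =
      MulOpposite.op b • f.1 m := by
    intro b m
    have : twistedPre (MulOpposite.op ((ψ : B ≃ₐ[𝕜] B) b)) f = twistedPost (MulOpposite.op b) f :=
      e.injective (by rw [he1, he2, hef, one_mul, mul_one])
    exact LinearMap.congr_fun (congrArg Subtype.val this) m
  have hpost : ∀ b, e.symm ((ψ : B ≃ₐ[𝕜] B) b) = twistedPost (MulOpposite.op b) f := fun b => by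
    rw [LinearEquiv.symm_apply_eq, he2, hef, one_mul]
  -- In `leftTwist` the right action of `B` is on the values of `f`, so the isomorphism with B_ψ
  -- gives f(m ψ(b)) = f(m) b. The automorphism in the triple is therefore ψ⁻¹.
  have hfb' : ∀ (b : B) (m : M), f.1 (MulOpposite.op b • m) =
      MulOpposite.op (((ψ⁻¹ : evenAut ℬ) : B ≃ₐ[𝕜] B) b) • f.1 m := fun b m => by
    rw [← hfb]
    congr 3
    exact ((ψ : B ≃ₐ[𝕜] B).apply_symm_apply b).symm
  have heven : f ∈ parityGrading (M.leftTwistParity φ) 0 := by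
    have hgr : DirectSum.IsInternal (parityGrading (M.leftTwistParity φ)) :=
      (M.leftTwist φ).isInternal
    have hp := (homogeneous_iff_parity hgr (DirectSum.Decomposition.isInternal ℬ) e.toLinearMap
      0).1 (fun i x hx => by rw [zero_add]; exact he3 i x hx) f
    rw [paritySign_zero, one_smul, LinearEquiv.coe_coe, hef,
      (mem_iff_parity (DirectSum.Decomposition.isInternal ℬ)).1 SetLike.GradedOne.one_mem,
      paritySign_zero, one_smul, ← hef, e.injective.eq_iff] at hp
    rw [mem_iff_parity hgr, ← hp, paritySign_zero, one_smul]
  obtain ⟨n, u, v, hu, hv, huv⟩ := h.exists_sum_mul_eq_one (𝕜 := 𝕜) (φ : A ≃ₐ[𝕜] A)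
  have hsurj : Function.Surjective f.1 := by
    intro m
    have hm := LinearMap.congr_fun huv m
    rw [LinearMap.sum_apply, Module.End.one_apply] at hm
    refine ⟨∑ i, MulOpposite.op (e ⟨u i, hu i⟩) • v i m, ?_⟩
    rw [map_sum]
    refine Eq.trans ?_ hm
    refine Finset.sum_congr rfl fun i _ => ?_
    rw [hfb']
    have := hpost (((ψ⁻¹ : evenAut ℬ) : B ≃ₐ[𝕜] B) (e ⟨u i, hu i⟩))
    rw [show (ψ : B ≃ₐ[𝕜] B) (((ψ⁻¹ : evenAut ℬ) : B ≃ₐ[𝕜] B) (e ⟨u i, hu i⟩)) = e ⟨u i, hu i⟩ from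
      (ψ : B ≃ₐ[𝕜] B).apply_symm_apply _, e.symm_apply_apply] at this
    exact (LinearMap.congr_fun (congrArg Subtype.val this) (v i m)).symm
  let f' : M ≃ₗ[𝕜] M := LinearEquiv.ofBijective f.1
    ⟨LinearMap.injective_iff_surjective.2 hsurj, hsurj⟩
  refine ⟨⟨(φ, ψ⁻¹, f'), (even_iff_parity M.isInternal f').2 fun m => ?_, fun a b m => ?_⟩, rfl⟩
  · have := (M.mem_leftTwist_grading).1 heven m
    rwa [paritySign_zero, one_smul] at this
  · change f.1 (a • MulOpposite.op b • m) = _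
    rw [f.2, hfb']
    rfl

end SuperBimodule

/-! ### Coordinates on spaces of linear maps -/

section CoordinateMaps
variable {𝕜 : Type v} [RCLike 𝕜] {V W : Type*} [AddCommGroup V] [Module 𝕜 V] [FiniteDimensional 𝕜 V]
  [AddCommGroup W] [Module 𝕜 W] [FiniteDimensional 𝕜 W]

/-- A linear map, in coordinates. -/
def coordMap (T : V →ₗ[𝕜] W) :
    (Fin (Module.finrank 𝕜 V) → 𝕜) →L[ℝ] (Fin (Module.finrank 𝕜 W) → 𝕜) :=
  LinearMap.toContinuousLinearMap
    (((coordEquiv 𝕜 W).toLinearMap ∘ₗ T ∘ₗ (coordEquiv 𝕜 V).symm.toLinearMap).restrictScalars ℝ)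

theorem coordMap_apply (T : V →ₗ[𝕜] W) (x : Fin (Module.finrank 𝕜 V) → 𝕜) :
    coordMap T x = coordEquiv 𝕜 W (T ((coordEquiv 𝕜 V).symm x)) := rfl

theorem endCoord_add (S T : Module.End 𝕜 V) :
    endCoord 𝕜 V (S + T) = endCoord 𝕜 V S + endCoord 𝕜 V T := by
  ext x : 1
  simp [endCoord_apply]

theorem endCoord_real_smul (c : ℝ) (T : Module.End 𝕜 V) :
    endCoord 𝕜 V ((c : 𝕜) • T) = c • endCoord 𝕜 V T := by
  ext x : 1
  rw [smul_apply, RCLike.real_smul_eq_coe_smul (K := 𝕜)]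
  simp [endCoord_apply]

theorem endCoord_injective : Function.Injective (endCoord 𝕜 V) := fun S T h =>
  LinearMap.ext fun x => by rw [← ofCoord_endCoord S, h, ofCoord_endCoord]

/-- A linear family of endomorphisms, in coordinates. -/
def coordAct (l : V →ₗ[𝕜] Module.End 𝕜 W) :
    (Fin (Module.finrank 𝕜 V) → 𝕜) →L[ℝ] CoordEnd 𝕜 W :=
  LinearMap.toContinuousLinearMap
    { toFun := fun v => endCoord 𝕜 W (l ((coordEquiv 𝕜 V).symm v))
      map_add' := fun v w => by rw [map_add, map_add, endCoord_add]
      map_smul' := fun c v => by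
        rw [RCLike.real_smul_eq_coe_smul (K := 𝕜), map_smul, map_smul, endCoord_real_smul]
        rfl }

theorem coordAct_apply (l : V →ₗ[𝕜] Module.End 𝕜 W) (v : Fin (Module.finrank 𝕜 V) → 𝕜) :
    coordAct l v = endCoord 𝕜 W (l ((coordEquiv 𝕜 V).symm v)) := rfl

theorem coordAct_coordEquiv (l : V →ₗ[𝕜] Module.End 𝕜 W) (x : V) :
    coordAct l (coordEquiv 𝕜 V x) = endCoord 𝕜 W (l x) := by
  rw [coordAct_apply, LinearEquiv.symm_apply_apply]

/-- A faithful action embeds the algebra linearly into the operators. A linear left inverse recovers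
the algebra element by a formula that is smooth on all operators; real linearity is enough for this.
-/
theorem exists_coordAct_leftInverse {l : V →ₗ[𝕜] Module.End 𝕜 W} (hl : Function.Injective l) :
    ∃ ρ : CoordEnd 𝕜 W →L[ℝ] (Fin (Module.finrank 𝕜 V) → 𝕜), ∀ v, ρ (coordAct l v) = v := by
  obtain ⟨g, hg⟩ := LinearMap.exists_leftInverse_of_injective
    ((coordAct l : _ →L[ℝ] CoordEnd 𝕜 W) : _ →ₗ[ℝ] CoordEnd 𝕜 W)
    (LinearMap.ker_eq_bot.2 fun v w h =>
      (coordEquiv 𝕜 V).symm.injective (hl (endCoord_injective h)))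
  exact ⟨LinearMap.toContinuousLinearMap g, LinearMap.congr_fun hg⟩

/-- The transformation of `V` induced by conjugation on `End(W)`, in coordinates. -/
def conjCoord (l : V →ₗ[𝕜] Module.End 𝕜 W)
    (ρ : CoordEnd 𝕜 W →L[ℝ] (Fin (Module.finrank 𝕜 V) → 𝕜)) (U : CoordEnd 𝕜 W) : CoordEnd 𝕜 V :=
  (ρ.comp ((ContinuousLinearMap.compL ℝ _ _ _ U).comp
    ((ContinuousLinearMap.compL ℝ _ _ _).flip (Ring.inverse U)))).comp (coordAct l)

/-- `Ring.inverse` makes the formula total; it is smooth at units. -/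
theorem contDiffAt_conjCoord (l : V →ₗ[𝕜] Module.End 𝕜 W)
    (ρ : CoordEnd 𝕜 W →L[ℝ] (Fin (Module.finrank 𝕜 V) → 𝕜)) {U : CoordEnd 𝕜 W} (hU : IsUnit U) :
    ContDiffAt ℝ ∞ (conjCoord l ρ) U := by
  obtain ⟨U, rfl⟩ := hU
  have h1 : ContDiffAt ℝ ∞ (Ring.inverse : CoordEnd 𝕜 W → CoordEnd 𝕜 W) U :=
    contDiffAt_ringInverse (R := CoordEnd 𝕜 W) ℝ (n := ∞) U
  let F := Fin (Module.finrank 𝕜 W) → 𝕜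
  have h2 : ContDiff ℝ ∞ fun U : F →L[ℝ] F => ContinuousLinearMap.compL ℝ F F F U :=
    ContinuousLinearMap.contDiff (𝕜 := ℝ) _
  have h3 : ContDiff ℝ ∞ fun U : F →L[ℝ] F => (ContinuousLinearMap.compL ℝ F F F).flip U :=
    ContinuousLinearMap.contDiff (𝕜 := ℝ) _
  exact (contDiffAt_const.clm_comp (h2.contDiffAt.clm_comp (h3.contDiffAt.comp _ h1))).clm_comp
    contDiffAt_const

/-- If `f` carries the family `l` to itself along φ, then conjugation of `l x` by `f` gives `l (φ
x)`, and `ρ` recovers the argument. Thus φ is a smooth function of `f` alone. -/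
theorem conjCoord_eq (l : V →ₗ[𝕜] Module.End 𝕜 W)
    {ρ : CoordEnd 𝕜 W →L[ℝ] (Fin (Module.finrank 𝕜 V) → 𝕜)} (hρ : ∀ v, ρ (coordAct l v) = v)
    (f : W ≃ₗ[𝕜] W) (φ : V ≃ₗ[𝕜] V) (h : ∀ x w, f (l x w) = l (φ x) (f w)) :
    conjCoord l ρ (glCoord 𝕜 W f : CoordEnd 𝕜 W) = (glCoord 𝕜 V φ : CoordEnd 𝕜 V) := by
  ext x : 1
  have h1 : (glCoord 𝕜 W f : CoordEnd 𝕜 W) * coordAct l x *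
      Ring.inverse (glCoord 𝕜 W f : CoordEnd 𝕜 W) =
      coordAct l (coordEquiv 𝕜 V (φ ((coordEquiv 𝕜 V).symm x))) := by
    rw [Ring.inverse_unit, Units.mul_inv_eq_iff_eq_mul, coordAct_coordEquiv, coordAct_apply]
    refine ofCoord_injective fun w => ?_
    rw [ofCoord_mul, ofCoord_mul, ofCoord_glCoord, ofCoord_glCoord, ofCoord_endCoord,
      ofCoord_endCoord, h]
  change ρ ((glCoord 𝕜 W f : CoordEnd 𝕜 W) * (coordAct l x *
      Ring.inverse (glCoord 𝕜 W f : CoordEnd 𝕜 W))) = _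
  rw [← mul_assoc, h1, hρ, glCoord_apply]

/-- The map `T ↦ ∑ ξᵢ ∘ T ∘ λᵢ`, in coordinates. -/
def coordSandwich {n : ℕ} (ξ : Fin n → V →ₗ[𝕜] W) (l : Fin n → W →ₗ[𝕜] V) :
    CoordEnd 𝕜 V →L[ℝ] CoordEnd 𝕜 W :=
  LinearMap.toContinuousLinearMap
    { toFun := fun u => ∑ i, (coordMap (ξ i)).comp (u.comp (coordMap (l i)))
      map_add' := fun u u' => by
        rw [← Finset.sum_add_distrib]
        refine Finset.sum_congr rfl fun i _ => ?_
        rw [ContinuousLinearMap.add_comp, ContinuousLinearMap.comp_add]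
      map_smul' := fun c u => by
        rw [Finset.smul_sum]
        refine Finset.sum_congr rfl fun i _ => ?_
        rw [ContinuousLinearMap.smul_comp, ContinuousLinearMap.comp_smul]
        rfl }

theorem coordSandwich_endCoord {n : ℕ} (ξ : Fin n → V →ₗ[𝕜] W) (l : Fin n → W →ₗ[𝕜] V)
    (T : Module.End 𝕜 V) :
    coordSandwich ξ l (endCoord 𝕜 V T) = endCoord 𝕜 W (∑ i, ξ i ∘ₗ T ∘ₗ l i) := by
  ext x : 1
  simp [coordSandwich, endCoord_apply, coordMap_apply, LinearMap.sum_apply]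

/-- The map `T ↦ (F + ε F ε) / 2` with `F = ∑ ξᵢ ∘ T ∘ λᵢ`, in coordinates. -/
theorem exists_coord_family {n : ℕ} (ξ : Fin n → V →ₗ[𝕜] W) (l : Fin n → W →ₗ[𝕜] V)
    (ε : Module.End 𝕜 W) : ∃ Θ : CoordEnd 𝕜 V →L[ℝ] CoordEnd 𝕜 W, ∀ T : Module.End 𝕜 V,
      Θ (endCoord 𝕜 V T) = endCoord 𝕜 W ((2⁻¹ : 𝕜) • ((∑ i, ξ i ∘ₗ T ∘ₗ l i) +
        ε * (∑ i, ξ i ∘ₗ T ∘ₗ l i) * ε)) := by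
  refine ⟨(2⁻¹ : ℝ) • (coordSandwich ξ l + coordSandwich (fun i => ε ∘ₗ ξ i) fun i => l i ∘ₗ ε),
    fun T => ?_⟩
  rw [smul_apply, add_apply, coordSandwich_endCoord, coordSandwich_endCoord, ← endCoord_add,
    ← endCoord_real_smul, Finset.mul_sum, Finset.sum_mul]
  simp only [RCLike.ofReal_inv, RCLike.ofReal_ofNat]
  rfl

/-- An endomorphism is invertible if it is in coordinates. -/
theorem exists_equiv_of_isUnit {T : Module.End 𝕜 V} (hT : IsUnit (endCoord 𝕜 V T)) :
    ∃ f : V ≃ₗ[𝕜] V, (∀ x, f x = T x) ∧ (glCoord 𝕜 V f : CoordEnd 𝕜 V) = endCoord 𝕜 V T := by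
  obtain ⟨u, hu⟩ := hT
  -- The inverse in coordinates is only known to be real linear. Injectivity suffices, since `T` is
  -- a 𝕜-linear endomorphism of a finite-dimensional space.
  have hinj : Function.Injective T := fun x y hxy => by
    rw [← ofCoord_inv_apply u x, ← ofCoord_inv_apply u y, hu, ofCoord_endCoord, ofCoord_endCoord, hxy]
  refine ⟨LinearEquiv.ofInjectiveEndo T hinj, fun x => rfl, ofCoord_injective fun x => ?_⟩
  rw [ofCoord_glCoord, ofCoord_endCoord]
  rfl

end CoordinateMaps

/-! ### The butterfly of an invertible bimodule -/

namespace SuperBimodule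
variable {𝕜 : Type v} [RCLike 𝕜] {A B : Type u} [Ring A] [Algebra 𝕜 A] [FiniteDimensional 𝕜 A]
  [Ring B] [Algebra 𝕜 B] [FiniteDimensional 𝕜 B]
  {𝒜 : ZMod 2 → Submodule 𝕜 A} {ℬ : ZMod 2 → Submodule 𝕜 B} (M : SuperBimodule 𝒜 ℬ)

/-- The left action of `A`, as a linear family of endomorphisms. -/
def leftOp : A →ₗ[𝕜] Module.End 𝕜 M := (Algebra.lsmul 𝕜 𝕜 M : A →ₐ[𝕜] Module.End 𝕜 M).toLinearMap

/-- The right action of `B`, as a linear family of endomorphisms. -/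
def rightOp : B →ₗ[𝕜] Module.End 𝕜 M :=
  (Algebra.lsmul 𝕜 𝕜 M : Bᵐᵒᵖ →ₐ[𝕜] Module.End 𝕜 M).toLinearMap ∘ₗ
    (MulOpposite.opLinearEquiv 𝕜).toLinearMap

theorem leftOp_injective {M : SuperBimodule 𝒜 ℬ} (h : IsMoritaPair Bᵐᵒᵖ A M) :
    Function.Injective M.leftOp := fun _ _ hab => h.eq_of_smul_eq (LinearMap.congr_fun hab)

theorem rightOp_injective {M : SuperBimodule 𝒜 ℬ} (h : IsMoritaPair A Bᵐᵒᵖ M) :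
    Function.Injective M.rightOp := fun _ _ hab =>
  MulOpposite.op_injective (h.eq_of_smul_eq (LinearMap.congr_fun hab))

theorem contDiff_coordAct {V W : Type*} [AddCommGroup V] [Module 𝕜 V] [FiniteDimensional 𝕜 V]
    [AddCommGroup W] [Module 𝕜 W] [FiniteDimensional 𝕜 W] (l : V →ₗ[𝕜] Module.End 𝕜 W) :
    ContDiff ℝ ∞ (coordAct l) := ContinuousLinearMap.contDiff (𝕜 := ℝ) _

theorem contMDiff_tripleRep : ContMDiff (𝓡 M.tripleLie.dim) 𝓘(ℝ, M.TripleAlg) ∞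
    (fun k : M.tripleLie => (M.tripleRep k : M.TripleAlg)) :=
  LieGrp.contMDiff_val_ofClosed M.tripleRep_injective M.isClosed_range_tripleRep

theorem contMDiff_tripleRep_snd : ContMDiff (𝓡 M.tripleLie.dim) 𝓘(ℝ, CoordEnd 𝕜 M) ∞
    (fun k : M.tripleLie => (M.tripleRep k : M.TripleAlg).2.2) :=
  (contDiff_snd.comp contDiff_snd : ContDiff ℝ ∞
    fun u : M.TripleAlg => u.2.2).contMDiff.comp M.contMDiff_tripleRep

/-- The first projection, as a homomorphism of Lie groups. -/
def projLeft : M.tripleLie →* autLie 𝒜 := (MonoidHom.fst _ _).comp M.tripleGroup.subtype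

/-- The second projection, as a homomorphism of Lie groups. -/
def projRight : M.tripleLie →* autLie ℬ :=
  (MonoidHom.fst _ _).comp ((MonoidHom.snd _ _).comp M.tripleGroup.subtype)

theorem contMDiff_projLeft : ContMDiff (𝓡 M.tripleLie.dim) (𝓡 (autLie 𝒜).dim) ∞ M.projLeft :=
  LieGrp.contMDiff_ofClosed_iff.2 ((contDiff_fst : ContDiff ℝ ∞
    fun u : M.TripleAlg => u.1).contMDiff.comp M.contMDiff_tripleRep)

theorem contMDiff_projRight : ContMDiff (𝓡 M.tripleLie.dim) (𝓡 (autLie ℬ).dim) ∞ M.projRight :=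
  LieGrp.contMDiff_ofClosed_iff.2 ((contDiff_fst.comp contDiff_snd : ContDiff ℝ ∞
    fun u : M.TripleAlg => u.2.1).contMDiff.comp M.contMDiff_tripleRep)

variable [GradedAlgebra 𝒜] [GradedAlgebra ℬ]

/-- The inclusion of `A₀ˣ`, as a homomorphism of Lie groups. -/
def inclLeftLie : unitsLie 𝒜 →* M.tripleLie := M.inclLeft

/-- The inclusion of `B₀ˣ`, as a homomorphism of Lie groups. -/
def inclRightLie : unitsLie ℬ →* M.tripleLie := M.inclRight

/-- An even unit, as an element of the algebra. -/
def unitVal (a : evenUnits 𝒜) : A := ((a : Aˣ) : A)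

/-- Even units depend smoothly, in coordinates, on the point of the Lie group of even units. -/
theorem contMDiff_coordEquiv_unit : ContMDiff (𝓡 (unitsLie 𝒜).dim)
    𝓘(ℝ, Fin (Module.finrank 𝕜 A) → 𝕜) ∞
    (fun a : unitsLie 𝒜 => coordEquiv 𝕜 A (unitVal (𝒜 := 𝒜) a)) := by
  have h1 : ContMDiff (𝓡 (unitsLie 𝒜).dim) 𝓘(ℝ, CoordEnd 𝕜 A) ∞
      (fun a : unitsLie 𝒜 => (evenUnitsRep 𝒜 a : CoordEnd 𝕜 A)) :=
    LieGrp.contMDiff_val_ofClosed (evenUnitsRep_injective 𝒜) (isClosed_range_evenUnitsRep 𝒜)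
  have h2 : ContDiff ℝ ∞ fun u : CoordEnd 𝕜 A => u (coordEquiv 𝕜 A 1) :=
    contDiff_id.clm_apply contDiff_const
  refine (h2.contMDiff.comp h1).congr fun a => ?_
  change _ = coordEquiv 𝕜 A (unitVal (𝒜 := 𝒜) a *
    (coordEquiv 𝕜 A).symm (coordEquiv 𝕜 A 1))
  rw [LinearEquiv.symm_apply_apply, mul_one]

theorem contMDiff_inclLeftLie :
    ContMDiff (𝓡 (unitsLie 𝒜).dim) (𝓡 M.tripleLie.dim) ∞ M.inclLeftLie := by
  refine LieGrp.contMDiff_ofClosed_iff.2 ?_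
  have h1 : ContMDiff (𝓡 (unitsLie 𝒜).dim) 𝓘(ℝ, CoordEnd 𝕜 A) ∞
      (fun a : unitsLie 𝒜 => (evenAutRep 𝒜 (innerAut 𝒜 a) : CoordEnd 𝕜 A)) :=
    LieGrp.contMDiff_ofClosed_iff.1 (contMDiff_innerAutLie 𝒜)
  have h2 : ContMDiff (𝓡 (unitsLie 𝒜).dim) 𝓘(ℝ, CoordEnd 𝕜 M) ∞
      (fun a : unitsLie 𝒜 => coordAct M.leftOp (coordEquiv 𝕜 A (unitVal (𝒜 := 𝒜) a))) :=
    (contDiff_coordAct M.leftOp).contMDiff.comp contMDiff_coordEquiv_unit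
  refine (h1.prodMk_space ((contMDiff_const (c := (1 : CoordEnd 𝕜 B))).prodMk_space h2)).congr
    fun a => ?_
  rw [coordAct_coordEquiv]
  exact Prod.ext rfl (Prod.ext (congrArg Units.val (map_one (evenAutRep ℬ))) rfl)

theorem contMDiff_inclRightLie :
    ContMDiff (𝓡 (unitsLie ℬ).dim) (𝓡 M.tripleLie.dim) ∞ M.inclRightLie := by
  refine LieGrp.contMDiff_ofClosed_iff.2 ?_
  have h1 : ContMDiff (𝓡 (unitsLie ℬ).dim) 𝓘(ℝ, CoordEnd 𝕜 B) ∞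
      (fun b : unitsLie ℬ => (evenAutRep ℬ (innerAut ℬ b) : CoordEnd 𝕜 B)) :=
    LieGrp.contMDiff_ofClosed_iff.1 (contMDiff_innerAutLie ℬ)
  have h2 : ContMDiff (𝓡 (unitsLie ℬ).dim) 𝓘(ℝ, CoordEnd 𝕜 M) ∞
      (fun b : unitsLie ℬ => coordAct M.rightOp
        (coordEquiv 𝕜 B (unitVal (𝒜 := ℬ) (b⁻¹ : unitsLie ℬ)))) :=
    (contDiff_coordAct M.rightOp).contMDiff.comp (contMDiff_coordEquiv_unit.comp
      (contMDiff_inv (𝓡 (unitsLie ℬ).dim) ∞ (G := unitsLie ℬ)))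
  refine ((contMDiff_const (c := (1 : CoordEnd 𝕜 A))).prodMk_space (h1.prodMk_space h2)).congr
    fun b => ?_
  rw [coordAct_coordEquiv]
  exact Prod.ext (congrArg Units.val (map_one (evenAutRep 𝒜))) (Prod.ext rfl rfl)

variable {M}

/-- The third component of i₁(a) is the action of a on M, from which `ρ` extracts a. The result is
turned into left multiplication on A, the form in which A₀ˣ is embedded as a linear group. -/
theorem exists_retraction_left (h : IsMoritaPair Bᵐᵒᵖ A M) : ∃ L : M.tripleLie → CoordEnd 𝕜 A,
    ContMDiff (𝓡 M.tripleLie.dim) 𝓘(ℝ, CoordEnd 𝕜 A) ∞ L ∧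
      ∀ a : unitsLie 𝒜, L (M.inclLeftLie a) = (evenUnitsRep 𝒜 a : CoordEnd 𝕜 A) := by
  obtain ⟨ρ, hρ⟩ := exists_coordAct_leftInverse (leftOp_injective h)
  refine ⟨fun k => coordAct (Algebra.lmul 𝕜 A).toLinearMap (ρ (M.tripleRep k : M.TripleAlg).2.2),
    (contDiff_coordAct (Algebra.lmul 𝕜 A).toLinearMap).contMDiff.comp
      ((ρ.contDiff (n := ∞)).contMDiff.comp M.contMDiff_tripleRep_snd), fun a => ?_⟩
  have h1 : (M.tripleRep (M.inclLeft a) : M.TripleAlg).2.2 =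
      coordAct M.leftOp (coordEquiv 𝕜 A (unitVal (𝒜 := 𝒜) a)) := by
    rw [coordAct_coordEquiv]
    rfl
  change coordAct (Algebra.lmul 𝕜 A).toLinearMap (ρ (M.tripleRep (M.inclLeft a) : M.TripleAlg).2.2) = _
  rw [h1, hρ, coordAct_coordEquiv]
  rfl

/-- i₂(b) acts through b⁻¹, so the element of K is inverted before b is extracted. -/
theorem exists_retraction_right (h : IsMoritaPair A Bᵐᵒᵖ M) : ∃ L : M.tripleLie → CoordEnd 𝕜 B,
    ContMDiff (𝓡 M.tripleLie.dim) 𝓘(ℝ, CoordEnd 𝕜 B) ∞ L ∧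
      ∀ b : unitsLie ℬ, L (M.inclRightLie b) = (evenUnitsRep ℬ b : CoordEnd 𝕜 B) := by
  obtain ⟨ρ, hρ⟩ := exists_coordAct_leftInverse (rightOp_injective h)
  refine ⟨fun k => coordAct (Algebra.lmul 𝕜 B).toLinearMap
      (ρ (M.tripleRep (k⁻¹ : M.tripleLie) : M.TripleAlg).2.2),
    (contDiff_coordAct (Algebra.lmul 𝕜 B).toLinearMap).contMDiff.comp
      ((ρ.contDiff (n := ∞)).contMDiff.comp (M.contMDiff_tripleRep_snd.comp
        (contMDiff_inv (𝓡 M.tripleLie.dim) ∞ (G := M.tripleLie)))), fun b => ?_⟩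
  change evenUnits ℬ at b
  have h1 : (M.tripleRep (M.inclRight b⁻¹) : M.TripleAlg).2.2 =
      coordAct M.rightOp (coordEquiv 𝕜 B (unitVal (𝒜 := ℬ) b)) := by
    rw [coordAct_coordEquiv]
    refine ofCoord_injective fun m => (ofCoord_glCoord _ m).trans ?_
    rw [ofCoord_endCoord]
    change MulOpposite.op (((b⁻¹⁻¹ : evenUnits ℬ) : Bˣ) : B) • m = _
    rw [inv_inv]
    rfl
  change coordAct (Algebra.lmul 𝕜 B).toLinearMap (ρ (M.tripleRep (M.inclRight b)⁻¹ : M.TripleAlg).2.2) = _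
  rw [← map_inv, h1, hρ, coordAct_coordEquiv]
  rfl

/-! ### Local sections -/

/-- τ is conjugation by `f` on the faithful action of `A`, so it commutes with the parity of `A`
when `f` commutes with the parity of `M`. -/
theorem mem_evenAut_of_left (h : IsMoritaPair Bᵐᵒᵖ A M) {f : M ≃ₗ[𝕜] M}
    (hf : ∀ m, parity M.isInternal (f m) = f (parity M.isInternal m)) {τ : A ≃ₐ[𝕜] A}
    (hτ : ∀ (a : A) m, f (a • m) = τ a • f m) : τ ∈ evenAut 𝒜 := by
  refine (even_iff_parity (DirectSum.Decomposition.isInternal 𝒜) τ.toLinearEquiv).2 fun a =>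
    h.eq_of_smul_eq fun m => ?_
  obtain ⟨m, rfl⟩ := f.surjective m
  obtain ⟨m, rfl⟩ : ∃ m', parity M.isInternal m' = m := ⟨_, parity_parity _ m⟩
  change parity _ (τ a) • f (parity _ m) = τ (parity _ a) • f (parity _ m)
  rw [← hτ, ← parity_smul, ← hf, ← hf, hτ, parity_smul]

theorem mem_evenAut_of_right (h : IsMoritaPair A Bᵐᵒᵖ M) {f : M ≃ₗ[𝕜] M}
    (hf : ∀ m, parity M.isInternal (f m) = f (parity M.isInternal m)) {τ : B ≃ₐ[𝕜] B}
    (hτ : ∀ (b : B) m, f (MulOpposite.op b • m) = MulOpposite.op (τ b) • f m) :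
    τ ∈ evenAut ℬ := by
  refine (even_iff_parity (DirectSum.Decomposition.isInternal ℬ) τ.toLinearEquiv).2 fun b =>
    MulOpposite.op_injective (h.eq_of_smul_eq fun m => ?_)
  obtain ⟨m, rfl⟩ := f.surjective m
  obtain ⟨m, rfl⟩ : ∃ m', parity M.isInternal m' = m := ⟨_, parity_parity _ m⟩
  change MulOpposite.op (parity _ (τ b)) • f (parity _ m) =
    MulOpposite.op (τ (parity _ b)) • f (parity _ m)
  rw [← hτ, ← parity_op_smul, ← hf, ← hf, hτ, parity_op_smul]

/-- The dual basis yields F_T(m) = ∑ xᵢ T(lᵢ(m)), which is linear in T, equals the identity for T =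
1 and is ψ-twisted for T = ψ. Its average with its parity conjugate is moreover even and is
invertible near T = 1. Only automorphisms near the identity are covered, and Picard-surjectivity
plays no role here. -/
theorem hasLocalSections_projRight (h : IsMoritaPair Bᵐᵒᵖ A M) : HasLocalSections M.projRight := by
  obtain ⟨n, x, l, hl⟩ := h.dualBasis
  obtain ⟨ρ, hρ⟩ := exists_coordAct_leftInverse (leftOp_injective h)
  let ε := parity M.isInternal
  let ξ : Fin n → B →ₗ[𝕜] M := fun i =>
    (LinearMap.toSpanSingleton Bᵐᵒᵖ M (x i)).restrictScalars 𝕜 ∘ₗ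
      (MulOpposite.opLinearEquiv 𝕜).toLinearMap
  let l' : Fin n → M →ₗ[𝕜] B := fun i =>
    (MulOpposite.opLinearEquiv 𝕜).symm.toLinearMap ∘ₗ (l i).restrictScalars 𝕜
  let F : Module.End 𝕜 B → Module.End 𝕜 M := fun T => ∑ i, ξ i ∘ₗ T ∘ₗ l' i
  have hF : ∀ T m, F T m = ∑ i, MulOpposite.op (T (l i m).unop) • x i := fun T m => by
    simp only [F, LinearMap.sum_apply]
    rfl
  obtain ⟨Θ, hΘ⟩ := exists_coord_family ξ l' ε
  have hΘs : ContDiff ℝ ∞ Θ := ContinuousLinearMap.contDiff (𝕜 := ℝ) _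
  let P : Module.End 𝕜 B → Module.End 𝕜 M := fun T => (2⁻¹ : 𝕜) • (F T + ε * F T * ε)
  have hP : ∀ T m, P T m = (2⁻¹ : 𝕜) • (F T m + ε (F T (ε m))) := fun _ _ => rfl
  have hΘ1 : Θ 1 = 1 := by
    have hF1 : F 1 = 1 := LinearMap.ext fun m => by
      rw [hF]
      exact hl m
    rw [← map_one (endCoord 𝕜 B), hΘ, ← map_one (endCoord 𝕜 M)]
    congr 1
    refine LinearMap.ext fun m => ?_
    change P 1 m = m
    rw [hP, hF1, Module.End.one_apply, Module.End.one_apply, parity_parity, ← two_smul 𝕜 m, smul_smul,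
      inv_mul_cancel₀ two_ne_zero, one_smul]
  -- The section is written on an open set of the ambient algebra: it is defined wherever the
  -- averaged map is invertible, with the component in GL(A) given by conjugation.
  refine hasLocalSections_ofClosed (O := {u | IsUnit (Θ u)})
    (s := fun u => ((conjCoord M.leftOp ρ (Θ u), u, Θ u) : M.TripleAlg))
    ((Units.isOpen (R := CoordEnd 𝕜 M)).preimage hΘs.continuous) (by
      change IsUnit (Θ 1)
      rw [hΘ1]
      exact isUnit_one) (fun u hu => ?_) fun ψ hψ => ?_
  · have h1 : ContDiffAt ℝ ∞ Θ u := hΘs.contDiffAt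
    exact (((contDiffAt_conjCoord M.leftOp ρ hu).comp u h1).prodMk
      (contDiffAt_id.prodMk h1)).contDiffWithinAt
  · change evenAut ℬ at ψ
    let T : Module.End 𝕜 B := (ψ : B ≃ₐ[𝕜] B).toLinearMap
    have hT : (evenAutRep ℬ ψ : CoordEnd 𝕜 B) = endCoord 𝕜 B T := rfl
    change IsUnit (Θ (evenAutRep ℬ ψ : CoordEnd 𝕜 B)) at hψ
    rw [hT, hΘ] at hψ
    obtain ⟨f, hf, hfc⟩ := exists_equiv_of_isUnit hψ
    have hf : ∀ m, f m = (2⁻¹ : 𝕜) • (F T m + ε (F T (ε m))) := hf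
    have hFb : ∀ (r : Bᵐᵒᵖ) m, F T (r • m) = AlgEquiv.op (ψ : B ≃ₐ[𝕜] B) r • F T m := fun r m => by
      rw [hF, hF, Finset.smul_sum]
      refine Finset.sum_congr rfl fun i _ => ?_
      rw [map_smul, smul_smul]
      congr 1
      exact congrArg MulOpposite.op (map_mul (ψ : B ≃ₐ[𝕜] B) _ _)
    have hfb : ∀ (r : Bᵐᵒᵖ) m, f (r • m) = AlgEquiv.op (ψ : B ≃ₐ[𝕜] B) r • f m := fun r m => by
      -- The parity conjugate is again ψ-twisted because ψ is even; this is the membership proof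
      -- contained in `twistedConj`.
      have hε : ε (F T (ε (r • m))) = AlgEquiv.op (ψ : B ≃ₐ[𝕜] B) r • ε (F T (ε m)) :=
        (twistedConj ε
          (fun r => MulOpposite.op (parity (DirectSum.Decomposition.isInternal ℬ) r.unop))
          (fun r m => M.parity_op_smul r.unop m)
          (fun r => by
            change MulOpposite.op (parity _ ((ψ : B ≃ₐ[𝕜] B) (parity _ r.unop))) = _
            rw [parity_evenAut, parity_parity]
            rfl) ⟨F T, hFb⟩).2 r m
      rw [hf, hf, hFb, hε, ← smul_add, smul_algebra_smul_comm]
    have hfε : ∀ m, ε (f m) = f (ε m) := fun m => by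
      rw [hf, hf, map_smul, map_add, parity_parity, parity_parity, add_comm]
    obtain ⟨τ, hτ⟩ := h.exists_algEquiv f hfb
    have hτε : τ ∈ evenAut 𝒜 := mem_evenAut_of_left h hfε hτ
    refine ⟨(⟨(⟨τ, hτε⟩, ψ, f), (even_iff_parity M.isInternal f).2 hfε, fun a b m => ?_⟩ :
      M.tripleGroup), ?_, rfl⟩
    · change f (a • MulOpposite.op b • m) = τ a • _
      rw [hτ, hfb]
      rfl
    · refine Prod.ext ?_ (Prod.ext rfl ?_)
      · change (glCoord 𝕜 A τ.toLinearEquiv : CoordEnd 𝕜 A) =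
          conjCoord M.leftOp ρ (Θ (evenAutRep ℬ ψ : CoordEnd 𝕜 B))
        rw [hT, hΘ, ← hfc]
        exact (conjCoord_eq M.leftOp hρ f τ.toLinearEquiv hτ).symm
      · change (glCoord 𝕜 M f : CoordEnd 𝕜 M) = Θ (evenAutRep ℬ ψ : CoordEnd 𝕜 B)
        rw [hT, hΘ, ← hfc]

/-- The same construction with a dual basis of `M` over `A`; here the third component determines the
automorphism of `B`. -/
theorem hasLocalSections_projLeft (h : IsMoritaPair A Bᵐᵒᵖ M) : HasLocalSections M.projLeft := by
  obtain ⟨n, x, l, hl⟩ := h.dualBasis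
  obtain ⟨ρ, hρ⟩ := exists_coordAct_leftInverse (rightOp_injective h)
  let ε := parity M.isInternal
  let ξ : Fin n → A →ₗ[𝕜] M := fun i => (LinearMap.toSpanSingleton A M (x i)).restrictScalars 𝕜
  let l' : Fin n → M →ₗ[𝕜] A := fun i => (l i).restrictScalars 𝕜
  let F : Module.End 𝕜 A → Module.End 𝕜 M := fun T => ∑ i, ξ i ∘ₗ T ∘ₗ l' i
  have hF : ∀ T m, F T m = ∑ i, T (l i m) • x i := fun T m => by
    simp only [F, LinearMap.sum_apply]
    rfl
  obtain ⟨Θ, hΘ⟩ := exists_coord_family ξ l' ε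
  have hΘs : ContDiff ℝ ∞ Θ := ContinuousLinearMap.contDiff (𝕜 := ℝ) _
  let P : Module.End 𝕜 A → Module.End 𝕜 M := fun T => (2⁻¹ : 𝕜) • (F T + ε * F T * ε)
  have hP : ∀ T m, P T m = (2⁻¹ : 𝕜) • (F T m + ε (F T (ε m))) := fun _ _ => rfl
  have hΘ1 : Θ 1 = 1 := by
    have hF1 : F 1 = 1 := LinearMap.ext fun m => by
      rw [hF]
      exact hl m
    rw [← map_one (endCoord 𝕜 A), hΘ, ← map_one (endCoord 𝕜 M)]
    congr 1
    refine LinearMap.ext fun m => ?_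
    change P 1 m = m
    rw [hP, hF1, Module.End.one_apply, Module.End.one_apply, parity_parity, ← two_smul 𝕜 m, smul_smul,
      inv_mul_cancel₀ two_ne_zero, one_smul]
  refine hasLocalSections_ofClosed (O := {u | IsUnit (Θ u)})
    (s := fun u => ((u, conjCoord M.rightOp ρ (Θ u), Θ u) : M.TripleAlg))
    ((Units.isOpen (R := CoordEnd 𝕜 M)).preimage hΘs.continuous) (by
      change IsUnit (Θ 1)
      rw [hΘ1]
      exact isUnit_one) (fun u hu => ?_) fun φ hφ => ?_
  · have h1 : ContDiffAt ℝ ∞ Θ u := hΘs.contDiffAt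
    exact (contDiffAt_id.prodMk
      (((contDiffAt_conjCoord M.rightOp ρ hu).comp u h1).prodMk h1)).contDiffWithinAt
  · change evenAut 𝒜 at φ
    let T : Module.End 𝕜 A := (φ : A ≃ₐ[𝕜] A).toLinearMap
    have hT : (evenAutRep 𝒜 φ : CoordEnd 𝕜 A) = endCoord 𝕜 A T := rfl
    change IsUnit (Θ (evenAutRep 𝒜 φ : CoordEnd 𝕜 A)) at hφ
    rw [hT, hΘ] at hφ
    obtain ⟨f, hf, hfc⟩ := exists_equiv_of_isUnit hφ
    have hf : ∀ m, f m = (2⁻¹ : 𝕜) • (F T m + ε (F T (ε m))) := hf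
    have hFa : ∀ (r : A) m, F T (r • m) = (φ : A ≃ₐ[𝕜] A) r • F T m := fun r m => by
      rw [hF, hF, Finset.smul_sum]
      refine Finset.sum_congr rfl fun i _ => ?_
      rw [map_smul, smul_smul]
      congr 1
      exact map_mul (φ : A ≃ₐ[𝕜] A) _ _
    have hfa : ∀ (r : A) m, f (r • m) = (φ : A ≃ₐ[𝕜] A) r • f m := fun r m => by
      have hε : ε (F T (ε (r • m))) = (φ : A ≃ₐ[𝕜] A) r • ε (F T (ε m)) :=
        (twistedConj ε (parity (DirectSum.Decomposition.isInternal 𝒜)) M.parity_smul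
          (fun r => by rw [parity_evenAut, parity_parity]) ⟨F T, hFa⟩).2 r m
      rw [hf, hf, hFa, hε, ← smul_add, smul_algebra_smul_comm]
    have hfε : ∀ m, ε (f m) = f (ε m) := fun m => by
      rw [hf, hf, map_smul, map_add, parity_parity, parity_parity, add_comm]
    obtain ⟨σ, hσ⟩ := h.exists_algEquiv f hfa
    -- Conjugation by `f` gives an automorphism of `Bᵐᵒᵖ`, which is the same as one of `B`.
    let τ : B ≃ₐ[𝕜] B := AlgEquiv.op.symm σ
    have hτ : ∀ (b : B) m, f (MulOpposite.op b • m) = MulOpposite.op (τ b) • f m :=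
      fun b m => hσ (MulOpposite.op b) m
    have hτε : τ ∈ evenAut ℬ := mem_evenAut_of_right h hfε hτ
    refine ⟨(⟨(φ, ⟨τ, hτε⟩, f), (even_iff_parity M.isInternal f).2 hfε, fun a b m => ?_⟩ :
      M.tripleGroup), ?_, rfl⟩
    · change f (a • MulOpposite.op b • m) = _
      rw [hfa, hτ]
    · refine Prod.ext rfl (Prod.ext ?_ ?_)
      · change (glCoord 𝕜 B τ.toLinearEquiv : CoordEnd 𝕜 B) =
          conjCoord M.rightOp ρ (Θ (evenAutRep 𝒜 φ : CoordEnd 𝕜 A))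
        rw [hT, hΘ, ← hfc]
        exact (conjCoord_eq M.rightOp hρ f τ.toLinearEquiv hτ).symm
      · change (glCoord 𝕜 M f : CoordEnd 𝕜 M) = Θ (evenAutRep 𝒜 φ : CoordEnd 𝕜 A)
        rw [hT, hΘ, ← hfc]

end SuperBimodule

/-! ### Exactness -/

/-- An `R`-linear automorphism is given by a unit of the endomorphism ring. -/
theorem IsMoritaPair.exists_unit {𝕜 : Type v} [RCLike 𝕜] {R C M : Type*} [Ring R] [Algebra 𝕜 R]
    [Ring C] [Algebra 𝕜 C] [AddCommGroup M] [Module 𝕜 M] [Module R M] [IsScalarTower 𝕜 R M]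
    [Module C M] [IsScalarTower 𝕜 C M] [SMulCommClass C R M] (h : IsMoritaPair R C M)
    (f : M ≃ₗ[𝕜] M) (hf : ∀ (r : R) m, f (r • m) = r • f m) : ∃ c : Cˣ, ∀ m, (c : C) • m = f m := by
  obtain ⟨c, hc⟩ := h.exists_smul_eq (𝕜 := 𝕜) (f := f.toLinearMap) hf
  obtain ⟨d, hd⟩ := h.exists_smul_eq (𝕜 := 𝕜) (f := f.symm.toLinearMap) fun r m => by
    change f.symm (r • m) = r • f.symm m
    rw [LinearEquiv.symm_apply_eq, hf, LinearEquiv.apply_symm_apply]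
  exact ⟨⟨c, d, h.eq_of_smul_eq fun m => by rw [mul_smul, hd, hc, one_smul]; exact f.apply_symm_apply m,
    h.eq_of_smul_eq fun m => by rw [mul_smul, hc, hd, one_smul]; exact f.symm_apply_apply m⟩, hc⟩

namespace SuperBimodule
variable {𝕜 : Type v} [RCLike 𝕜] {A B : Type u} [Ring A] [Algebra 𝕜 A] [FiniteDimensional 𝕜 A]
  [Ring B] [Algebra 𝕜 B] [FiniteDimensional 𝕜 B]
  {𝒜 : ZMod 2 → Submodule 𝕜 A} {ℬ : ZMod 2 → Submodule 𝕜 B} {M : SuperBimodule 𝒜 ℬ}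
  [GradedAlgebra 𝒜] [GradedAlgebra ℬ]

theorem triple_smul (k : M.tripleGroup) (a : A) (m : M) :
    k.1.2.2 (a • m) = (k.1.1 : A ≃ₐ[𝕜] A) a • k.1.2.2 m := by
  have := k.2.2 a 1 m
  rwa [map_one, MulOpposite.op_one, one_smul, one_smul] at this

theorem triple_op_smul (k : M.tripleGroup) (b : B) (m : M) :
    k.1.2.2 (MulOpposite.op b • m) = MulOpposite.op ((k.1.2.1 : B ≃ₐ[𝕜] B) b) • k.1.2.2 m := by
  have := k.2.2 1 b m
  rwa [map_one, one_smul, one_smul] at this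

theorem parity_triple (k : M.tripleGroup) (m : M) :
    parity M.isInternal (k.1.2.2 m) = k.1.2.2 (parity M.isInternal m) :=
  (even_iff_parity M.isInternal k.1.2.2).1 k.2.1 m

/-- φ is redundant in a triple: φ(a) f(m) = f(am) determines it, as f is surjective and A acts
faithfully. -/
theorem triple_ext_left (h : IsMoritaPair Bᵐᵒᵖ A M) {k k' : M.tripleGroup}
    (hψ : k.1.2.1 = k'.1.2.1) (hf : ∀ m, k.1.2.2 m = k'.1.2.2 m) : k = k' := by
  refine Subtype.ext (Prod.ext (Subtype.ext (AlgEquiv.ext fun a => h.eq_of_smul_eq fun m => ?_))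
    (Prod.ext hψ (LinearEquiv.ext hf)))
  obtain ⟨m, rfl⟩ := k.1.2.2.surjective m
  rw [← triple_smul, hf, hf, triple_smul]

theorem triple_ext_right (h : IsMoritaPair A Bᵐᵒᵖ M) {k k' : M.tripleGroup}
    (hφ : k.1.1 = k'.1.1) (hf : ∀ m, k.1.2.2 m = k'.1.2.2 m) : k = k' := by
  refine Subtype.ext (Prod.ext hφ (Prod.ext (Subtype.ext (AlgEquiv.ext fun b =>
    MulOpposite.op_injective (h.eq_of_smul_eq fun m => ?_))) (LinearEquiv.ext hf)))
  obtain ⟨m, rfl⟩ := k.1.2.2.surjective m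
  rw [← triple_op_smul, hf, hf, triple_op_smul]

/-- If ψ = id, then f is right B-linear, so it is the action of a unit of A. The unit is even
because f commutes with the parity. -/
theorem range_inclLeftLie (h : IsMoritaPair Bᵐᵒᵖ A M) : M.inclLeftLie.range = M.projRight.ker := by
  ext k
  refine ⟨fun ⟨a, ha⟩ => ha ▸ rfl, fun hk => ?_⟩
  change M.tripleGroup at k
  have hk : k.1.2.1 = 1 := hk
  obtain ⟨a, ha⟩ := h.exists_unit k.1.2.2 fun r m => by
    have := triple_op_smul k r.unop m
    rwa [hk] at this
  have ha0 : (a : A) ∈ 𝒜 0 := mem_left_of_parity h fun m => by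
    rw [ha, ha, parity_triple, paritySign_zero, one_smul]
  exact ⟨(⟨a, ha0⟩ : evenUnits 𝒜), triple_ext_left h hk.symm ha⟩

theorem range_inclRightLie (h : IsMoritaPair A Bᵐᵒᵖ M) :
    M.inclRightLie.range = M.projLeft.ker := by
  ext k
  refine ⟨fun ⟨b, hb⟩ => hb ▸ rfl, fun hk => ?_⟩
  change M.tripleGroup at k
  have hk : k.1.1 = 1 := hk
  obtain ⟨c, hc⟩ := h.exists_unit k.1.2.2 fun r m => by
    have := triple_smul k r m
    rwa [hk] at this
  let b : Bˣ := ⟨(c : Bᵐᵒᵖ).unop, ((c⁻¹ : (Bᵐᵒᵖ)ˣ) : Bᵐᵒᵖ).unop,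
    congrArg MulOpposite.unop c.inv_mul, congrArg MulOpposite.unop c.mul_inv⟩
  have hb0 : (b : B) ∈ ℬ 0 := mem_right_of_parity h fun m => by
    change parity _ ((c : Bᵐᵒᵖ) • m) = _ • (c : Bᵐᵒᵖ) • _
    rw [hc, hc, parity_triple, paritySign_zero, one_smul]
  -- The preimage is b⁻¹, because i₂ lets a unit act through its inverse.
  refine ⟨((⟨b, hb0⟩ : evenUnits ℬ)⁻¹ : evenUnits ℬ), triple_ext_right h hk.symm fun m => ?_⟩
  rw [← hc]
  change MulOpposite.op (((b⁻¹⁻¹ : Bˣ)) : B) • m = _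
  rw [inv_inv]
  rfl

theorem isLieShortExact_left (h : IsMoritaPair Bᵐᵒᵖ A M) (hA : PicardSurjective 𝒜) :
    IsLieShortExact M.inclLeftLie M.projRight := by
  obtain ⟨L, hL, hLi⟩ := exists_retraction_left h
  have he : Topology.IsEmbedding M.inclLeftLie :=
    isEmbedding_of_retraction hL hLi M.contMDiff_inclLeftLie.continuous
  exact
    { smooth_left := M.contMDiff_inclLeftLie
      smooth_right := M.contMDiff_projRight
      injective := he.injective
      exact := range_inclLeftLie h
      surjective := exists_triple_of_right h hA
      embedding := he
      immersion := mfderiv_injective_of_retraction hL hLi M.contMDiff_inclLeftLie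
      submersion := (hasLocalSections_projRight h).mfderiv_surjective M.contMDiff_projRight }

theorem isLieShortExact_right (h : IsMoritaPair A Bᵐᵒᵖ M) (hB : PicardSurjective ℬ) :
    IsLieShortExact M.inclRightLie M.projLeft := by
  obtain ⟨L, hL, hLi⟩ := exists_retraction_right h
  have he : Topology.IsEmbedding M.inclRightLie :=
    isEmbedding_of_retraction hL hLi M.contMDiff_inclRightLie.continuous
  exact
    { smooth_left := M.contMDiff_inclRightLie
      smooth_right := M.contMDiff_projLeft
      injective := he.injective
      exact := range_inclRightLie h
      surjective := exists_triple_of_left h hB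
      embedding := he
      immersion := mfderiv_injective_of_retraction hL hLi M.contMDiff_inclRightLie
      submersion := (hasLocalSections_projLeft h).mfderiv_surjective M.contMDiff_projLeft }

/-- On the component in GL(M) this is f(a f⁻¹(m)) = φ(a) m, and the component in Aut(A) follows from
faithfulness. -/
theorem inclLeft_evalAct (h : IsMoritaPair Bᵐᵒᵖ A M) (k : M.tripleGroup) (a : evenUnits 𝒜) :
    M.inclLeft (evalAct 𝒜 k.1.1 a) = k * M.inclLeft a * k⁻¹ := by
  refine triple_ext_left h ?_ fun m => ?_
  · change (1 : evenAut ℬ) = k.1.2.1 * 1 * k.1.2.1⁻¹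
    rw [mul_one, mul_inv_cancel]
  · change (k.1.1 : A ≃ₐ[𝕜] A) ((a : Aˣ) : A) • m = k.1.2.2 (((a : Aˣ) : A) • k.1.2.2.symm m)
    rw [triple_smul, LinearEquiv.apply_symm_apply]

theorem inclRight_evalAct (h : IsMoritaPair A Bᵐᵒᵖ M) (k : M.tripleGroup) (b : evenUnits ℬ) :
    M.inclRight (evalAct ℬ k.1.2.1 b) = k * M.inclRight b * k⁻¹ := by
  refine triple_ext_right h ?_ fun m => ?_
  · change (1 : evenAut 𝒜) = k.1.1 * 1 * k.1.1⁻¹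
    rw [mul_one, mul_inv_cancel]
  · change MulOpposite.op ((k.1.2.1 : B ≃ₐ[𝕜] B) (((b : Bˣ)⁻¹ : Bˣ) : B)) • m =
      k.1.2.2 (MulOpposite.op (((b : Bˣ)⁻¹ : Bˣ) : B) • k.1.2.2.symm m)
    rw [triple_op_smul, LinearEquiv.apply_symm_apply]

theorem isInvertibleButterfly (hl : IsMoritaPair A Bᵐᵒᵖ M) (hr : IsMoritaPair Bᵐᵒᵖ A M)
    (hA : PicardSurjective 𝒜) (hB : PicardSurjective ℬ) : M.butterfly.IsInvertibleButterfly where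
  comm₁ _ := rfl
  comm₂ _ := rfl
  shortExact₁ := isLieShortExact_left hr hA
  shortExact₂ := isLieShortExact_right hl hB
  act₁ k a := inclLeft_evalAct hr k a
  act₂ k b := inclRight_evalAct hl k b

theorem existsUnique_cechH1_equiv (hl : IsMoritaPair A Bᵐᵒᵖ M) (hr : IsMoritaPair Bᵐᵒᵖ A M)
    (hA : PicardSurjective 𝒜) (hB : PicardSurjective ℬ)
    (E : Type*) [NormedAddCommGroup E] [NormedSpace ℝ E] [FiniteDimensional ℝ E]
    (X : Type w) [TopologicalSpace X] [T2Space X] [ParacompactSpace X] [ChartedSpace E X]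
    [IsManifold 𝓘(ℝ, E) ∞ X] :
    ∃! Φ : CechH1 E X (AUT 𝒜) ≃ CechH1 E X (AUT ℬ),
      ∀ (c : CechCocycle E X (AUT 𝒜)) (d : CechCocycle E X (AUT ℬ)),
        M.butterfly.Transports c d → Φ (Quot.mk _ c) = Quot.mk _ d := by
  obtain ⟨L, hL, hLi⟩ := exists_retraction_left hr
  obtain ⟨L', hL', hLi'⟩ := exists_retraction_right hl
  exact (isInvertibleButterfly hl hr hA hB).existsUnique_equiv (hasLocalSections_projLeft hl)
    (hasLocalSections_projRight hr) (reflectsSmooth_of_retraction hL hLi E X)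
    (reflectsSmooth_of_retraction hL' hLi' E X)

end SuperBimodule
end

/-! ### The proposition -/

theorem mainTheorem9
    {𝕜 : Type v} [RCLike 𝕜]
    {A : Type u} [Ring A] [Algebra 𝕜 A] [FiniteDimensional 𝕜 A]
    (𝒜 : ZMod 2 → Submodule 𝕜 A) [GradedAlgebra 𝒜]
    {B : Type u} [Ring B] [Algebra 𝕜 B] [FiniteDimensional 𝕜 B]
    (ℬ : ZMod 2 → Submodule 𝕜 B) [GradedAlgebra ℬ]
    (hA : PicardSurjective 𝒜) (hB : PicardSurjective ℬ)
    (E : Type*) [NormedAddCommGroup E] [NormedSpace ℝ E] [FiniteDimensional ℝ E]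
    (X : Type w) [TopologicalSpace X] [T2Space X] [ParacompactSpace X]
    [ChartedSpace E X] [IsManifold 𝓘(ℝ, E) ∞ X] :
    (∀ M : SuperBimodule 𝒜 ℬ, M.IsInvertible →
      M.butterfly.IsInvertibleButterfly ∧
      ∃! Φ : CechH1 E X (AUT 𝒜) ≃ CechH1 E X (AUT ℬ),
        ∀ (c : CechCocycle E X (AUT 𝒜)) (d : CechCocycle E X (AUT ℬ)),
          M.butterfly.Transports c d → Φ (Quot.mk _ c) = Quot.mk _ d) ∧
    (SuperMoritaEquivalent 𝒜 ℬ →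
      Nonempty (CechH1 E X (AUT 𝒜) ≃ CechH1 E X (AUT ℬ))) := by
  refine ⟨fun M hM => ⟨SuperBimodule.isInvertibleButterfly hM.isMoritaPair_left
    hM.isMoritaPair_right hA hB, SuperBimodule.existsUnique_cechH1_equiv hM.isMoritaPair_left
    hM.isMoritaPair_right hA hB E X⟩, fun ⟨M, hM⟩ => ?_⟩
  obtain ⟨Φ, -⟩ := SuperBimodule.existsUnique_cechH1_equiv hM.isMoritaPair_left
    hM.isMoritaPair_right hA hB E X
  exact ⟨Φ⟩
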